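/- **The MKT index.** Let $K=F(\sqrt D)$ be a quadratic extension of number fields and let $E$ be an elliptic curve over $F$, with quadratic twist $E_D$ (for $E: y^2=x^3+ax+b$, the curve $E_D: y^2=x^3+aD^2x+bD^3$). Let $S$ be the set of finite places of $F$ that ramify in $K$ or at which $E$ has bad reduction, let $S_0$ be the set of $v\in S$ that are ramified or inert in $K$, and for $v\in S_0$ let $w$ be the place of $K$ above $v$. The Mazur–Kramer–Tunnell index of $E$ over $K/F$ is $\delta(E,F,K)=\delta_\infty+\delta_f$, where $\delta_\infty$ is the number of real places $v$ of $F$ that ramify in $K$ and satisfy $\sigma_v(\Delta(E))>0$ ($\sigma_v$ being the corresponding real embedding), and $$\delta_f=\sum_{v\in S_0}\log_2\left(\frac{c_v\,c_{D,v}}{c_w}\left(\frac{\|\Delta_v\,\Delta_{D,v}\,d(K_w/F_v)^{-6}\|_{F_v}}{\|\Delta_w\|_{K_w}}\right)^{1/12}\right).$$ Here $c_v,c_{D,v},c_w$ are the Tamagawa factors (the index of the subgroup of points with nonsingular reduction on a minimal equation) and $\Delta_v,\Delta_{D,v},\Delta_w$ the minimal discriminants of $E/F_v$, $E_D/F_v$,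 $E/K_w$, respectively; $d(K_w/F_v)$ is the discriminant of $K_w/F_v$; and $\|a\|=(\#k)^{-\mathrm{ord}(a)}$ is the normalized absolute value, $k$ being the residue field. **Lemma 4.2.** Let $n\ne 1$ be a squarefree integer, $K=\mathbb{Q}(\sqrt n)$, and let $E=E_1$ be the elliptic curve $y^2=x^3-x$ over $\mathbb{Q}$. Let $\omega_0(n)$ be the number of odd primes dividing $n$. Then $$\delta(E_1,\mathbb{Q},K)=\begin{cases} 2\omega_0(n) & \text{if } n>0 \text{ and } n\equiv 1 \pmod 8,\\ 1+2\omega_0(n) & \text{if } n>0 \text{ and } n\equiv 5 \text{ or } 7 \pmod 8,\\ 3+2\omega_0(n) & \text{if } n>0 \text{ and } n\equiv 6 \pmod 8,\\ 2+2\omega_0(n) & \text{if } n>0 \text{ and } n\equiv 2 \text{ or } 3 \pmod 8,\\ 1+2\omega_0(n) & \text{if } n<0 \text{ and } n\equiv 1 \pmod 8,\\ 2+2\omega_0(n) & \text{if } n<0 \text{ and } n\equiv 5 \text{ or } 7 \pmod 8,\\ 3+2\omega_0(n) & \text{if } n<0 \text{ and } n\equiv 2 \text{ or } 3 \pmod 8,\\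 4+2\omega_0(n) & \text{if } n<0 \text{ and } n\equiv 6 \pmod 8. \end{cases}$$ -/

import Mathlib

open NumberField IsDedekindDomain

noncomputable section

namespace WeierstrassCurve

section Local

variable (R : Type*) [CommRing R] [IsDomain R] [IsDiscreteValuationRing R]
  {F : Type*} [Field F] [Algebra R F] [IsFractionRing R F]

open Classical in
/-- For a minimal Weierstrass equation over the fraction field of a discrete valuation ring `R`:
the subgroup `E₀` of the points whose reduction is a nonsingular point. The points without
`R`-integral affine coordinates reduce to the point at infinity, which is nonsingular, so the
condition is void for them. (The set of these points is itself a subgroup; the closure only saves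
carrying along the proof of this fact.) -/
def nonsingularReductionSubgroup (W : WeierstrassCurve F) [W.IsMinimal R] :
    AddSubgroup W.toAffine.Point :=
  AddSubgroup.closure {P | ∀ (x y : R)
    (h : W.toAffine.Nonsingular (algebraMap R F x) (algebraMap R F y)), P = .some _ _ h →
      (W.reduction R).toAffine.Nonsingular (IsLocalRing.residue R x) (IsLocalRing.residue R y)}

open Classical in
/-- The Tamagawa factor `c = (E(F) : E₀(F))`, computed on a minimal equation. -/
def tamagawaFactor (W : WeierstrassCurve F) : ℕ :=
  (nonsingularReductionSubgroup R (W.minimal R)).index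

/-- The discriminant of a minimal equation (well defined up to 12th powers of units of `R`). -/
def minimalDiscriminant (W : WeierstrassCurve F) : F := (W.minimal R).Δ

end Local

/-- The quadratic twist by `D`, over a field of characteristic different from `2`. For
`y² = x³ + a x + b` it is `y² = x³ + a D² x + b D³`. -/
def quadraticTwist {F : Type*} [Field F] (W : WeierstrassCurve F) (D : F) : WeierstrassCurve F where
  a₁ := 0
  a₂ := D * W.b₂ / 4
  a₃ := 0
  a₄ := D ^ 2 * W.b₄ / 2
  a₆ := D ^ 3 * W.b₆ / 4

end WeierstrassCurve

namespace MKT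

/-- The discriminant of a finite separable extension `L` of the fraction field `F` of a principal
ideal domain `R`: the discriminant of an `R`-basis of the integral closure of `R` in `L`
(well defined up to squares of units of `R`). -/
def extensionDiscriminant (R F L : Type*) [CommRing R] [IsDomain R] [IsPrincipalIdealRing R]
    [Field F] [Algebra R F] [IsFractionRing R F] [Field L] [Algebra F L] [Algebra R L]
    [IsScalarTower R F L] [FiniteDimensional F L] [Algebra.IsSeparable F L] : R :=
  haveI : Module.IsTorsionFree R L := .trans_faithfulSMul R F L
  haveI : IsNoetherian R (integralClosure R L) :=
    IsIntegralClosure.isNoetherian R F L (integralClosure R L)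
  haveI : Module.Free R (integralClosure R L) :=
    IsIntegralClosure.module_free R F L (integralClosure R L)
  Algebra.discr R (Module.finBasis R (integralClosure R L))

section Completion

variable {F K : Type*} [Field F] [NumberField F] [Field K] [NumberField K] [Algebra F K]
  (v : HeightOneSpectrum (𝓞 F)) (w : HeightOneSpectrum (𝓞 K)) [w.asIdeal.LiesOver v.asIdeal]

/-- The embedding `F_v → K_w` of completions, for `w` above `v`: the continuous extension of
`F → K`. -/
def completionMap : v.adicCompletion F →+* w.adicCompletion K :=
  ((HeightOneSpectrum.adicCompletion.equiv K w).symm.toRingHom.comp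
    (UniformSpace.Completion.mapRingHom
      (algebraMap (WithVal (v.valuation F)) (WithVal (w.valuation K)))
      (HeightOneSpectrum.uniformContinuous_algebraMap_liesOver F K v w).continuous)).comp
    (HeightOneSpectrum.adicCompletion.equiv F v).toRingHom

/-- `K_w` as an `F_v`-algebra. -/
abbrev completionAlgebra : Algebra (v.adicCompletion F) (w.adicCompletion K) :=
  (completionMap v w).toAlgebra

theorem continuous_completionMap : Continuous (completionMap v w) := by
  have h1 : Continuous (HeightOneSpectrum.adicCompletion.equiv F v) :=
    (HeightOneSpectrum.adicCompletion.isUniformInducing_toCompletion F v).uniformContinuous.continuous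
  have h2 : Continuous (HeightOneSpectrum.adicCompletion.equiv K w).symm :=
    (HeightOneSpectrum.adicCompletion.uniformEquiv K w).symm.continuous
  exact h2.comp (UniformSpace.Completion.continuous_map.comp h1)

theorem completionMap_algebraMap (x : F) :
    completionMap v w (algebraMap F (v.adicCompletion F) x) =
      algebraMap F (w.adicCompletion K) x := by
  apply HeightOneSpectrum.adicCompletion.ext
  rw [HeightOneSpectrum.algebraMap_adicCompletion_toCompletion]
  exact (UniformSpace.Completion.map_coe
    (HeightOneSpectrum.uniformContinuous_algebraMap_liesOver F K v w) _)

theorem finiteDimensional_completion :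
    letI := completionAlgebra v w
    FiniteDimensional (v.adicCompletion F) (w.adicCompletion K) := by
  let := completionAlgebra v w
  have : ContinuousSMul (v.adicCompletion F) (w.adicCompletion K) :=
    ⟨((continuous_completionMap v w).comp continuous_fst).mul continuous_snd⟩
  have : IsScalarTower F (v.adicCompletion F) (w.adicCompletion K) :=
    .of_algebraMap_eq fun x => (completionMap_algebraMap v w x).symm
  infer_instance

instance charZero_completion : CharZero (v.adicCompletion F) :=
  charZero_of_injective_algebraMap (algebraMap F (v.adicCompletion F)).injective

/-- The discriminant `d(K_w / F_v)`. -/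
def localDiscriminant : v.adicCompletion F :=
  letI := completionAlgebra v w
  haveI := finiteDimensional_completion v w
  algebraMap (v.adicCompletionIntegers F) (v.adicCompletion F)
    (extensionDiscriminant (v.adicCompletionIntegers F) (v.adicCompletion F) (w.adicCompletion K))

/-- The summand of the finite part of the MKT index at `v`, formed with the place `w` above `v`. The
norm on a completion is the normalized one, `‖a‖ = (#k)^(-ord a)` with `k` the residue field. -/
def localTerm (E : WeierstrassCurve F) (D : F) : ℝ :=
  Real.logb 2
    (((E.baseChange (v.adicCompletion F)).tamagawaFactor (v.adicCompletionIntegers F) : ℝ) *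
        (((E.quadraticTwist D).baseChange (v.adicCompletion F)).tamagawaFactor
          (v.adicCompletionIntegers F) : ℝ) /
        ((E.baseChange (w.adicCompletion K)).tamagawaFactor (w.adicCompletionIntegers K) : ℝ) *
      (‖(E.baseChange (v.adicCompletion F)).minimalDiscriminant (v.adicCompletionIntegers F) *
            ((E.quadraticTwist D).baseChange (v.adicCompletion F)).minimalDiscriminant
              (v.adicCompletionIntegers F) *
            localDiscriminant v w ^ (-6 : ℤ)‖ /
          ‖(E.baseChange (w.adicCompletion K)).minimalDiscriminant (w.adicCompletionIntegers K)‖) ^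
        (1 / 12 : ℝ))

end Completion

section Index

variable {F : Type*} [Field F] [NumberField F] (E : WeierstrassCurve F) (D : F)
  (K : Type*) [Field K] [NumberField K] [Algebra F K]

theorem exists_place_above (v : HeightOneSpectrum (𝓞 F)) :
    ∃ w : HeightOneSpectrum (𝓞 K), w.asIdeal.LiesOver v.asIdeal := by
  obtain ⟨P, hP, hover⟩ :=
    Ideal.exists_maximal_ideal_liesOver_of_isIntegral (S := 𝓞 K) v.asIdeal
  exact ⟨⟨P, hP.isPrime, Ideal.ne_bot_of_liesOver_of_ne_bot v.ne_bot P⟩, hover⟩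

/-- A chosen place `w` of `K` above `v`. (At the places used below there is only one.) -/
def placeAbove (v : HeightOneSpectrum (𝓞 F)) : HeightOneSpectrum (𝓞 K) :=
  (exists_place_above K v).choose

instance (v : HeightOneSpectrum (𝓞 F)) : (placeAbove K v).asIdeal.LiesOver v.asIdeal :=
  (exists_place_above K v).choose_spec

/-- `v` is ramified in `K`: the square of some prime of `K` divides `v`. -/
def IsRamifiedIn (v : HeightOneSpectrum (𝓞 F)) : Prop :=
  ∃ w : HeightOneSpectrum (𝓞 K), v.asIdeal.map (algebraMap (𝓞 F) (𝓞 K)) ≤ w.asIdeal ^ 2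

/-- `v` is inert in `K`: it stays prime. -/
def IsInertIn (v : HeightOneSpectrum (𝓞 F)) : Prop :=
  (v.asIdeal.map (algebraMap (𝓞 F) (𝓞 K))).IsPrime

/-- `E` has bad reduction at `v`. -/
def IsBadAt (v : HeightOneSpectrum (𝓞 F)) : Prop :=
  ¬ ((E.baseChange (v.adicCompletion F)).minimal (v.adicCompletionIntegers F)).HasGoodReduction
    (v.adicCompletionIntegers F)

/-- The finite places of `F` that ramify in `K` or at which `E` has bad reduction. -/
def placesS : Set (HeightOneSpectrum (𝓞 F)) := {v | IsRamifiedIn K v ∨ IsBadAt E v}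

/-- The places in `placesS` that are ramified or inert in `K`. -/
def placesS₀ : Set (HeightOneSpectrum (𝓞 F)) :=
  {v ∈ placesS E K | IsRamifiedIn K v ∨ IsInertIn K v}

/-- The number of real places of `F` that ramify in `K` and at which the discriminant of `E` is
positive. -/
def deltaInfinite : ℕ :=
  {v : InfinitePlace F | ∃ hv : v.IsReal, ¬ v.IsUnramifiedIn K ∧
    0 < InfinitePlace.embedding_of_isReal hv E.Δ}.ncard

/-- The finite part of the MKT index. -/
def deltaFinite : ℝ := ∑ᶠ v ∈ placesS₀ E K, localTerm v (placeAbove K v) E D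

/-- The Mazur–Kramer–Tunnell index `δ(E, F, K)` of an elliptic curve `E` over `F`, for
`K = F(√D)` a quadratic extension of `F`. -/
def mktIndex : ℝ := deltaInfinite E K + deltaFinite E D K

end Index

/-- The elliptic curve `y² = x³ - x` over `ℚ`. -/
def curveE₁ : WeierstrassCurve ℚ where
  a₁ := 0
  a₂ := 0
  a₃ := 0
  a₄ := -1
  a₆ := 0

/-- The number of odd prime divisors of `n`. -/
def oddPrimeCount (n : ℤ) : ℕ := (n.natAbs.primeFactors.erase 2).card

end MKT
end

/-! Over every completion the curve and its twist by n have the form y² = x³ - a²x with a = 1 or a =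
n, and discriminant 64a⁶. The index is thus a sum of local computations inside one family:
minimality, valuations of discriminants, and Tamagawa factors.

The real place contributes 1 exactly when n < 0, because Δ = 64 is positive. At an odd prime p the
curve has good reduction, so p counts only if it ramifies, that is, if p divides n. There the twist
has Tamagawa factor 4, the other two factors are 1, the norms cancel, and the term is log₂ 4 = 2
(`localTerm_of_odd_dvd`). The prime 2 is bad, so it counts unless it splits, which happens for n ≡ 1
mod 8.

At 2 all the equations in use are already minimal. This is delicate over a ramified dyadic field,
where 64 has valuation exactly 12 and a congruence argument is needed
(`isMinimal_congruentCurve_one`). The norm factor is then 2^m with m = 0 in the inert case and m = 1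
in the ramified case (`localTerm_curveE₁_eq`). Over ℚ₂ the curve has Tamagawa factor 2 and the twist
has 2 or 4, as n is odd or even.

For the Tamagawa factors, the singular point of the reduction is the image of a 2-torsion point T =
(e, 0). The points that do not reduce to it form a subgroup (`avoidsReduction_add`), and translation
by T acts on z = x - e as z ↦ (3e² - a²)/z (`congruentCurve_add_torsion`). This computes the index
of the subgroup once it is known how close to e an abscissa can be. Over a ramified dyadic field,
with a = e = 1, the constant 3e² - a² = 2 has valuation 2, and the factor is 4 or 2 according to
whether there is a point with x - 1 a uniformizer. For n ≡ 7 mod 8 the point (i, 1 - i) serves, for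
n ≡ 2 a point with x = 1 + √n; for n ≡ 3 and n ≡ 6 an expansion in powers of a uniformizer excludes
such points. The dyadic terms are therefore 1, 1, 2, 2, 3 for n ≡ 5, 7, 3, 2, 6 mod 8. -/

namespace WeierstrassCurve

/-! ### Changes of variables as isomorphisms of groups of points. -/

section VariableChange

variable {F : Type*} [Field F] (C : VariableChange F) (W : WeierstrassCurve F)

lemma variableChange_equation_iff (x y : F) :
    (C • W).toAffine.Equation x y ↔
      W.toAffine.Equation (C.u ^ 2 * x + C.r) (C.u ^ 3 * y + C.s * C.u ^ 2 * x + C.t) := by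
  have hu : (C.u : F) ≠ 0 := C.u.ne_zero
  rw [Affine.equation_iff', Affine.equation_iff', ← mul_right_inj' (pow_ne_zero 6 hu), mul_zero]
  simp only [variableChange_a₁, variableChange_a₂, variableChange_a₃, variableChange_a₄,
    variableChange_a₆, Units.val_inv_eq_inv_val]
  refine Eq.congr_left ?_
  field_simp
  ring

/-- The partial derivative with respect to `X` of a Weierstrass polynomial. -/
def partialX (x y : F) : F := W.a₁ * y - (3 * x ^ 2 + 2 * W.a₂ * x + W.a₄)

/-- The partial derivative with respect to `Y` of a Weierstrass polynomial. -/
def partialY (x y : F) : F := 2 * y + W.a₁ * x + W.a₃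

lemma nonsingular_iff_partial (x y : F) : W.toAffine.Nonsingular x y ↔
    W.toAffine.Equation x y ∧ (W.partialX x y ≠ 0 ∨ W.partialY x y ≠ 0) :=
  Affine.nonsingular_iff' ..

/-- Chain rule. The substitution turns the Weierstrass polynomial of `W` into u⁶ times that of `C •
W`; differentiating in x produces u² and su² as inner derivatives, and u² cancels. -/
lemma variableChange_partialX (x y : F) : C.u ^ 4 * (C • W).partialX x y =
    W.partialX (C.u ^ 2 * x + C.r) (C.u ^ 3 * y + C.s * C.u ^ 2 * x + C.t) +
      C.s * W.partialY (C.u ^ 2 * x + C.r) (C.u ^ 3 * y + C.s * C.u ^ 2 * x + C.t) := by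
  have hu : (C.u : F) ≠ 0 := C.u.ne_zero
  simp only [partialX, partialY, variableChange_a₁, variableChange_a₂, variableChange_a₄,
    Units.val_inv_eq_inv_val]
  field_simp
  ring

lemma variableChange_partialY (x y : F) : C.u ^ 3 * (C • W).partialY x y =
    W.partialY (C.u ^ 2 * x + C.r) (C.u ^ 3 * y + C.s * C.u ^ 2 * x + C.t) := by
  have hu : (C.u : F) ≠ 0 := C.u.ne_zero
  simp only [partialY, variableChange_a₁, variableChange_a₃, Units.val_inv_eq_inv_val]
  field_simp
  ring

lemma variableChange_nonsingular_iff (x y : F) :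
    (C • W).toAffine.Nonsingular x y ↔
      W.toAffine.Nonsingular (C.u ^ 2 * x + C.r) (C.u ^ 3 * y + C.s * C.u ^ 2 * x + C.t) := by
  have hu : (C.u : F) ≠ 0 := C.u.ne_zero
  rw [nonsingular_iff_partial, nonsingular_iff_partial, variableChange_equation_iff,
    ← not_and_or, ← not_and_or, ← mul_eq_zero_iff_left (pow_ne_zero 4 hu),
    ← mul_eq_zero_iff_left (b := (C • W).partialY x y) (pow_ne_zero 3 hu),
    variableChange_partialX, variableChange_partialY]
  refine and_congr_right fun _ => not_congr ⟨fun h => ⟨?_, h.2⟩, fun h => ⟨?_, h.2⟩⟩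
  · simpa [h.2] using h.1
  · simp [h.1, h.2]

lemma variableChange_negY (x y : F) :
    C.u ^ 3 * (C • W).toAffine.negY x y + C.s * C.u ^ 2 * x + C.t =
      W.toAffine.negY (C.u ^ 2 * x + C.r) (C.u ^ 3 * y + C.s * C.u ^ 2 * x + C.t) := by
  have hu : (C.u : F) ≠ 0 := C.u.ne_zero
  simp only [Affine.negY, variableChange_a₁, variableChange_a₃, Units.val_inv_eq_inv_val]
  field_simp
  ring

lemma variableChange_negY_eq_iff (x y y' : F) :
    y = (C • W).toAffine.negY x y' ↔ C.u ^ 3 * y + C.s * C.u ^ 2 * x + C.t =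
      W.toAffine.negY (C.u ^ 2 * x + C.r) (C.u ^ 3 * y' + C.s * C.u ^ 2 * x + C.t) := by
  have hu : (C.u : F) ≠ 0 := C.u.ne_zero
  rw [← variableChange_negY, add_left_inj, add_left_inj, mul_right_inj' (pow_ne_zero 3 hu)]

/-- Implicit differentiation. In this form the tangent slope inherits its transformation rule from
the partial derivatives. -/
lemma slope_of_Y_ne_eq_partial [DecidableEq F] {x y₁ y₂ : F}
    (hy : y₁ ≠ W.toAffine.negY x y₂) :
    W.toAffine.slope x x y₁ y₂ = -W.partialX x y₁ / W.partialY x y₁ := by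
  rw [Affine.slope_of_Y_ne rfl hy]
  congr 1
  · simp only [partialX]; ring
  · simp only [partialY, Affine.negY]; ring

/-- The substitution is affine and carries lines to lines. Secants are compared directly, tangents
by the chain rule for the partial derivatives. -/
lemma variableChange_slope [DecidableEq F] {x₁ x₂ y₁ y₂ : F}
    (h₁ : (C • W).toAffine.Equation x₁ y₁) (h₂ : (C • W).toAffine.Equation x₂ y₂)
    (hxy : ¬(x₁ = x₂ ∧ y₁ = (C • W).toAffine.negY x₂ y₂)) :
    W.toAffine.slope (C.u ^ 2 * x₁ + C.r) (C.u ^ 2 * x₂ + C.r)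
        (C.u ^ 3 * y₁ + C.s * C.u ^ 2 * x₁ + C.t) (C.u ^ 3 * y₂ + C.s * C.u ^ 2 * x₂ + C.t) =
      C.u * (C • W).toAffine.slope x₁ x₂ y₁ y₂ + C.s := by
  have hu : (C.u : F) ≠ 0 := C.u.ne_zero
  by_cases hx : x₁ = x₂
  · subst hx
    have hy : y₁ ≠ (C • W).toAffine.negY x₁ y₂ := fun h => hxy ⟨rfl, h⟩
    obtain rfl := Affine.Y_eq_of_Y_ne h₁ h₂ rfl hy
    have h0 : (C • W).partialY x₁ y₁ ≠ 0 := fun h => hy <| by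
      simp only [partialY] at h
      simp only [Affine.negY]
      linear_combination h
    rw [slope_of_Y_ne_eq_partial _ hy,
      slope_of_Y_ne_eq_partial _ (mt (variableChange_negY_eq_iff ..).mpr hy),
      ← variableChange_partialY, div_eq_iff (mul_ne_zero (pow_ne_zero 3 hu) h0)]
    have hX := variableChange_partialX C W x₁ y₁
    rw [← variableChange_partialY] at hX
    generalize W.partialX _ _ = A at *
    field_simp
    linear_combination hX
  · have hx' : x₁ - x₂ ≠ 0 := sub_ne_zero.mpr hx
    rw [Affine.slope_of_X_ne hx, Affine.slope_of_X_ne (by simpa [hu] using hx),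
      add_sub_add_right_eq_sub (C.u ^ 2 * x₁), ← mul_sub,
      div_eq_iff (mul_ne_zero (pow_ne_zero 2 hu) hx')]
    field_simp
    ring

lemma variableChange_addX (x₁ x₂ l : F) :
    C.u ^ 2 * (C • W).toAffine.addX x₁ x₂ l + C.r =
      W.toAffine.addX (C.u ^ 2 * x₁ + C.r) (C.u ^ 2 * x₂ + C.r) (C.u * l + C.s) := by
  have hu : (C.u : F) ≠ 0 := C.u.ne_zero
  simp only [Affine.addX, variableChange_a₁, variableChange_a₂, Units.val_inv_eq_inv_val]
  field_simp
  ring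

lemma variableChange_addY (x₁ x₂ y l : F) :
    C.u ^ 3 * (C • W).toAffine.addY x₁ x₂ y l +
        C.s * C.u ^ 2 * (C • W).toAffine.addX x₁ x₂ l + C.t =
      W.toAffine.addY (C.u ^ 2 * x₁ + C.r) (C.u ^ 2 * x₂ + C.r)
        (C.u ^ 3 * y + C.s * C.u ^ 2 * x₁ + C.t) (C.u * l + C.s) := by
  rw [Affine.addY, variableChange_negY, Affine.addY, variableChange_addX]
  congr 1
  rw [Affine.negAddY, Affine.negAddY, ← variableChange_addX]
  ring

lemma Affine.Point.some_congr {x y x' y' : F} (hx : x = x') (hy : y = y')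
    (h : W.toAffine.Nonsingular x y) :
    (Affine.Point.some x y h : W.toAffine.Point) = .some x' y' (hx ▸ hy ▸ h) := by
  subst hx hy; rfl

/-- The map on points given by a change of variables. -/
def variableChangePoint : (C • W).toAffine.Point → W.toAffine.Point
  | .zero => .zero
  | .some x y h => .some (C.u ^ 2 * x + C.r) (C.u ^ 3 * y + C.s * C.u ^ 2 * x + C.t)
      ((variableChange_nonsingular_iff C W x y).mp h)

lemma variableChangePoint_bijective : Function.Bijective (variableChangePoint C W) := by
  have hu : (C.u : F) ≠ 0 := C.u.ne_zero
  constructor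
  · rintro (_ | ⟨x, y, h⟩) (_ | ⟨x', y', h'⟩) H
    · rfl
    · simp [variableChangePoint] at H
    · simp [variableChangePoint] at H
    · simp only [variableChangePoint, Affine.Point.some.injEq] at H
      obtain rfl : x = x' := by simpa [hu] using H.1
      obtain rfl : y = y' := by simpa [hu] using H.2
      rfl
  · rintro (_ | ⟨x, y, h⟩)
    · exact ⟨.zero, rfl⟩
    · have hx : C.u ^ 2 * ((x - C.r) / C.u ^ 2) + C.r = x := by field_simp; ring
      have hy : C.u ^ 3 * ((y - C.s * (x - C.r) - C.t) / C.u ^ 3) +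
          C.s * C.u ^ 2 * ((x - C.r) / C.u ^ 2) + C.t = y := by field_simp; ring
      refine ⟨.some ((x - C.r) / C.u ^ 2) ((y - C.s * (x - C.r) - C.t) / C.u ^ 3) ?_, ?_⟩
      · rwa [variableChange_nonsingular_iff, hx, hy]
      · exact Affine.Point.some_congr W hx hy _

/-- A change of variables induces an isomorphism on the groups of points. -/
noncomputable def variableChangePointEquiv [DecidableEq F] :
    (C • W).toAffine.Point ≃+ W.toAffine.Point :=
  AddEquiv.mk' (Equiv.ofBijective _ (variableChangePoint_bijective C W)) <| by
    rintro (_ | ⟨x₁, y₁, h₁⟩) (_ | ⟨x₂, y₂, h₂⟩)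
    · rfl
    · rfl
    · rfl
    · simp only [Equiv.ofBijective_apply]
      by_cases hxy : x₁ = x₂ ∧ y₁ = (C • W).toAffine.negY x₂ y₂
      · rw [Affine.Point.add_of_Y_eq hxy.1 hxy.2]
        obtain ⟨rfl, hy⟩ := hxy
        exact (Affine.Point.add_of_Y_eq rfl ((variableChange_negY_eq_iff ..).mp hy)).symm
      · have hu : (C.u : F) ≠ 0 := C.u.ne_zero
        have hxy' : ¬(C.u ^ 2 * x₁ + C.r = C.u ^ 2 * x₂ + C.r ∧
            C.u ^ 3 * y₁ + C.s * C.u ^ 2 * x₁ + C.t =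
            W.toAffine.negY (C.u ^ 2 * x₂ + C.r) (C.u ^ 3 * y₂ + C.s * C.u ^ 2 * x₂ + C.t)) := by
          rintro ⟨hx, hy⟩
          obtain rfl : x₁ = x₂ := by simpa [hu] using hx
          exact hxy ⟨rfl, (variableChange_negY_eq_iff ..).mpr hy⟩
        rw [Affine.Point.add_some hxy, variableChangePoint, variableChangePoint,
          variableChangePoint, Affine.Point.add_some hxy']
        rw [Affine.Point.some.injEq, variableChange_slope C W h₁.1 h₂.1 hxy]
        exact ⟨variableChange_addX .., variableChange_addY ..⟩

lemma variableChangePointEquiv_apply [DecidableEq F] (P : (C • W).toAffine.Point) :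
    variableChangePointEquiv C W P = variableChangePoint C W P := rfl

end VariableChange
end WeierstrassCurve

namespace WeierstrassCurve

/-! ### Independence of the Tamagawa factor from the minimal equation. -/

section MinimalModels

open IsDedekindDomain.HeightOneSpectrum

variable (R : Type*) [CommRing R] [IsDomain R] [IsDiscreteValuationRing R]
  {F : Type*} [Field F] [Algebra R F] [IsFractionRing R F]

local notation "𝓿" => HeightOneSpectrum.valuation F (IsDiscreteValuationRing.maximalIdeal R)

lemma valuation_le_one_iff_mem_range (x : F) : 𝓿 x ≤ 1 ↔ x ∈ (algebraMap R F).range := by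
  constructor
  · intro h
    exact IsDiscreteValuationRing.exists_lift_of_le_one h
  · rintro ⟨r, rfl⟩
    exact valuation_le_one _ r

variable {R}

lemma mem_range_of_quartic {x p q r : F} (hp : p ∈ (algebraMap R F).range)
    (hq : q ∈ (algebraMap R F).range) (hr : r ∈ (algebraMap R F).range)
    (h : x ^ 4 + p * x ^ 2 + q * x + r = 0) : x ∈ (algebraMap R F).range := by
  obtain ⟨p, rfl⟩ := hp
  obtain ⟨q, rfl⟩ := hq
  obtain ⟨r, rfl⟩ := hr
  refine IsIntegrallyClosed.isIntegral_iff.mp ⟨.X ^ 4 + .C p * .X ^ 2 + .C q * .X + .C r, ?_, ?_⟩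
  · monicity!
  · simpa using h

lemma mem_range_of_quadratic {x p q : F} (hp : p ∈ (algebraMap R F).range)
    (hq : q ∈ (algebraMap R F).range) (h : x ^ 2 + p * x + q = 0) :
    x ∈ (algebraMap R F).range := by
  -- Multiply by x² - (px + q): the difference of squares x⁴ - (px + q)² has the shape of the
  -- quartic lemma.
  refine mem_range_of_quartic (neg_mem (pow_mem hp 2))
    (neg_mem (mul_mem (mul_mem (ofNat_mem _ 2) hp) hq)) (neg_mem (pow_mem hq 2)) ?_
  linear_combination (x ^ 2 - p * x - q) * h

omit [IsDomain R] [IsDiscreteValuationRing R] [IsFractionRing R F] in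
lemma IsIntegral.coeff_mem_range (W : WeierstrassCurve F) [IsIntegral R W] :
    W.a₁ ∈ (algebraMap R F).range ∧ W.a₂ ∈ (algebraMap R F).range ∧
      W.a₃ ∈ (algebraMap R F).range ∧ W.a₄ ∈ (algebraMap R F).range ∧
      W.a₆ ∈ (algebraMap R F).range :=
  ⟨⟨_, integralModel_a₁_eq R W⟩, ⟨_, integralModel_a₂_eq R W⟩, ⟨_, integralModel_a₃_eq R W⟩,
    ⟨_, integralModel_a₄_eq R W⟩, ⟨_, integralModel_a₆_eq R W⟩⟩

/-- A change of variables between integral equations whose scaling factor is a unit is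
integral. -/
lemma variableChange_mem_range (W : WeierstrassCurve F) [IsIntegral R W] (C : VariableChange F)
    [IsIntegral R (C • W)] (hu : (C.u : F) ∈ (algebraMap R F).range) :
    C.r ∈ (algebraMap R F).range ∧ C.s ∈ (algebraMap R F).range ∧
      C.t ∈ (algebraMap R F).range := by
  have hu0 : (C.u : F) ≠ 0 := C.u.ne_zero
  obtain ⟨h1, h2, h3, h4, h6⟩ := IsIntegral.coeff_mem_range (R := R) W
  obtain ⟨h1', h2', h3', h4', h6'⟩ := IsIntegral.coeff_mem_range (R := R) (C • W)
  have hb4 : W.b₄ ∈ (algebraMap R F).range := ⟨_, integralModel_b₄_eq R W⟩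
  have hb6 : W.b₆ ∈ (algebraMap R F).range := ⟨_, integralModel_b₆_eq R W⟩
  have hb8 : W.b₈ ∈ (algebraMap R F).range := ⟨_, integralModel_b₈_eq R W⟩
  have hb6' : (C • W).b₆ ∈ (algebraMap R F).range := ⟨_, integralModel_b₆_eq R (C • W)⟩
  have hb8' : (C • W).b₈ ∈ (algebraMap R F).range := ⟨_, integralModel_b₈_eq R (C • W)⟩
  have e6 : (C.u : F) ^ 6 * (C • W).b₆ =
      W.b₆ + 2 * C.r * W.b₄ + C.r ^ 2 * W.b₂ + 4 * C.r ^ 3 := by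
    rw [variableChange_b₆, Units.val_inv_eq_inv_val]; field_simp
  have e8 : (C.u : F) ^ 8 * (C • W).b₈ =
      W.b₈ + 3 * C.r * W.b₆ + 3 * C.r ^ 2 * W.b₄ + C.r ^ 3 * W.b₂ + 3 * C.r ^ 4 := by
    rw [variableChange_b₈, Units.val_inv_eq_inv_val]; field_simp
  have e2 : (C.u : F) ^ 2 * (C • W).a₂ = W.a₂ - C.s * W.a₁ + 3 * C.r - C.s ^ 2 := by
    rw [variableChange_a₂, Units.val_inv_eq_inv_val]; field_simp
  have ea6 : (C.u : F) ^ 6 * (C • W).a₆ = W.a₆ + C.r * W.a₄ + C.r ^ 2 * W.a₂ + C.r ^ 3 -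
      C.t * W.a₃ - C.t ^ 2 - C.r * C.t * W.a₁ := by
    rw [variableChange_a₆, Units.val_inv_eq_inv_val]; field_simp
  -- In the b₈ relation minus r times the b₆ relation the terms with b₂ cancel and the leading
  -- coefficient becomes 3 - 4 = -1, so r is integral in every residue characteristic.
  have hr : C.r ∈ (algebraMap R F).range :=
    mem_range_of_quartic (p := -W.b₄) (q := -2 * W.b₆ - C.u ^ 6 * (C • W).b₆)
      (r := C.u ^ 8 * (C • W).b₈ - W.b₈) (neg_mem hb4)
      (sub_mem (mul_mem (neg_mem (ofNat_mem _ 2)) hb6) (mul_mem (pow_mem hu 6) hb6'))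
      (sub_mem (mul_mem (pow_mem hu 8) hb8') hb8) (by linear_combination e8 - C.r * e6)
  refine ⟨hr, ?_, ?_⟩
  · exact mem_range_of_quadratic (p := W.a₁) (q := C.u ^ 2 * (C • W).a₂ - W.a₂ - 3 * C.r) h1
      (sub_mem (sub_mem (mul_mem (pow_mem hu 2) h2') h2) (mul_mem (ofNat_mem _ 3) hr))
      (by linear_combination e2)
  · exact mem_range_of_quadratic (p := W.a₃ + C.r * W.a₁)
      (q := C.u ^ 6 * (C • W).a₆ - W.a₆ - C.r * W.a₄ - C.r ^ 2 * W.a₂ - C.r ^ 3)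
      (add_mem h3 (mul_mem hr h1))
      (sub_mem (sub_mem (sub_mem (sub_mem (mul_mem (pow_mem hu 6) h6') h6) (mul_mem hr h4))
        (mul_mem (pow_mem hr 2) h2)) (pow_mem hr 3)) (by linear_combination ea6)

lemma IsMinimal.valuation_Δ_le (W : WeierstrassCurve F) [IsMinimal R W] (C : VariableChange F)
    [hC : IsIntegral R (C • W)] : 𝓿 (C • W).Δ ≤ 𝓿 W.Δ := by
  have h := (IsMinimal.val_Δ_maximal (R := R) (W := W)).2 (j := C) hC
  rw [← valuation_Δ_aux_eq_of_isIntegral, ← valuation_Δ_aux_eq_of_isIntegral, Subtype.coe_le_coe]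
  simp only [one_smul] at h
  exact (le_total _ _).elim h id

/-- Minimality on both sides, applied to `C` and to its inverse, makes the discriminants equally
large; they differ by the twelfth power of u. -/
lemma valuation_u_eq_one (W : WeierstrassCurve F) (hΔ : W.Δ ≠ 0) [IsMinimal R W]
    (C : VariableChange F) [IsMinimal R (C • W)] : 𝓿 (C.u : F) = 1 := by
  have h1 := IsMinimal.valuation_Δ_le (R := R) W C
  have : IsIntegral R (C⁻¹ • C • W) := by rw [inv_smul_smul]; infer_instance
  have h2 := IsMinimal.valuation_Δ_le (R := R) (C • W) C⁻¹
  rw [inv_smul_smul] at h2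
  have h := le_antisymm h1 h2
  rw [variableChange_Δ, map_mul, mul_eq_right₀ ((map_ne_zero _).mpr hΔ), map_pow,
    pow_eq_one_iff_of_nonneg zero_le (by norm_num), Units.val_inv_eq_inv_val, map_inv₀, inv_eq_one] at h
  exact h

variable (R) in
lemma exists_minimal_eq (W : WeierstrassCurve F) : ∃ C : VariableChange F, W.minimal R = C • W :=
  ⟨_, rfl⟩

variable (R) in
-- The unit is the twelfth power of an inverse scaling factor. It cannot be avoided, as `minimal` is
-- only some chosen equation.
lemma valuation_minimalDiscriminant (W : WeierstrassCurve F) (hΔ : W.Δ ≠ 0) [IsMinimal R W] :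
    ∃ u : Rˣ, W.minimalDiscriminant R = algebraMap R F u * W.Δ := by
  obtain ⟨C, hC⟩ := exists_minimal_eq R W
  have : IsMinimal R (C • W) := hC ▸ inferInstance
  have hu := valuation_u_eq_one (R := R) W hΔ C
  obtain ⟨a, ha⟩ := (valuation_le_one_iff_mem_range R (C.u : F)).mp hu.le
  obtain ⟨b, hb⟩ := (valuation_le_one_iff_mem_range R (C.u⁻¹ : F)).mp (by rw [map_inv₀, hu, inv_one])
  have hab : a * b = 1 := by
    apply IsFractionRing.injective R F
    rw [map_mul, ha, hb, map_one, mul_inv_cancel₀ C.u.ne_zero]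
  refine ⟨(Units.mkOfMulEqOne b a (by rw [mul_comm, hab])) ^ 12, ?_⟩
  rw [minimalDiscriminant, hC, variableChange_Δ]
  simp [hb]

lemma residue_eq_zero_iff_valuation (a : R) :
    IsLocalRing.residue R a = 0 ↔ 𝓿 (algebraMap R F a) < 1 := by
  rw [IsLocalRing.residue_eq_zero_iff, valuation_lt_one_iff_mem]
  rfl

lemma reduction_nonsingular_iff (W : WeierstrassCurve F) [IsMinimal R W] (x y : R)
    (h : W.toAffine.Equation (algebraMap R F x) (algebraMap R F y)) :
    (W.reduction R).toAffine.Nonsingular (IsLocalRing.residue R x) (IsLocalRing.residue R y) ↔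
      ¬ (𝓿 (W.partialX (algebraMap R F x) (algebraMap R F y)) < 1 ∧
        𝓿 (W.partialY (algebraMap R F x) (algebraMap R F y)) < 1) := by
  have hR : (integralModel R W).toAffine.Equation x y := by
    rw [← Affine.map_equation _ (IsFractionRing.injective R F)]
    change (baseChange (integralModel R W) F).toAffine.Equation _ _
    rwa [baseChange_integralModel_eq R W]
  rw [nonsingular_iff_partial, ← not_and_or,
    and_iff_right (show (W.reduction R).toAffine.Equation _ _ from Affine.Equation.map _ hR)]
  refine not_congr (and_congr ?_ ?_)
  · rw [show (W.reduction R).partialX (IsLocalRing.residue R x) (IsLocalRing.residue R y) =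
      IsLocalRing.residue R ((integralModel R W).a₁ * y -
        (3 * x ^ 2 + 2 * (integralModel R W).a₂ * x + (integralModel R W).a₄)) by
      simp only [partialX, reduction, map_a₁, map_a₂, map_a₄, map_sub, map_add, map_mul, map_pow,
        map_ofNat], residue_eq_zero_iff_valuation (F := F)]
    simp only [partialX, map_sub, map_add, map_mul, map_pow, map_ofNat, integralModel_a₁_eq, integralModel_a₂_eq, integralModel_a₄_eq]
  · rw [show (W.reduction R).partialY (IsLocalRing.residue R x) (IsLocalRing.residue R y) =
      IsLocalRing.residue R (2 * y + (integralModel R W).a₁ * x + (integralModel R W).a₃) by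
      simp only [partialY, reduction, map_a₁, map_a₃, map_add, map_mul, map_ofNat], residue_eq_zero_iff_valuation (F := F)]
    simp only [partialY, map_add, map_mul, map_ofNat, integralModel_a₁_eq, integralModel_a₃_eq]

variable (R) in
/-- The points whose reduction on an integral equation is nonsingular, described by the valuations
of the partial derivatives. -/
def HasNonsingularReduction (W : WeierstrassCurve F) : W.toAffine.Point → Prop
  | .zero => True
  | .some x y _ => (𝓿 x ≤ 1 ∧ 𝓿 y ≤ 1) → ¬ (𝓿 (W.partialX x y) < 1 ∧ 𝓿 (W.partialY x y) < 1)

open Classical in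
variable (R) in
lemma nonsingularReductionSubgroup_eq (W : WeierstrassCurve F) [IsMinimal R W] :
    nonsingularReductionSubgroup R W = AddSubgroup.closure {P | HasNonsingularReduction R W P} := by
  rw [nonsingularReductionSubgroup]
  congr 1
  ext P
  rcases P with _ | ⟨x, y, h⟩
  · simp [HasNonsingularReduction]
  · simp only [Set.mem_ofPred_eq, HasNonsingularReduction, valuation_le_one_iff_mem_range]
    constructor
    · rintro H ⟨⟨x, rfl⟩, ⟨y, rfl⟩⟩
      exact (reduction_nonsingular_iff W x y h.1).mp (H x y h rfl)
    · rintro H x' y' h' H'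
      obtain ⟨rfl, rfl⟩ := Affine.Point.some.inj H'
      exact (reduction_nonsingular_iff W x' y' h.1).mpr (H ⟨⟨_, rfl⟩, ⟨_, rfl⟩⟩)

lemma valuation_variableChange_le_one_iff {C : VariableChange F} (hu : 𝓿 (C.u : F) = 1)
    (hr : 𝓿 C.r ≤ 1) (hs : 𝓿 C.s ≤ 1) (ht : 𝓿 C.t ≤ 1) (x y : F) :
    (𝓿 x ≤ 1 ∧ 𝓿 y ≤ 1) ↔
      (𝓿 (C.u ^ 2 * x + C.r) ≤ 1 ∧ 𝓿 (C.u ^ 3 * y + C.s * C.u ^ 2 * x + C.t) ≤ 1) := by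
  have hx : 𝓿 x = 𝓿 (C.u ^ 2 * x) := by simp [hu]
  have hy : 𝓿 y = 𝓿 (C.u ^ 3 * y) := by simp [hu]
  rw [hx, hy]
  simp only [← Valuation.mem_integer_iff] at *
  have h1 : (C.u ^ 2 * x ∈ Valuation.integer 𝓿) ↔ (C.u ^ 2 * x + C.r ∈ Valuation.integer 𝓿) :=
    (add_mem_cancel_right hr).symm
  rw [← h1]
  refine and_congr_right fun h => ?_
  rw [add_mem_cancel_right ht, add_mem_cancel_right]
  rw [mul_assoc]
  exact mul_mem hs h

/-- The X-derivative changes by s times the Y-derivative with s integral, so the two are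
simultaneously small before and after the substitution. -/
lemma hasNonsingularReduction_variableChange (W : WeierstrassCurve F) [IsIntegral R W]
    {C : VariableChange F} (hu : 𝓿 (C.u : F) = 1) (hr : 𝓿 C.r ≤ 1) (hs : 𝓿 C.s ≤ 1)
    (ht : 𝓿 C.t ≤ 1) (P : (C • W).toAffine.Point) :
    HasNonsingularReduction R (C • W) P ↔
      HasNonsingularReduction R W (variableChangePoint C W P) := by
  rcases P with _ | ⟨x, y, h⟩
  · exact Iff.rfl
  · simp only [HasNonsingularReduction, variableChangePoint]
    rw [← valuation_variableChange_le_one_iff hu hr hs ht]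
    refine imp_congr_right fun _ => not_congr ?_
    have e1 : 𝓿 ((C • W).partialX x y) = 𝓿 (C.u ^ 4 * (C • W).partialX x y) := by simp [hu]
    have e2 : 𝓿 ((C • W).partialY x y) = 𝓿 (C.u ^ 3 * (C • W).partialY x y) := by simp [hu]
    rw [e1, e2, variableChange_partialX, variableChange_partialY]
    refine ⟨fun H => ⟨?_, H.2⟩, fun H => ⟨?_, H.2⟩⟩
    · have := Valuation.map_sub_lt _ H.1 (g := 1)
        (y := C.s * W.partialY (C.u ^ 2 * x + C.r) (C.u ^ 3 * y + C.s * C.u ^ 2 * x + C.t))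
        (by rw [map_mul]; exact (mul_le_of_le_one_left' hs).trans_lt H.2)
      simpa using this
    · refine Valuation.map_add_lt _ H.1 ?_
      rw [map_mul]; exact (mul_le_of_le_one_left' hs).trans_lt H.2

variable (R) in
open Classical in
/-- The Tamagawa factor can be computed on any minimal equation. -/
theorem tamagawaFactor_of_isMinimal (W : WeierstrassCurve F) (hΔ : W.Δ ≠ 0) [IsMinimal R W] :
    W.tamagawaFactor R =
      (AddSubgroup.closure {P : W.toAffine.Point | HasNonsingularReduction R W P}).index := by
  obtain ⟨C, hC⟩ : ∃ C : VariableChange F, C = (W.exists_isMinimal R).choose := ⟨_, rfl⟩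
  have hmin : IsMinimal R (C • W) := by rw [hC]; exact (W.exists_isMinimal R).choose_spec
  rw [tamagawaFactor, nonsingularReductionSubgroup_eq, minimal, ← hC]
  have hu := valuation_u_eq_one (R := R) W hΔ C
  obtain ⟨hr, hs, ht⟩ := variableChange_mem_range W C
    ((valuation_le_one_iff_mem_range R _).mp hu.le)
  rw [← valuation_le_one_iff_mem_range] at hr hs ht
  rw [← AddSubgroup.index_map_equiv _ (variableChangePointEquiv C W)]
  congr 1
  rw [AddMonoidHom.map_closure]
  congr 1
  ext P
  simp only [Set.mem_image, Set.mem_ofPred_eq]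
  constructor
  · rintro ⟨Q, hQ, rfl⟩
    exact (hasNonsingularReduction_variableChange W hu hr hs ht Q).mp hQ
  · intro hP
    refine ⟨(variableChangePointEquiv C W).symm P, ?_, by simp⟩
    rw [hasNonsingularReduction_variableChange W hu hr hs ht, ← variableChangePointEquiv_apply]
    simpa using hP

/-- If the minimal discriminant is a unit, the Tamagawa factor is `1`. -/
theorem tamagawaFactor_of_valuation_Δ_eq_one (W : WeierstrassCurve F) [IsMinimal R W]
    (hΔ : 𝓿 W.Δ = 1) : W.tamagawaFactor R = 1 := by
  classical
  have hΔ0 : W.Δ ≠ 0 := fun h => by simp [h] at hΔ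
  have : HasGoodReduction R W := ⟨hΔ⟩
  have := (hasGoodReduction_iff_isElliptic_reduction R).mp this
  rw [tamagawaFactor_of_isMinimal R W hΔ0, AddSubgroup.index_eq_one, eq_top_iff]
  refine fun P _ => AddSubgroup.subset_closure ?_
  rcases P with _ | ⟨x, y, h⟩
  · trivial
  · rintro ⟨hx, hy⟩
    obtain ⟨x, rfl⟩ := (valuation_le_one_iff_mem_range R x).mp hx
    obtain ⟨y, rfl⟩ := (valuation_le_one_iff_mem_range R y).mp hy
    rw [← reduction_nonsingular_iff W x y h.1, ← Affine.equation_iff_nonsingular]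
    have hR : (integralModel R W).toAffine.Equation x y := by
      rw [← Affine.map_equation _ (IsFractionRing.injective R F)]
      change (baseChange (integralModel R W) F).toAffine.Equation _ _
      rw [baseChange_integralModel_eq R W]
      exact h.1
    exact Affine.Equation.map _ hR

end MinimalModels
end WeierstrassCurve

namespace WeierstrassCurve

/-- The curve `y² = x³ - a² x`. -/
def congruentCurve {F : Type*} [Field F] (a : F) : WeierstrassCurve F where
  a₁ := 0
  a₂ := 0
  a₃ := 0
  a₄ := -a ^ 2
  a₆ := 0

/-! ### Points of y² = x³ - a²x that avoid the singular point of the reduction. -/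

section CongruentCurve

open IsDedekindDomain.HeightOneSpectrum

variable {R : Type*} [CommRing R] [IsDomain R] [IsDiscreteValuationRing R]
  {F : Type*} [Field F] [Algebra R F] [IsFractionRing R F]

local notation "𝓿" => HeightOneSpectrum.valuation F (IsDiscreteValuationRing.maximalIdeal R)

lemma congruentCurve_Δ (a : F) : (congruentCurve a).Δ = 64 * a ^ 6 := by
  simp only [congruentCurve, Δ, b₂, b₄, b₆, b₈]; ring

lemma congruentCurve_equation_iff {a x y : F} :
    (congruentCurve a).toAffine.Equation x y ↔ y ^ 2 = x ^ 3 - a ^ 2 * x := by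
  rw [Affine.equation_iff]
  simp [congruentCurve, sub_eq_add_neg]

lemma congruentCurve_negY (a x y : F) : (congruentCurve a).toAffine.negY x y = -y := by
  simp [congruentCurve, Affine.negY]

lemma congruentCurve_nonsingular_iff {a x y : F} (h2 : (2 : F) ≠ 0) (ha : a ≠ 0) :
    (congruentCurve a).toAffine.Nonsingular x y ↔ y ^ 2 = x ^ 3 - a ^ 2 * x := by
  rw [← congruentCurve_equation_iff, Affine.equation_iff_nonsingular_of_Δ_ne_zero]
  rw [congruentCurve_Δ, show (64 : F) = 2 ^ 6 by norm_num]
  positivity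

/-- The relations between the coordinates of two points and of their sum. -/
lemma congruentCurve_add [DecidableEq F] {a e x₁ x₂ y₁ y₂ : F} (he : e ^ 3 = a ^ 2 * e)
    (h₁ : (congruentCurve a).toAffine.Nonsingular x₁ y₁)
    (h₂ : (congruentCurve a).toAffine.Nonsingular x₂ y₂) (h : ¬(x₁ = x₂ ∧ y₁ = -y₂)) :
    ∃ (l x₃ y₃ : F) (h₃ : (congruentCurve a).toAffine.Nonsingular x₃ y₃),
      (Affine.Point.some x₁ y₁ h₁ + Affine.Point.some x₂ y₂ h₂ : (congruentCurve a).toAffine.Point)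
        = .some x₃ y₃ h₃ ∧
      (x₁ - e) * (x₂ - e) * (x₃ - e) = (y₃ + l * (x₃ - e)) ^ 2 ∧ x₁ + x₂ + x₃ = l ^ 2 := by
  have hxy : ¬(x₁ = x₂ ∧ y₁ = (congruentCurve a).toAffine.negY x₂ y₂) := by
    rwa [congruentCurve_negY]
  refine ⟨(congruentCurve a).toAffine.slope x₁ x₂ y₁ y₂, _, _, _, Affine.Point.add_some hxy, ?_, ?_⟩
  · have H := congrArg (Polynomial.eval e) (Affine.addPolynomial_slope h₁.1 h₂.1 hxy)
    simp only [Affine.addY, congruentCurve_negY, Affine.negAddY]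
    rw [Affine.addPolynomial_eq] at H
    generalize (congruentCurve a).toAffine.slope x₁ x₂ y₁ y₂ = l at *
    generalize (congruentCurve a).toAffine.addX x₁ x₂ l = x₃ at *
    simp [Cubic.toPoly, congruentCurve] at H
    linear_combination -he - H
  · simp [Affine.addX, congruentCurve]

/-- In z = x - e the curve is y² = z(z² + 3ez + (3e² - a²)), so translation by (0, 0) sends z to
(3e² - a²)/z. This involution exchanges points close to (e, 0) with points far from it and drives
the index computations. -/
lemma congruentCurve_add_torsion [DecidableEq F] {a e x y : F} (he : e ^ 3 = a ^ 2 * e)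
    (h : (congruentCurve a).toAffine.Nonsingular x y)
    (hT : (congruentCurve a).toAffine.Nonsingular e 0) (hx : x ≠ e) :
    ∃ (x₃ y₃ : F) (h₃ : (congruentCurve a).toAffine.Nonsingular x₃ y₃),
      (Affine.Point.some x y h + Affine.Point.some e 0 hT : (congruentCurve a).toAffine.Point)
        = .some x₃ y₃ h₃ ∧ (x₃ - e) * (x - e) = 3 * e ^ 2 - a ^ 2 := by
  refine ⟨_, _, _, Affine.Point.add_of_X_ne hx, ?_⟩
  have hxe : x - e ≠ 0 := sub_ne_zero.mpr hx
  have hq := congruentCurve_equation_iff.mp h.1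
  rw [Affine.slope_of_X_ne hx]
  have e1 : (congruentCurve a).a₁ = 0 := rfl
  have e2 : (congruentCurve a).a₂ = 0 := rfl
  simp only [Affine.addX, e1, e2]
  field_simp
  linear_combination hq + he

lemma congruentCurve_torsion_add_self [DecidableEq F] {a e : F}
    (hT : (congruentCurve a).toAffine.Nonsingular e 0) :
    (Affine.Point.some e 0 hT + Affine.Point.some e 0 hT : (congruentCurve a).toAffine.Point) = 0 :=
  Affine.Point.add_self_of_Y_eq (by rw [congruentCurve_negY, neg_zero])

variable (R) in
/-- The points not reducing to the point with abscissa `e`. -/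
def AvoidsReduction (a e : F) : (congruentCurve a).toAffine.Point → Prop
  | .zero => True
  | .some x _ _ => ¬ 𝓿 (x - e) < 1

lemma avoidsReduction_neg {a e : F} {P : (congruentCurve a).toAffine.Point}
    (hP : AvoidsReduction R a e P) : AvoidsReduction R a e (-P) := by
  rcases P with _ | ⟨x, y, h⟩ <;> exact hP

/-- In z = x - e the equation is y² = z(z(z + 3e) + (3e² - a²)), and the second factor lies in the
maximal ideal. -/
lemma valuation_sq_lt {a e x y : F} (hve : 𝓿 e ≤ 1) (hc : 𝓿 (3 * e ^ 2 - a ^ 2) < 1)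
    (he : e ^ 3 = a ^ 2 * e) (h : y ^ 2 = x ^ 3 - a ^ 2 * x) (hx : 𝓿 (x - e) < 1) (hx0 : x ≠ e) :
    𝓿 y ^ 2 < 𝓿 (x - e) := by
  have hpos : 0 < 𝓿 (x - e) := zero_lt_iff.mpr ((map_ne_zero _).mpr (sub_ne_zero.mpr hx0))
  have hxe : y ^ 2 = (x - e) * ((x - e) * ((x - e) + 3 * e) + (3 * e ^ 2 - a ^ 2)) := by
    linear_combination h + he
  have h3 : 𝓿 (3 : F) ≤ 1 := by
    rw [valuation_le_one_iff_mem_range]; exact ofNat_mem _ 3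
  rw [← map_pow, hxe, map_mul]
  refine mul_lt_of_lt_one_right hpos (Valuation.map_add_lt _ ?_ hc)
  rw [map_mul]
  refine (mul_le_of_le_one_right' (Valuation.map_add_le _ hx.le ?_)).trans_lt hx
  rw [map_mul]
  exact mul_le_one' h3 hve

/-- Let A, B, D be the sizes of the three x - e, with A, B ≥ 1 and, for contradiction, D < 1. The
chord relation makes ABD the size of (y₃ + l(x₃ - e))². But |y₃|² < D, and |l|² ≤ AB by the sum of
the abscissas, so that square is smaller than ABD. -/
lemma avoidsReduction_add [DecidableEq F] {a e : F} (he : e ^ 3 = a ^ 2 * e) (hve : 𝓿 e ≤ 1)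
    (hc : 𝓿 (3 * e ^ 2 - a ^ 2) < 1) {P Q : (congruentCurve a).toAffine.Point}
    (hP : AvoidsReduction R a e P) (hQ : AvoidsReduction R a e Q) :
    AvoidsReduction R a e (P + Q) := by
  rcases P with _ | ⟨x₁, y₁, h₁⟩
  · exact hQ
  rcases Q with _ | ⟨x₂, y₂, h₂⟩
  · exact hP
  by_cases h : x₁ = x₂ ∧ y₁ = -y₂
  · rw [Affine.Point.add_of_Y_eq h.1 (by rw [h.2, congruentCurve_negY])]
    trivial
  obtain ⟨l, x₃, y₃, h₃, heq, hprod, hsum⟩ := congruentCurve_add he h₁ h₂ h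
  rw [heq]
  intro hD
  simp only [AvoidsReduction, not_lt] at hP hQ
  have hy := congruentCurve_equation_iff.mp h₃.1
  have hx₃ : x₃ ≠ e := by
    rintro rfl
    -- If the sum is the torsion point itself, the strict bound on y₃ is not available. Then the
    -- second point is the translate of the negative of the first, and (x₁ - e)(x₂ - e) = 3e² - a²
    -- is small although both factors are not.
    have hy0 : y₃ = 0 := by
      have : y₃ ^ 2 = 0 := by rw [hy, he, sub_self]
      exact pow_eq_zero_iff two_ne_zero |>.mp this
    subst hy0
    have h1 : x₁ ≠ x₃ := fun h => by simp [h] at hP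
    obtain ⟨x', y', h', heq', hx'⟩ := congruentCurve_add_torsion he
      ((Affine.nonsingular_neg _ _).mpr h₁) h₃ h1
    rw [← heq, ← Affine.Point.neg_some h₁, neg_add_cancel_left] at heq'
    obtain ⟨rfl, -⟩ := Affine.Point.some.inj heq'
    rw [← hx', map_mul] at hc
    exact hc.not_ge (one_le_mul hQ hP)
  have hy2 := valuation_sq_lt hve hc he hy hD hx₃
  set A := 𝓿 (x₁ - e)
  set B := 𝓿 (x₂ - e)
  set D := 𝓿 (x₃ - e)
  have hpos : 0 < D := zero_lt_iff.mpr ((map_ne_zero _).mpr (sub_ne_zero.mpr hx₃))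
  have h3 : 𝓿 (3 : F) ≤ 1 := by rw [valuation_le_one_iff_mem_range]; exact ofNat_mem _ 3
  have hAB : 1 ≤ A * B := one_le_mul hP hQ
  have hl : 𝓿 l ^ 2 ≤ A * B := by
    rw [← map_pow, ← hsum, show x₁ + x₂ + x₃ = (x₁ - e) + (x₂ - e) + ((x₃ - e) + 3 * e) by ring]
    refine Valuation.map_add_le _ (Valuation.map_add_le _ ?_ ?_) (Valuation.map_add_le _ ?_ ?_)
    · exact le_mul_of_one_le_right' hQ
    · exact le_mul_of_one_le_left' hP
    · exact hD.le.trans hAB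
    · rw [map_mul]
      exact (mul_le_one' h3 hve).trans hAB
  have hAB0 : 0 < A * B := zero_lt_one.trans_le hAB
  have hABD : A * B * D = 𝓿 (y₃ + l * (x₃ - e)) ^ 2 := by
    rw [← map_pow, ← hprod, map_mul, map_mul]
  rcases le_total (𝓿 y₃) (𝓿 (l * (x₃ - e))) with hle | hle
  · have h1 : A * B * D ≤ (𝓿 l * D) ^ 2 := by
      rw [hABD, ← map_mul]
      exact pow_le_pow_left' (Valuation.map_add_le _ hle le_rfl) 2
    have h2 : (𝓿 l * D) ^ 2 ≤ A * B * D * D := by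
      rw [mul_pow, sq D, ← mul_assoc]
      gcongr
    exact (h1.trans h2).not_gt (mul_lt_of_lt_one_right (mul_pos hAB0 hpos) hD)
  · have h1 : A * B * D ≤ 𝓿 y₃ ^ 2 := by
      rw [hABD]
      exact pow_le_pow_left' (Valuation.map_add_le _ le_rfl hle) 2
    exact (h1.trans_lt hy2).not_ge (le_mul_of_one_le_left' hAB)

/-- The subgroup of the points not reducing to the singular point `(e, 0)`. -/
def avoidsReductionSubgroup [DecidableEq F] {a e : F} (he : e ^ 3 = a ^ 2 * e) (hve : 𝓿 e ≤ 1)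
    (hc : 𝓿 (3 * e ^ 2 - a ^ 2) < 1) : AddSubgroup (congruentCurve a).toAffine.Point where
  carrier := {P | AvoidsReduction R a e P}
  zero_mem' := trivial
  add_mem' := avoidsReduction_add he hve hc
  neg_mem' := avoidsReduction_neg

open Classical in
-- By `hsing` every singular reduction is that of (e, 0). The generating set of the closure is then
-- already a subgroup, and the closure disappears.
theorem tamagawaFactor_congruentCurve {a e : F} (hΔ : (congruentCurve a).Δ ≠ 0)
    [IsMinimal R (congruentCurve a)] (he : e ^ 3 = a ^ 2 * e)
    (hve : 𝓿 e ≤ 1) (hc : 𝓿 (3 * e ^ 2 - a ^ 2) < 1)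
    (hsing : ∀ x y : F, y ^ 2 = x ^ 3 - a ^ 2 * x → 𝓿 x ≤ 1 → 𝓿 y ≤ 1 →
      𝓿 (3 * x ^ 2 - a ^ 2) < 1 → 𝓿 (2 * y) < 1 → 𝓿 (x - e) < 1) :
    (congruentCurve a).tamagawaFactor R = (avoidsReductionSubgroup (R := R) he hve hc).index := by
  have h3 : 𝓿 (3 : F) ≤ 1 := by rw [valuation_le_one_iff_mem_range]; exact ofNat_mem _ 3
  have h2 : 𝓿 (2 : F) ≤ 1 := by rw [valuation_le_one_iff_mem_range]; exact ofNat_mem _ 2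
  rw [tamagawaFactor_of_isMinimal R _ hΔ, ← AddSubgroup.closure_eq (avoidsReductionSubgroup he _ _)]
  congr 2
  ext P
  rcases P with _ | ⟨x, y, h⟩
  · exact Iff.rfl
  · have hy := congruentCurve_equation_iff.mp h.1
    have hX : (congruentCurve a).partialX x y = -(3 * x ^ 2 - a ^ 2) := by
      simp only [partialX, congruentCurve]; ring
    have hY : (congruentCurve a).partialY x y = 2 * y := by
      simp only [partialY, congruentCurve]; ring
    change (_ → ¬ (𝓿 _ < 1 ∧ 𝓿 _ < 1)) ↔ ¬ 𝓿 (x - e) < 1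
    rw [hX, hY, Valuation.map_neg]
    constructor
    · intro H hx
      have hvx : 𝓿 x ≤ 1 := by simpa using Valuation.map_add_le _ hx.le hve
      have hvy2 : 𝓿 y ^ 2 < 1 := by
        by_cases hx0 : x = e
        · subst hx0
          rw [← map_pow, hy, he, sub_self, map_zero]; exact zero_lt_one
        · exact (valuation_sq_lt hve hc he hy hx hx0).trans hx
      have hvy : 𝓿 y < 1 := (pow_lt_one_iff (n := 2) (by norm_num)).mp hvy2
      refine H ⟨hvx, hvy.le⟩ ⟨?_, ?_⟩
      · rw [show 3 * x ^ 2 - a ^ 2 = (x - e) * (3 * (x + e)) + (3 * e ^ 2 - a ^ 2) by ring]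
        refine Valuation.map_add_lt _ ?_ hc
        rw [map_mul, map_mul]
        exact (mul_le_of_le_one_right' (mul_le_one' h3 (Valuation.map_add_le _ hvx hve))).trans_lt hx
      · rw [map_mul]
        exact (mul_le_of_le_one_left' h2).trans_lt hvy
    · rintro H ⟨hx, hy'⟩ ⟨h1, h2⟩
      exact H (hsing x y hy hx hy' h1 h2)

end CongruentCurve
end WeierstrassCurve

/-! ### Indices from coset representatives, and parity of valuations. -/

lemma AddSubgroup.index_eq_card_of_representatives {G ι : Type*} [AddCommGroup G] [Fintype ι]
    (H : AddSubgroup G) (f : ι → G) (hinj : ∀ i j, f i - f j ∈ H → i = j)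
    (hsurj : ∀ g, ∃ i, g - f i ∈ H) : H.index = Fintype.card ι := by
  rw [AddSubgroup.index, ← Nat.card_eq_fintype_card]
  refine (Nat.card_congr (Equiv.ofBijective (fun i => (f i : G ⧸ H)) ⟨fun i j h => ?_, ?_⟩)).symm
  · refine (hinj j i ?_).symm
    rw [sub_eq_neg_add]
    exact QuotientAddGroup.eq.mp h
  · rintro ⟨g⟩
    obtain ⟨i, hi⟩ := hsurj g
    refine ⟨i, QuotientAddGroup.eq.mpr ?_⟩
    rwa [neg_add_eq_sub]

lemma AddSubgroup.index_eq_two_of_cover {G : Type*} [AddCommGroup G] (S : AddSubgroup G) {A : G}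
    (hA : A ∉ S) (hcover : ∀ g, g ∉ S → g - A ∈ S) : S.index = 2 := by
  rw [AddSubgroup.index_eq_card_of_representatives S ![0, A], Fintype.card_fin]
  · intro i j hij
    fin_cases i <;> fin_cases j <;> simp_all
  · intro g
    by_cases hg : g ∈ S
    · exact ⟨0, by simpa using hg⟩
    · exact ⟨1, hcover g hg⟩

lemma AddSubgroup.index_eq_four_of_cover {G : Type*} [AddCommGroup G] (S : AddSubgroup G)
    {A B : G} (hA : A ∉ S) (hB : B ∉ S) (hBA : B + A ∉ S) (hBA' : B - A ∉ S)
    (hcover : ∀ g, g ∉ S → g - A ∈ S ∨ g - B ∈ S ∨ g - (B + A) ∈ S) : S.index = 4 := by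
  rw [AddSubgroup.index_eq_card_of_representatives S ![0, A, B, B + A], Fintype.card_fin]
  · have key : ∀ i j : Fin 4, i < j → ![0, A, B, B + A] j - ![0, A, B, B + A] i ∉ S := by
      intro i j hij
      fin_cases i <;> fin_cases j <;> simp_all
    intro i j hij
    rcases lt_trichotomy i j with h | h | h
    · exact absurd (by simpa using neg_mem hij) (key i j h)
    · exact h
    · exact absurd hij (key j i h)
  · intro g
    by_cases hg : g ∈ S
    · exact ⟨0, by simpa using hg⟩
    · rcases hcover g hg with h | h | h
      exacts [⟨1, h⟩, ⟨2, h⟩, ⟨3, h⟩]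

namespace WithZero

/-- Squares have even valuation; this parity is the obstruction that separates components below. -/
lemma sq_ne_exp_of_odd (g : WithZero (Multiplicative ℤ)) {k : ℤ} (hk : Odd k) :
    g ^ 2 ≠ exp k := by
  intro h
  have h' := congrArg log h
  rw [log_pow, log_exp] at h'
  simp only [nsmul_eq_mul, Nat.cast_ofNat] at h'
  exact (Int.not_even_iff_odd.mpr hk) ⟨log g, by omega⟩

lemma lt_one_iff_le_exp_neg_one (g : WithZero (Multiplicative ℤ)) : g < 1 ↔ g ≤ exp (-1) := by
  rcases eq_or_ne g 0 with rfl | hg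
  · simp
  · rw [← exp_log hg, ← exp_zero, exp_lt_exp, exp_le_exp]; omega

lemma eq_exp_neg_one_or_le {g : WithZero (Multiplicative ℤ)} (h : g < 1) :
    g = exp (-1) ∨ g ≤ exp (-2) := by
  rcases eq_or_ne g 0 with rfl | hg
  · simp
  · rw [← exp_log hg, ← exp_zero, exp_lt_exp] at h
    rw [← exp_log hg, exp_le_exp, exp_inj]; omega

end WithZero

namespace WeierstrassCurve

/-! ### The component group of y² = x³ - a²x. -/

section Index

open IsDedekindDomain.HeightOneSpectrum WithZero

variable {R : Type*} [CommRing R] [IsDomain R] [IsDiscreteValuationRing R]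
  {F : Type*} [Field F] [Algebra R F] [IsFractionRing R F]

local notation "𝓿" => HeightOneSpectrum.valuation F (IsDiscreteValuationRing.maximalIdeal R)

lemma some_mem_avoidsReductionSubgroup [DecidableEq F] {a e : F} (he : e ^ 3 = a ^ 2 * e)
    (hve : 𝓿 e ≤ 1) (hc : 𝓿 (3 * e ^ 2 - a ^ 2) < 1) {x y : F}
    (h : (congruentCurve a).toAffine.Nonsingular x y) :
    (Affine.Point.some x y h : (congruentCurve a).toAffine.Point) ∈
      avoidsReductionSubgroup (R := R) he hve hc ↔ 1 ≤ 𝓿 (x - e) := by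
  rw [← not_lt]; exact Iff.rfl

lemma congruentCurve_neg_torsion {a e : F} (hT : (congruentCurve a).toAffine.Nonsingular e 0) :
    -(Affine.Point.some e 0 hT : (congruentCurve a).toAffine.Point) = .some e 0 hT := by
  rw [Affine.Point.neg_some, Affine.Point.some.injEq, congruentCurve_negY]
  simp

lemma congruentCurve_eq_torsion {a e y : F} (he : e ^ 3 = a ^ 2 * e)
    (h : (congruentCurve a).toAffine.Nonsingular e y)
    (hT : (congruentCurve a).toAffine.Nonsingular e 0) :
    (Affine.Point.some e y h : (congruentCurve a).toAffine.Point) = .some e 0 hT := by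
  have := congruentCurve_equation_iff.mp h.1
  rw [he, sub_self, pow_eq_zero_iff two_ne_zero] at this
  subst this; rfl

/-- Translation by (f, 0) turns x - f into (3f² - a²)/(x - f), which has size at least 1 by `hx`;
replacing f by e changes it only by an element of the maximal ideal. -/
lemma sub_torsion_mem_avoidsReductionSubgroup [DecidableEq F] {a e : F} (he : e ^ 3 = a ^ 2 * e)
    (hve : 𝓿 e ≤ 1) (hc : 𝓿 (3 * e ^ 2 - a ^ 2) < 1) {x y f : F} (hf : f ^ 3 = a ^ 2 * f)
    (hef : 𝓿 (f - e) < 1)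
    (h : (congruentCurve a).toAffine.Nonsingular x y)
    (hT : (congruentCurve a).toAffine.Nonsingular f 0) (hx : 𝓿 (x - f) ≤ 𝓿 (3 * f ^ 2 - a ^ 2)) :
    (Affine.Point.some x y h - .some f 0 hT : (congruentCurve a).toAffine.Point) ∈
      avoidsReductionSubgroup (R := R) he hve hc := by
  rw [sub_eq_add_neg, congruentCurve_neg_torsion]
  by_cases hxf : x = f
  · subst hxf
    rw [congruentCurve_eq_torsion hf h hT, congruentCurve_torsion_add_self]
    exact zero_mem _
  · obtain ⟨x₃, y₃, h₃, heq, hx₃⟩ := congruentCurve_add_torsion hf h hT hxf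
    rw [heq, some_mem_avoidsReductionSubgroup]
    have hpos : 0 < 𝓿 (x - f) := zero_lt_iff.mpr ((map_ne_zero _).mpr (sub_ne_zero.mpr hxf))
    have h1 : 1 ≤ 𝓿 (x₃ - f) := by
      rw [← hx₃, map_mul] at hx
      by_contra! hlt
      exact hx.not_gt (mul_lt_of_lt_one_left hpos hlt)
    have : x₃ - e = (x₃ - f) + (f - e) := by ring
    rw [this, Valuation.map_add_eq_of_lt_left _ (hef.trans_le h1)]
    exact h1

/-- If translation by the torsion point `(e, 0)` moves each point reducing to `(e, 0)` to a point
that does not reduce to it, the index is `2`. -/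
lemma index_avoidsReductionSubgroup_eq_two [DecidableEq F] {a e : F} (he : e ^ 3 = a ^ 2 * e)
    (hve : 𝓿 e ≤ 1) (hc : 𝓿 (3 * e ^ 2 - a ^ 2) < 1)
    (hT : (congruentCurve a).toAffine.Nonsingular e 0)
    (H : ∀ x y : F, y ^ 2 = x ^ 3 - a ^ 2 * x → 𝓿 (x - e) < 1 →
      𝓿 (x - e) ≤ 𝓿 (3 * e ^ 2 - a ^ 2)) :
    (avoidsReductionSubgroup (R := R) he hve hc).index = 2 := by
  refine AddSubgroup.index_eq_two_of_cover _ (A := .some e 0 hT) ?_ ?_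
  · rw [some_mem_avoidsReductionSubgroup]; simp
  · rintro (_ | ⟨x, y, h⟩) hg
    · exact absurd (zero_mem _) hg
    · rw [some_mem_avoidsReductionSubgroup, not_le] at hg
      exact sub_torsion_mem_avoidsReductionSubgroup he hve hc he (by simp) h hT
          (H x y (congruentCurve_equation_iff.mp h.1) hg)

/-- The case in which the group of components has order `4` and is generated by the torsion point
`(e, 0)` and a point reducing to it to first order. -/
lemma index_avoidsReductionSubgroup_eq_four [DecidableEq F] {a e : F} (he : e ^ 3 = a ^ 2 * e)
    (hve : 𝓿 e ≤ 1) (hc : 𝓿 (3 * e ^ 2 - a ^ 2) < 1)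
    (hT : (congruentCurve a).toAffine.Nonsingular e 0)
    (hc' : 𝓿 (3 * e ^ 2 - a ^ 2) = exp (-2)) {x₀ y₀ : F}
    (h₀ : (congruentCurve a).toAffine.Nonsingular x₀ y₀) (hx₀ : 𝓿 (x₀ - e) = exp (-1)) :
    (avoidsReductionSubgroup (R := R) he hve hc).index = 4 := by
  have hx₀e : x₀ ≠ e := fun h => by
    rw [h, sub_self, map_zero] at hx₀
    exact exp_ne_zero hx₀.symm
  -- Since 3e² - a² has valuation 2, translation by the torsion point preserves the points with x -
  -- e of valuation 1.
  have hPT : (.some x₀ y₀ h₀ + .some e 0 hT : (congruentCurve a).toAffine.Point) ∉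
      avoidsReductionSubgroup (R := R) he hve hc := by
    obtain ⟨x₃, y₃, h₃, heq, hx₃⟩ := congruentCurve_add_torsion he h₀ hT hx₀e
    rw [heq, some_mem_avoidsReductionSubgroup, not_le]
    have := congrArg 𝓿 hx₃
    rw [map_mul, hc', hx₀, show exp (-2 : ℤ) = exp (-1) * exp (-1) by rw [← exp_add]; rfl] at this
    rw [mul_right_cancel₀ exp_ne_zero this, ← exp_zero, exp_lt_exp]; norm_num
  refine AddSubgroup.index_eq_four_of_cover _ (A := .some e 0 hT) (B := .some x₀ y₀ h₀)
    ?_ ?_ hPT ?_ ?_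
  · rw [some_mem_avoidsReductionSubgroup]; simp
  · rw [some_mem_avoidsReductionSubgroup, hx₀, ← exp_zero, exp_le_exp]; norm_num
  · rwa [sub_eq_add_neg, congruentCurve_neg_torsion]
  · rintro (_ | ⟨x, y, h⟩) hg
    · exact absurd (zero_mem _) hg
    rw [some_mem_avoidsReductionSubgroup, not_le] at hg
    rcases eq_exp_neg_one_or_le hg with hx | hx
    -- Two first-order points cannot differ by a third: the chord relation would make an element of
    -- valuation 3 a square. So the difference Q lies in the subgroup, or is close enough to (e, 0)
    -- to be moved into it by the torsion point.
    · obtain ⟨Q, hQ⟩ : ∃ Q : (congruentCurve a).toAffine.Point,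
        Q = .some x y h - .some x₀ y₀ h₀ := ⟨_, rfl⟩
      rw [← sub_sub, ← hQ, or_iff_not_imp_left, or_iff_not_imp_left]
      rintro - hQS
      rcases Q with _ | ⟨x', y', h'⟩
      · exact absurd (zero_mem _) hQS
      rw [some_mem_avoidsReductionSubgroup, not_le] at hQS
      refine sub_torsion_mem_avoidsReductionSubgroup he hve hc he (by simp) h' hT ?_
      rw [hc']
      refine (eq_exp_neg_one_or_le hQS).resolve_left fun hx' => ?_
      have hsum : (.some x' y' h' + .some x₀ y₀ h₀ : (congruentCurve a).toAffine.Point) =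
          .some x y h := by rw [hQ, sub_add_cancel]
      have hne : ¬ (x' = x₀ ∧ y' = -y₀) := by
        rintro ⟨h1, h2⟩
        rw [Affine.Point.add_of_Y_eq h1 (by rw [h2, congruentCurve_negY])] at hsum
        exact Affine.Point.some_ne_zero h hsum.symm
      obtain ⟨l, x₃, y₃, h₃, heq, hprod, -⟩ := congruentCurve_add he h' h₀ hne
      rw [hsum] at heq
      obtain ⟨rfl, -⟩ := Affine.Point.some.inj heq
      have := congrArg 𝓿 hprod
      rw [map_mul, map_mul, hx', hx₀, hx, map_pow, ← exp_add, ← exp_add] at this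
      exact sq_ne_exp_of_odd _ (by decide) this.symm
    · exact .inl <| sub_torsion_mem_avoidsReductionSubgroup he hve hc he (by simp) h hT (hc' ▸ hx)

/-- The case in which the group of components has order `4` and is given by the `2`-torsion. -/
lemma index_avoidsReductionSubgroup_zero_eq_four [DecidableEq F] {a : F} (h20 : (2 : F) ≠ 0)
    (ha0 : a ≠ 0) (he : (0 : F) ^ 3 = a ^ 2 * 0)
    (hve : 𝓿 (0 : F) ≤ 1) (hc : 𝓿 (3 * 0 ^ 2 - a ^ 2) < 1) (ha : 𝓿 a < 1)
    (H : ∀ x y : F, y ^ 2 = x ^ 3 - a ^ 2 * x → 𝓿 x < 1 →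
      𝓿 x ≤ 𝓿 (a ^ 2) ∨ 𝓿 (x - a) ≤ 𝓿 (2 * a ^ 2) ∨ 𝓿 (x + a) ≤ 𝓿 (2 * a ^ 2)) :
    (avoidsReductionSubgroup (R := R) he hve hc).index = 4 := by
  have h0 : (congruentCurve a).toAffine.Nonsingular 0 0 :=
    (congruentCurve_nonsingular_iff h20 ha0).mpr (by ring)
  have h1 : (congruentCurve a).toAffine.Nonsingular a 0 :=
    (congruentCurve_nonsingular_iff h20 ha0).mpr (by ring)
  have h2 : (congruentCurve a).toAffine.Nonsingular (-a) 0 :=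
    (congruentCurve_nonsingular_iff h20 ha0).mpr (by ring)
  have sum01 : (.some a 0 h1 + .some 0 0 h0 : (congruentCurve a).toAffine.Point) =
      .some (-a) 0 h2 := by
    obtain ⟨x₃, y₃, h₃, heq, hx₃⟩ := congruentCurve_add_torsion he h1 h0 ha0
    have : x₃ = -a := mul_right_cancel₀ ha0 (by linear_combination hx₃)
    subst this
    rw [heq, congruentCurve_eq_torsion (by ring) h₃ h2]
  have mem2 : (.some (-a) 0 h2 : (congruentCurve a).toAffine.Point) ∉
      avoidsReductionSubgroup (R := R) he hve hc := by
    rw [some_mem_avoidsReductionSubgroup, not_le, sub_zero, Valuation.map_neg]; exact ha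
  refine AddSubgroup.index_eq_four_of_cover _ (A := .some 0 0 h0) (B := .some a 0 h1)
    ?_ ?_ (sum01 ▸ mem2) ?_ ?_
  · rw [some_mem_avoidsReductionSubgroup]; simp
  · rw [some_mem_avoidsReductionSubgroup, not_le, sub_zero]; exact ha
  · rwa [sub_eq_add_neg, congruentCurve_neg_torsion, sum01]
  · rintro (_ | ⟨x, y, h⟩) hg
    · exact absurd (zero_mem _) hg
    rw [some_mem_avoidsReductionSubgroup, not_le, sub_zero] at hg
    rw [sum01]
    rcases H x y (congruentCurve_equation_iff.mp h.1) hg with hx | hx | hx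
    · refine .inl <| sub_torsion_mem_avoidsReductionSubgroup he hve hc he (by simp) h h0 ?_
      simpa using hx
    · refine .inr <| .inl <| sub_torsion_mem_avoidsReductionSubgroup he hve hc (by ring)
        (by simpa using ha) h h1 ?_
      rwa [show 3 * a ^ 2 - a ^ 2 = 2 * a ^ 2 by ring]
    · refine .inr <| .inr <| sub_torsion_mem_avoidsReductionSubgroup he hve hc (by ring)
        (by simpa using ha) h h2 ?_
      rwa [show 3 * (-a) ^ 2 - a ^ 2 = 2 * a ^ 2 by ring, sub_neg_eq_add]

end Index
end WeierstrassCurve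

namespace WeierstrassCurve

/-! ### Minimality of y² = x³ - a²x. -/

section Minimality

open IsDedekindDomain.HeightOneSpectrum WithZero

variable {R : Type*} [CommRing R] [IsDomain R] [IsDiscreteValuationRing R]
  {F : Type*} [Field F] [Algebra R F] [IsFractionRing R F]

local notation "𝓿" => HeightOneSpectrum.valuation F (IsDiscreteValuationRing.maximalIdeal R)

/-- The discriminant is multiplied by u⁻¹², so only |u| < 1 could enlarge it. -/
lemma isMinimal_of_forall (W : WeierstrassCurve F) [hW : IsIntegral R W]
    (H : ∀ C : VariableChange F, IsIntegral R (C • W) → ¬ 𝓿 (C.u : F) < 1) : IsMinimal R W := by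
  refine ⟨⟨by simpa using hW, fun C hC _ => ?_⟩⟩
  have hC' : IsIntegral R (C • W) := hC
  have hu := not_lt.mp (H C hC)
  rw [← Subtype.coe_le_coe]
  simp only [one_smul]
  rw [valuation_Δ_aux_eq_of_isIntegral, valuation_Δ_aux_eq_of_isIntegral, variableChange_Δ, map_mul,
    map_pow, Units.val_inv_eq_inv_val, map_inv₀]
  exact mul_le_of_le_one_left' (pow_le_one' (inv_le_one_of_one_le₀ hu) 12)

lemma valuation_Δ_le_pow (W : WeierstrassCurve F) (C : VariableChange F)
    [hC : IsIntegral R (C • W)] : 𝓿 W.Δ ≤ 𝓿 (C.u : F) ^ 12 := by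
  obtain ⟨d, hd⟩ := Δ_integral_of_isIntegral R (C • W)
  have h : 𝓿 (C • W).Δ ≤ 1 := (valuation_le_one_iff_mem_range R _).mpr ⟨d, hd⟩
  have hu : (C.u : F) ≠ 0 := C.u.ne_zero
  have : W.Δ = (C.u : F) ^ 12 * (C • W).Δ := by
    rw [variableChange_Δ, Units.val_inv_eq_inv_val]; field_simp
  rw [this, map_mul, map_pow]
  exact mul_le_of_le_one_right' h

lemma isMinimal_of_exp_lt_valuation_Δ (W : WeierstrassCurve F) [IsIntegral R W]
    (h : exp (-12) < 𝓿 W.Δ) : IsMinimal R W := by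
  refine isMinimal_of_forall W fun C hC hu => ?_
  have h1 := valuation_Δ_le_pow (R := R) W C
  have h2 : 𝓿 (C.u : F) ^ 12 ≤ exp (-1) ^ 12 :=
    pow_le_pow_left' ((lt_one_iff_le_exp_neg_one _).mp hu) 12
  rw [← exp_nsmul] at h2
  exact (h.trans_le (h1.trans h2)).false

lemma valuation_u_eq_exp_neg_one {W : WeierstrassCurve F} (h : 𝓿 W.Δ = exp (-12))
    (C : VariableChange F) [IsIntegral R (C • W)] (hu : 𝓿 (C.u : F) < 1) :
    𝓿 (C.u : F) = exp (-1) := by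
  have h1 := valuation_Δ_le_pow (R := R) W C
  refine le_antisymm ((lt_one_iff_le_exp_neg_one _).mp hu) ?_
  rw [h, show exp (-12 : ℤ) = exp (-1) ^ 12 by rw [← exp_nsmul]; rfl] at h1
  exact le_of_pow_le_pow_left₀ (by norm_num) zero_le h1

lemma isIntegral_congruentCurve {a : F} (ha : 𝓿 a ≤ 1) : IsIntegral R (congruentCurve a) := by
  obtain ⟨b, rfl⟩ := (valuation_le_one_iff_mem_range R a).mp ha
  exact isIntegral_of_exists_lift R ⟨0, by simp [congruentCurve]⟩ ⟨0, by simp [congruentCurve]⟩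
    ⟨0, by simp [congruentCurve]⟩ ⟨-b ^ 2, by simp [congruentCurve]⟩ ⟨0, by simp [congruentCurve]⟩

lemma valuation_congruentCurve_Δ (a : F) : 𝓿 (congruentCurve a).Δ = (𝓿 2 * 𝓿 a) ^ 6 := by
  rw [congruentCurve_Δ, show (64 : F) * a ^ 6 = (2 * a) ^ 6 by ring, map_pow, map_mul]

lemma valuation_three {F : Type*} [Field F] {Γ : Type*} [LinearOrderedCommGroupWithZero Γ]
    {v : Valuation F Γ} (h2 : v (2 : F) < 1) : v (3 : F) = 1 := by
  rw [show (3 : F) = 1 + 2 by norm_num, Valuation.map_one_add_of_lt _ h2]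

/-- Minimality of `y² = x³ - a² x` in residue characteristic `2` when `2` and `a` are
uniformizers. -/
lemma isMinimal_congruentCurve_of_two_mul {a : F} (h2 : 𝓿 (2 : F) = exp (-1))
    (ha : 𝓿 a = exp (-1)) : IsMinimal R (congruentCurve a) := by
  have hlt : exp (-1 : ℤ) < 1 := by rw [← exp_zero, exp_lt_exp]; norm_num
  have := isIntegral_congruentCurve (R := R) (a := a) (ha ▸ hlt.le)
  refine isMinimal_of_forall _ fun C hC hu => ?_
  have hΔ : 𝓿 (congruentCurve a).Δ = exp (-12) := by
    rw [valuation_congruentCurve_Δ, h2, ha, ← exp_add, ← exp_nsmul]; rfl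
  have hu' := valuation_u_eq_exp_neg_one hΔ C hu
  obtain ⟨h1, h2', h3, h4, -⟩ := IsIntegral.coeff_mem_range (R := R) (C • congruentCurve a)
  simp only [← valuation_le_one_iff_mem_range] at h1 h2' h3 h4
  have hv3 := valuation_three (h2 ▸ hlt)
  -- A smaller equation would have c₄ = 48a²/u⁴ of valuation 4 + 2 - 4 = 2. No integral equation
  -- does: c₄ ≡ a₁⁴ mod 2, so either a₁ is a unit and so is c₄, or 2 divides a₁ and then 16 divides
  -- c₄.
  have hc4 : 𝓿 (C • congruentCurve a).c₄ = exp (-2) := by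
    have h48 : (congruentCurve a).c₄ = 3 * 2 ^ 4 * a ^ 2 := by
      simp only [c₄, b₂, b₄, congruentCurve]; ring
    rw [variableChange_c₄, h48, Units.val_inv_eq_inv_val]
    simp only [map_mul, map_pow, map_inv₀, hu', h2, ha, hv3, one_mul]
    rw [← exp_neg, ← exp_nsmul, ← exp_nsmul, ← exp_nsmul, ← exp_add, ← exp_add]
    rfl
  generalize C • congruentCurve a = W at *
  have hc : W.c₄ = W.a₁ ^ 4 + 2 * (4 * (W.a₁ ^ 2 * W.a₂ + 2 * W.a₂ ^ 2 - 6 * W.a₄ - 3 * (W.a₁ * W.a₃))) := by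
    simp only [c₄, b₂, b₄]; ring
  have hint : ∀ x : F, x ∈ (algebraMap R F).range ↔ 𝓿 x ≤ 1 := fun x =>
    (valuation_le_one_iff_mem_range R x).symm
  have m1 := (hint _).mpr h1
  have m2 := (hint _).mpr h2'
  have m3 := (hint _).mpr h3
  have m4 := (hint _).mpr h4
  have ha1 : 𝓿 W.a₁ < 1 := by
    have : 𝓿 (W.a₁ ^ 4) < 1 := by
      rw [show W.a₁ ^ 4 = W.c₄ - 2 * (4 * (W.a₁ ^ 2 * W.a₂ + 2 * W.a₂ ^ 2 - 6 * W.a₄ -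
        3 * (W.a₁ * W.a₃))) by rw [hc]; ring]
      refine Valuation.map_sub_lt _ ?_ ?_
      · rw [hc4, ← exp_zero, exp_lt_exp]; norm_num
      · rw [map_mul]
        refine (mul_le_of_le_one_right' ?_).trans_lt (h2 ▸ hlt)
        rw [← hint]
        have := ofNat_mem (algebraMap R F).range
        exact mul_mem (this 4) (sub_mem (sub_mem (add_mem (mul_mem (pow_mem m1 2) m2)
          (mul_mem (this 2) (pow_mem m2 2))) (mul_mem (this 6) m4))
          (mul_mem (this 3) (mul_mem m1 m3)))
    rw [map_pow] at this
    exact (pow_lt_one_iff (by norm_num)).mp this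
  obtain ⟨a₁', ha₁'⟩ : ∃ z, W.a₁ = 2 * z :=
    ⟨W.a₁ / 2, by rw [mul_div_cancel₀]; intro h; simp [h] at h2; exact exp_ne_zero h2.symm⟩
  have m1' : a₁' ∈ (algebraMap R F).range := by
    rw [hint]
    rw [lt_one_iff_le_exp_neg_one, ha₁', map_mul, h2] at ha1
    by_contra! hlt'
    exact ha1.not_gt (lt_mul_of_one_lt_right (exp_pos) hlt')
  have hle : 𝓿 W.c₄ ≤ exp (-4) := by
    rw [show W.c₄ = 2 ^ 4 * ((a₁' ^ 2 + W.a₂) ^ 2 - 3 * (W.a₄ + a₁' * W.a₃)) by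
      simp only [c₄, b₂, b₄, ha₁']; ring, map_mul, map_pow, h2, ← exp_nsmul]
    refine mul_le_of_le_one_right' ?_
    rw [← hint]
    exact sub_mem (pow_mem (add_mem (pow_mem m1' 2) m2) 2)
      (mul_mem (ofNat_mem _ 3) (add_mem m4 (mul_mem m1' m3)))
  rw [hc4, exp_le_exp] at hle
  norm_num at hle

lemma dvd_of_valuation_le {x y : R} (hy : y ≠ 0)
    (h : 𝓿 (algebraMap R F x) ≤ 𝓿 (algebraMap R F y)) : y ∣ x := by
  have hy' : algebraMap R F y ≠ 0 := by simpa using hy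
  have : 𝓿 (algebraMap R F x / algebraMap R F y) ≤ 1 := by
    rw [map_div₀]
    exact div_le_one_of_le₀ h zero_le
  obtain ⟨z, hz⟩ := (valuation_le_one_iff_mem_range R _).mp this
  refine ⟨z, IsFractionRing.injective R F ?_⟩
  rw [map_mul, hz, mul_div_cancel₀ _ hy']

/-- Minimality of `y² = x³ - x` when `2` is the square of a uniformizer up to a unit, provided that
certain congruences have no solution. -/
lemma isMinimal_congruentCurve_one (h2 : 𝓿 (2 : F) = exp (-2))
    (H : ¬ ∃ r σ : R, r ^ 2 = 1 + 2 * σ ∧ 4 ∣ σ ^ 2 + 1) : IsMinimal R (congruentCurve (1 : F)) := by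
  have hlt : exp (-2 : ℤ) < 1 := by rw [← exp_zero, exp_lt_exp]; norm_num
  have := isIntegral_congruentCurve (R := R) (F := F) (a := 1) (by simp)
  refine isMinimal_of_forall _ fun C hC hu => H ?_
  have hΔ : 𝓿 (congruentCurve (1 : F)).Δ = exp (-12) := by
    rw [valuation_congruentCurve_Δ, h2, map_one, mul_one, ← exp_nsmul]; rfl
  have hu' := valuation_u_eq_exp_neg_one hΔ C hu
  have h20 : (2 : F) ≠ 0 := fun h => by simp [h] at h2; exact exp_ne_zero h2.symm
  have hv3 := valuation_three (h2 ▸ hlt)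
  have h30 : (3 : F) ≠ 0 := fun h => by simp [h] at hv3
  obtain ⟨t, ht⟩ := (valuation_le_one_iff_mem_range R (3⁻¹ : F)).mp (by rw [map_inv₀, hv3, inv_one])
  have ht3 : (t : R) * 3 = 1 := by
    apply IsFractionRing.injective R F
    rw [map_mul, ht, map_ofNat, map_one, inv_mul_cancel₀ h30]
  obtain ⟨b, hb⟩ : (C • congruentCurve (1 : F)).b₈ ∈ (algebraMap R F).range :=
    ⟨_, integralModel_b₈_eq R _⟩
  obtain ⟨u, hu''⟩ := (valuation_le_one_iff_mem_range R (C.u : F)).mp hu.le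
  have hu0 : (C.u : F) ≠ 0 := C.u.ne_zero
  -- The b₈ relation alone suffices: its right side is 3(r² - 1)² - 4, while u⁸ has the valuation of
  -- 16. As 3 is a unit, the relation also makes r integral.
  have e8 : (C.u : F) ^ 8 * (C • congruentCurve (1 : F)).b₈ = 3 * C.r ^ 4 - 6 * C.r ^ 2 - 1 := by
    rw [variableChange_b₈, Units.val_inv_eq_inv_val]
    simp only [b₂, b₄, b₆, b₈, congruentCurve]
    field_simp
    ring
  obtain ⟨r, hr⟩ : C.r ∈ (algebraMap R F).range := by
    refine mem_range_of_quartic (p := algebraMap R F (-2)) (q := 0)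
      (r := algebraMap R F (- (1 + u ^ 8 * b) * t)) ⟨_, rfl⟩ (zero_mem _) ⟨_, rfl⟩ ?_
    simp only [map_neg, map_mul, map_add, map_pow, map_one, map_ofNat, hu'', hb, ht, e8]
    field_simp
    ring
  rw [← hr] at e8
  have hz : (16 : R) ∣ 3 * (r ^ 2 - 1) ^ 2 - 4 := by
    refine dvd_of_valuation_le (F := F) ?_ ?_
    · intro h
      have := congrArg (algebraMap R F) h
      rw [map_ofNat, map_zero, show (16 : F) = 2 ^ 4 by norm_num] at this
      exact h20 (pow_eq_zero_iff (by norm_num) |>.mp this)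
    · rw [show algebraMap R F (3 * (r ^ 2 - 1) ^ 2 - 4) =
        (C.u : F) ^ 8 * (C • congruentCurve (1 : F)).b₈ by rw [e8]; simp only [map_sub, map_mul, map_pow, map_one, map_ofNat]; ring,
        map_ofNat, show (16 : F) = 2 ^ 4 by norm_num, map_mul, map_pow, map_pow, hu', h2,
        ← exp_nsmul, ← exp_nsmul]
      refine mul_le_of_le_one_right' ?_
      rw [valuation_le_one_iff_mem_range]
      exact ⟨b, hb⟩
  obtain ⟨z, hz⟩ := hz
  have hdvd : (2 : R) ∣ r ^ 2 - 1 := by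
    have h20' : (2 : R) ≠ 0 := fun h => h20 (by
      rw [← map_ofNat (algebraMap R F), h, map_zero])
    refine dvd_of_valuation_le (F := F) h20' ?_
    refine le_of_pow_le_pow_left₀ (n := 2) (by norm_num) zero_le ?_
    rw [← map_pow, ← map_pow, ← map_pow, ← map_pow,
      show (r ^ 2 - 1) ^ 2 = 2 ^ 2 * ((1 + 4 * z) * t) by
        linear_combination (-(r ^ 2 - 1) ^ 2) * ht3 + t * hz, map_mul, map_mul]
    refine mul_le_of_le_one_right' ?_
    rw [valuation_le_one_iff_mem_range]
    exact ⟨_, rfl⟩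
  obtain ⟨σ, hσ⟩ := hdvd
  -- Putting r² - 1 = 2σ gives 3σ² - 1 = 4z, hence 3(σ² + 1) = 4(z + 1); `t` is the inverse of 3.
  refine ⟨r, σ, by linear_combination hσ, (z + 1) * t, ?_⟩
  have h4 : (4 : R) ≠ 0 := fun h => by
    have := congrArg (algebraMap R F) h
    rw [map_ofNat, map_zero, show (4 : F) = 2 ^ 2 by norm_num] at this
    exact h20 (pow_eq_zero_iff (by norm_num) |>.mp this)
  have h3σ : 3 * σ ^ 2 - 1 = 4 * z := by
    refine mul_left_cancel₀ h4 ?_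
    rw [hσ] at hz
    linear_combination hz
  linear_combination (-(σ ^ 2 + 1)) * ht3 + t * h3σ

end Minimality
end WeierstrassCurve

namespace WeierstrassCurve

/-! ### Tamagawa factors of y² = x³ - a²x. -/

section Tamagawa

open IsDedekindDomain.HeightOneSpectrum WithZero

variable {R : Type*} [CommRing R] [IsDomain R] [IsDiscreteValuationRing R]
  {F : Type*} [Field F] [Algebra R F] [IsFractionRing R F]

local notation "𝓿" => HeightOneSpectrum.valuation F (IsDiscreteValuationRing.maximalIdeal R)

lemma exp_neg_one_lt_one : exp (-1 : ℤ) < 1 := by rw [← exp_zero, exp_lt_exp]; norm_num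

lemma exp_neg_two_lt_one : exp (-2 : ℤ) < 1 := by rw [← exp_zero, exp_lt_exp]; norm_num

lemma congruentCurve_Δ_ne_zero {a : F} (h20 : (2 : F) ≠ 0) (ha0 : a ≠ 0) :
    (congruentCurve a).Δ ≠ 0 := by
  rw [congruentCurve_Δ, show (64 : F) = 2 ^ 6 by norm_num]; positivity

/-- In residue characteristic 2 the derivative 3x² - a² is congruent to (x - a)², so the only
singular abscissa is a. -/
lemma valuation_sub_lt_one_of_singular {a x : F} (h2 : 𝓿 (2 : F) < 1) (ha : 𝓿 a ≤ 1) (hx : 𝓿 x ≤ 1)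
    (h : 𝓿 (3 * x ^ 2 - a ^ 2) < 1) : 𝓿 (x - a) < 1 := by
  have : 𝓿 ((x - a) ^ 2) < 1 := by
    rw [show (x - a) ^ 2 = (3 * x ^ 2 - a ^ 2) - 2 * (x ^ 2 + a * x - a ^ 2) by ring]
    refine Valuation.map_sub_lt _ h ?_
    rw [map_mul]
    refine (mul_le_of_le_one_right' ?_).trans_lt h2
    rw [valuation_le_one_iff_mem_range] at *
    exact sub_mem (add_mem (pow_mem hx 2) (mul_mem ha hx)) (pow_mem ha 2)
  rw [map_pow] at this
  exact (pow_lt_one_iff (by norm_num)).mp this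

lemma isMinimal_congruentCurve_of_unit {a : F} (h2 : 𝓿 (2 : F) = exp (-1)) (ha : 𝓿 a = 1) :
    IsMinimal R (congruentCurve a) := by
  have := isIntegral_congruentCurve (R := R) ha.le
  refine isMinimal_of_exp_lt_valuation_Δ _ ?_
  rw [valuation_congruentCurve_Δ, h2, ha, mul_one, ← exp_nsmul, exp_lt_exp]; norm_num

/-- The Tamagawa factor of `y² = x³ - a² x` when `2` is a uniformizer and `a` is a unit. -/
theorem tamagawaFactor_congruentCurve_of_unit {a : F} (h2 : 𝓿 (2 : F) = exp (-1)) (ha : 𝓿 a = 1) :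
    (congruentCurve a).tamagawaFactor R = 2 := by
  classical
  have := isMinimal_congruentCurve_of_unit h2 ha
  have h20 : (2 : F) ≠ 0 := fun h => by simp [h] at h2; exact exp_ne_zero h2.symm
  have ha0 : a ≠ 0 := fun h => by simp [h] at ha
  have hc : 𝓿 (3 * a ^ 2 - a ^ 2) = exp (-1) := by
    rw [show 3 * a ^ 2 - a ^ 2 = 2 * a ^ 2 by ring, map_mul, map_pow, ha, h2, one_pow, mul_one]
  have h2' : 𝓿 (2 : F) < 1 := h2 ▸ exp_neg_one_lt_one
  rw [tamagawaFactor_congruentCurve (e := a) (congruentCurve_Δ_ne_zero h20 ha0) (by ring) ha.le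
    (hc ▸ exp_neg_one_lt_one) fun x y _ hx _ h _ => valuation_sub_lt_one_of_singular h2' ha.le hx h]
  refine index_avoidsReductionSubgroup_eq_two _ _ _
    ((congruentCurve_nonsingular_iff h20 ha0).mpr (by ring)) fun x y _ h => ?_
  rw [hc]
  exact (lt_one_iff_le_exp_neg_one _).mp h

/-- The first-order point of the component group decides the Tamagawa factor of `y² = x³ - x` in the
case that `2` is the square of a uniformizer up to a unit. -/
theorem tamagawaFactor_congruentCurve_one_eq_two (h2 : 𝓿 (2 : F) = exp (-2))
    [IsMinimal R (congruentCurve (1 : F))]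
    (H : ∀ x y : F, y ^ 2 = x ^ 3 - x → 𝓿 (x - 1) ≠ exp (-1)) :
    (congruentCurve (1 : F)).tamagawaFactor R = 2 := by
  classical
  have h20 : (2 : F) ≠ 0 := fun h => by simp [h] at h2; exact exp_ne_zero h2.symm
  have hc : 𝓿 (3 * 1 ^ 2 - 1 ^ 2 : F) = exp (-2) := by norm_num [h2]
  have h2' : 𝓿 (2 : F) < 1 := h2 ▸ exp_neg_two_lt_one
  rw [tamagawaFactor_congruentCurve (e := 1) (congruentCurve_Δ_ne_zero h20 one_ne_zero) (by ring)
    (by simp) (hc ▸ exp_neg_two_lt_one) fun x y _ hx _ h _ =>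
      valuation_sub_lt_one_of_singular h2' (by simp) hx h]
  refine index_avoidsReductionSubgroup_eq_two _ _ _
    ((congruentCurve_nonsingular_iff h20 one_ne_zero).mpr (by ring)) fun x y hxy h => ?_
  rw [hc]
  exact (eq_exp_neg_one_or_le h).resolve_left (H x y (by linear_combination hxy))

theorem tamagawaFactor_congruentCurve_one_eq_four (h2 : 𝓿 (2 : F) = exp (-2))
    [IsMinimal R (congruentCurve (1 : F))] {x y : F} (hxy : y ^ 2 = x ^ 3 - x)
    (hx : 𝓿 (x - 1) = exp (-1)) :
    (congruentCurve (1 : F)).tamagawaFactor R = 4 := by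
  classical
  have h20 : (2 : F) ≠ 0 := fun h => by simp [h] at h2; exact exp_ne_zero h2.symm
  have hc : 𝓿 (3 * 1 ^ 2 - 1 ^ 2 : F) = exp (-2) := by norm_num [h2]
  have h2' : 𝓿 (2 : F) < 1 := h2 ▸ exp_neg_two_lt_one
  rw [tamagawaFactor_congruentCurve (e := 1) (congruentCurve_Δ_ne_zero h20 one_ne_zero) (by ring)
    (by simp) (hc ▸ exp_neg_two_lt_one) fun x y _ hx _ h _ =>
      valuation_sub_lt_one_of_singular h2' (by simp) hx h]
  exact index_avoidsReductionSubgroup_eq_four _ _ _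
    ((congruentCurve_nonsingular_iff h20 one_ne_zero).mpr (by ring)) hc
    ((congruentCurve_nonsingular_iff (y := y) h20 one_ne_zero).mpr (by rw [hxy]; ring)) hx

lemma valuation_le_one_of_mul {a b : F} (ha : 𝓿 a = exp (-1)) (hab : 𝓿 (a * b) < 1) :
    𝓿 b ≤ 1 := by
  rw [lt_one_iff_le_exp_neg_one, map_mul, ha] at hab
  by_contra! hlt
  exact hab.not_gt (lt_mul_of_one_lt_right exp_pos hlt)

/-- On `y² = x³ - a² x` with `a` a uniformizer, a point reducing to `(0, 0)` has its abscissa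
congruent to that of a `2`-torsion point to second order. -/
lemma valuation_lt_one_of_equation {a ξ y : F} (ha : 𝓿 a = exp (-1)) (hξ : 𝓿 ξ ≤ 1)
    (hy : y ^ 2 = (a * ξ) ^ 3 - a ^ 2 * (a * ξ)) : 𝓿 (ξ * ((ξ - 1) * (ξ + 1))) < 1 := by
  refine lt_of_le_of_ne ?_ fun h => ?_
  · rw [valuation_le_one_iff_mem_range] at *
    exact mul_mem hξ (mul_mem (sub_mem hξ (one_mem _)) (add_mem hξ (one_mem _)))
  · have := congrArg 𝓿 (show y ^ 2 = a ^ 3 * (ξ * ((ξ - 1) * (ξ + 1))) by rw [hy]; ring)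
    rw [map_mul, h, mul_one, map_pow, map_pow, ha, ← exp_nsmul] at this
    exact sq_ne_exp_of_odd _ (by decide) this

lemma valuation_mul_lt_one {x y : F} (hx : 𝓿 x ≤ 1) (hy : 𝓿 y ≤ 1) (h : 𝓿 (x * y) < 1) :
    𝓿 x < 1 ∨ 𝓿 y < 1 := by
  by_contra! H
  rw [map_mul, le_antisymm hx H.1, le_antisymm hy H.2, mul_one] at h
  exact h.false

lemma isMinimal_congruentCurve_of_odd {a : F} (h2 : 𝓿 (2 : F) = 1) (ha : 𝓿 a = exp (-1)) :
    IsMinimal R (congruentCurve a) := by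
  have := isIntegral_congruentCurve (R := R) (a := a) (ha ▸ exp_neg_one_lt_one.le)
  refine isMinimal_of_exp_lt_valuation_Δ _ ?_
  rw [valuation_congruentCurve_Δ, h2, ha, one_mul, ← exp_nsmul, exp_lt_exp]; norm_num

/-- The Tamagawa factor of `y² = x³ - a² x` when `2` is a unit and `a` is a uniformizer. -/
theorem tamagawaFactor_congruentCurve_of_odd {a : F} (h2 : 𝓿 (2 : F) = 1) (ha : 𝓿 a = exp (-1)) :
    (congruentCurve a).tamagawaFactor R = 4 := by
  classical
  have := isMinimal_congruentCurve_of_odd h2 ha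
  have h20 : (2 : F) ≠ 0 := fun h => by simp [h] at h2
  have ha0 : a ≠ 0 := fun h => by simp [h] at ha; exact exp_ne_zero ha.symm
  have ha1 : 𝓿 a < 1 := ha ▸ exp_neg_one_lt_one
  rw [tamagawaFactor_congruentCurve (e := 0) (congruentCurve_Δ_ne_zero h20 ha0) (by ring)
    (by simp) (by simpa [pow_lt_one_iff] using ha1) ?_]
  · refine index_avoidsReductionSubgroup_zero_eq_four h20 ha0 _ _ _ ha1 fun x y hxy hx => ?_
    obtain ⟨ξ, rfl⟩ : ∃ ξ, x = a * ξ := ⟨x / a, by field_simp⟩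
    have hξ := valuation_le_one_of_mul ha hx
    have hξ1 : 𝓿 (ξ - 1) ≤ 1 := Valuation.map_sub_le _ hξ (by simp)
    have hξ2 : 𝓿 (ξ + 1) ≤ 1 := Valuation.map_add_le _ hξ (by simp)
    have hprod := valuation_lt_one_of_equation ha hξ hxy
    have key : ∀ z : F, 𝓿 z < 1 → 𝓿 (a * z) ≤ 𝓿 (a ^ 2) := fun z hz => by
      rw [sq, map_mul, map_mul]
      gcongr
      rw [ha]
      exact (lt_one_iff_le_exp_neg_one _).mp hz
    have h22 : 𝓿 (2 * a ^ 2) = 𝓿 (a ^ 2) := by rw [map_mul, h2, one_mul]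
    rw [h22, show a * ξ - a = a * (ξ - 1) by ring, show a * ξ + a = a * (ξ + 1) by ring]
    -- The residue of ξ is one of 0, 1, -1, so x is close to the abscissa of one of the three points
    -- of order 2.
    rcases valuation_mul_lt_one hξ (by rw [map_mul]; exact mul_le_one' hξ1 hξ2) hprod with h | h
    · exact .inl (key _ h)
    · rcases valuation_mul_lt_one hξ1 hξ2 h with h | h
      · exact .inr (.inl (key _ h))
      · exact .inr (.inr (key _ h))
  · intro x y hxy hx hy _ h
    rw [map_mul, h2, one_mul] at h
    have : 𝓿 (x ^ 3) < 1 := by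
      rw [show x ^ 3 = y * y + a * (a * x) by linear_combination -hxy]
      refine Valuation.map_add_lt _ ?_ ?_
      · rw [map_mul]; exact (mul_le_of_le_one_right' hy).trans_lt h
      · rw [map_mul, map_mul]; exact (mul_le_of_le_one_right' (mul_le_one' ha1.le hx)).trans_lt ha1
    rw [map_pow] at this
    rw [sub_zero]
    exact (pow_lt_one_iff (by norm_num)).mp this

/-- The Tamagawa factor of `y² = x³ - a² x` when `2` and `a` are uniformizers. -/
theorem tamagawaFactor_congruentCurve_of_two_mul {a : F} (h2 : 𝓿 (2 : F) = exp (-1))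
    (ha : 𝓿 a = exp (-1)) : (congruentCurve a).tamagawaFactor R = 4 := by
  classical
  have := isMinimal_congruentCurve_of_two_mul h2 ha
  have h20 : (2 : F) ≠ 0 := fun h => by simp [h] at h2; exact exp_ne_zero h2.symm
  have ha0 : a ≠ 0 := fun h => by simp [h] at ha; exact exp_ne_zero ha.symm
  have ha1 : 𝓿 a < 1 := ha ▸ exp_neg_one_lt_one
  have h21 : 𝓿 (2 : F) < 1 := h2 ▸ exp_neg_one_lt_one
  rw [tamagawaFactor_congruentCurve (e := 0) (congruentCurve_Δ_ne_zero h20 ha0) (by ring)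
    (by simp) (by simpa [pow_lt_one_iff] using ha1) ?_]
  · refine index_avoidsReductionSubgroup_zero_eq_four h20 ha0 _ _ _ ha1 fun x y hxy hx => ?_
    obtain ⟨ξ, rfl⟩ : ∃ ξ, x = a * ξ := ⟨x / a, by field_simp⟩
    have hξ := valuation_le_one_of_mul ha hx
    have hξ1 : 𝓿 (ξ - 1) ≤ 1 := Valuation.map_sub_le _ hξ (by simp)
    have hξ2 : 𝓿 (ξ + 1) ≤ 1 := Valuation.map_add_le _ hξ (by simp)
    have hprod := valuation_lt_one_of_equation ha hξ hxy
    rcases lt_or_eq_of_le hξ with hlt | heq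
    · left
      rw [sq, map_mul, map_mul]
      gcongr
      rw [ha]
      exact (lt_one_iff_le_exp_neg_one _).mp hlt
    have hlt1 : 𝓿 (ξ - 1) < 1 := by
      rw [map_mul, heq, one_mul] at hprod
      rcases valuation_mul_lt_one hξ1 hξ2 hprod with h | h
      · exact h
      · rw [show ξ - 1 = (ξ + 1) - 2 by ring]; exact Valuation.map_sub_lt _ h h21
    -- Here 1 and -1 have the same residue, and a finer expansion has to separate a from -a. With ξ
    -- = 1 + 2k the equation is y² = 4a³ξk(k + 1); the factor 4a³ has odd valuation 5, so k or k + 1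
    -- is in the maximal ideal.
    obtain ⟨k, hk⟩ : ∃ k, ξ - 1 = 2 * k := ⟨(ξ - 1) / 2, by field_simp⟩
    have hk1 : 𝓿 k ≤ 1 := valuation_le_one_of_mul h2 (hk ▸ hlt1)
    have hk2 : 𝓿 (k + 1) ≤ 1 := Valuation.map_add_le _ hk1 (by simp)
    have hkk : 𝓿 (k * (k + 1)) < 1 := by
      refine lt_of_le_of_ne (by rw [map_mul]; exact mul_le_one' hk1 hk2) fun h => ?_
      have := congrArg 𝓿 (show y ^ 2 = a ^ 3 * 2 ^ 2 * ξ * (k * (k + 1)) by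
        rw [hxy]
        linear_combination a ^ 3 * ξ * ((ξ + 1) + 2 * k) * hk)
      rw [map_mul, h, mul_one, map_mul, heq, mul_one, map_mul, map_pow, map_pow, map_pow, ha, h2,
        ← exp_nsmul, ← exp_nsmul, ← exp_add] at this
      exact sq_ne_exp_of_odd _ (by decide) this
    have key : ∀ z : F, 𝓿 z < 1 → 𝓿 (a * (2 * z)) ≤ 𝓿 (2 * a ^ 2) := fun z hz => by
      rw [show 2 * a ^ 2 = a * (2 * a) by ring, map_mul, map_mul, map_mul, map_mul]
      gcongr
      rw [ha]
      exact (lt_one_iff_le_exp_neg_one _).mp hz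
    right
    rw [show a * ξ - a = a * (2 * k) by rw [← hk]; ring,
      show a * ξ + a = a * (2 * (k + 1)) by linear_combination a * hk]
    exact (valuation_mul_lt_one hk1 hk2 hkk).imp (key _) (key _)
  · intro x y hxy hx hy h _
    have : 𝓿 (x ^ 2) < 1 := by
      have h3 : 𝓿 (3 * x ^ 2) < 1 := by
        rw [show 3 * x ^ 2 = (3 * x ^ 2 - a ^ 2) + a ^ 2 by ring]
        refine Valuation.map_add_lt _ h ?_
        rw [map_pow]
        exact pow_lt_one' ha1 (by norm_num)
      rwa [map_mul, valuation_three h21, one_mul] at h3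
    rw [map_pow] at this
    rw [sub_zero]
    exact (pow_lt_one_iff (by norm_num)).mp this

end Tamagawa
end WeierstrassCurve

/-! ### Congruences in powers of a uniformizer when 2 = επ². -/

section Congruences

variable {R : Type*} [CommRing R]

lemma dvd_add_mul_self_iff {p a b : R} : p ∣ a + p * b ↔ p ∣ a :=
  (dvd_add_left (dvd_mul_right p b))

variable [IsDomain R]

/-- The congruences `r² = 1 + 2σ`, `σ² ≡ -1 mod 4` have no solution in a ramified quadratic
extension of the `2`-adic integers generated by a square root of a unit. -/
lemma no_congruence_of_one_add_sq {π ε s k : R} (hπ : Prime π) (hε : IsUnit ε)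
    (h2 : 2 = ε * π ^ 2) (hs : s ^ 2 = -1 + 4 * k) (hπs : π = 1 + s) :
    ¬ ∃ r σ : R, r ^ 2 = 1 + 2 * σ ∧ 4 ∣ σ ^ 2 + 1 := by
  rintro ⟨r, σ, hr, j, hj⟩
  have hπ0 : π ≠ 0 := hπ.ne_zero
  have hεπ : ¬ π ∣ ε := fun h => hπ.not_isUnit (isUnit_of_dvd_unit h hε)
  obtain ⟨η, hη⟩ := hε.exists_left_inv
  -- From σ² ≡ -1 ≡ s² mod 4 it follows that σ ≡ s mod π, and then mod π², hence mod 2.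
  have d1 : π ∣ σ - s := by
    refine hπ.dvd_of_dvd_pow (n := 2) ⟨ε * π * (2 * j - 2 * k - s * (σ - s)), ?_⟩
    linear_combination hj - hs + (2 * j - 2 * k - s * (σ - s)) * h2
  obtain ⟨d, hd⟩ := d1
  have d2 : π ∣ d := by
    have : d * (d + ε * π * s) = π * (ε ^ 2 * π * (j - k)) := by
      refine mul_left_cancel₀ (pow_ne_zero 2 hπ0) ?_
      have e4 : (4 : R) = ε ^ 2 * π ^ 4 := by linear_combination (2 + ε * π ^ 2) * h2
      linear_combination (-(σ - s) - π * d - 2 * s) * hd + hj - hs + (j - k) * e4 - s * π * d * h2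
    rcases hπ.dvd_or_dvd ⟨_, this⟩ with h | h
    · exact h
    · rwa [mul_comm ε, mul_assoc, dvd_add_mul_self_iff] at h
  obtain ⟨d', rfl⟩ := d2
  have e4 : (4 : R) = ε ^ 2 * π ^ 4 := by linear_combination (2 + ε * π ^ 2) * h2
  -- Since π² = (1 + s)² = 2s + 4k and σ ≡ s mod 2, the equation for r becomes r² ≡ 1 + π² mod 4.
  have hr2 : r ^ 2 - 1 - π ^ 2 = 4 * (η * d' - k) := by
    rw [hr, hπs, ← hπs]
    have : σ = s + 2 * η * d' := by linear_combination hd - π ^ 2 * d' * hη - η * d' * h2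
    rw [this, hπs]
    linear_combination -hs
  have d3 : π ∣ r - 1 := by
    refine hπ.dvd_of_dvd_pow (n := 2) ⟨π + ε * π * (2 * (η * d' - k) - (r - 1)), ?_⟩
    linear_combination hr2 + (2 * (η * d' - k) - (r - 1)) * h2
  obtain ⟨κ, hκ⟩ := d3
  have hκ2 : κ ^ 2 + ε * π * κ - 1 = ε ^ 2 * π ^ 2 * (η * d' - k) := by
    refine mul_left_cancel₀ (pow_ne_zero 2 hπ0) ?_
    linear_combination hr2 - (r + 1 + π * κ) * hκ + (η * d' - k) * e4 - π * κ * h2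
  have d4 : π ∣ κ - 1 := by
    refine hπ.dvd_of_dvd_pow (n := 2)
      ⟨ε ^ 2 * π * (η * d' - k) - ε * κ - ε * π * (κ - 1), ?_⟩
    linear_combination hκ2 - (κ - 1) * h2
  obtain ⟨μ, hμ⟩ := d4
  -- Now r = 1 + π + π²μ, so r² - 1 - π² ≡ 2π = επ³ mod π⁴. Being a multiple of 4, it is divisible
  -- by π⁴, and so π divides ε.
  refine hεπ ⟨ε ^ 2 * (η * d' - k) - μ ^ 2 - ε * π * μ - ε * μ, ?_⟩
  refine mul_left_cancel₀ hπ0 ?_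
  obtain rfl : κ = 1 + π * μ := by linear_combination hμ
  linear_combination hκ2 - π * μ * h2

/-- The congruence `σ² ≡ -1 mod 4` has no solution in a ramified quadratic extension of the
`2`-adic integers generated by a square root of twice a unit. -/
lemma no_congruence_of_sq {π ε m k : R} (hπ : Prime π) (h2 : 2 = ε * π ^ 2)
    (hm : ε * m = 1) (hk : m = 1 + 2 * k) :
    ¬ ∃ r σ : R, r ^ 2 = 1 + 2 * σ ∧ 4 ∣ σ ^ 2 + 1 := by
  rintro ⟨-, σ, -, j, hj⟩
  have hπ0 : π ≠ 0 := hπ.ne_zero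
  have d1 : π ∣ σ - 1 := by
    refine hπ.dvd_of_dvd_pow (n := 2) ⟨ε * π * (2 * j - σ), ?_⟩
    linear_combination hj + (2 * j - σ) * h2
  obtain ⟨η, hη⟩ := d1
  have hη2 : η ^ 2 = 2 * ε * j - ε * (1 + π * η) := by
    refine mul_left_cancel₀ (pow_ne_zero 2 hπ0) ?_
    obtain rfl : σ = 1 + π * η := by linear_combination hη
    linear_combination hj + (2 * j - (1 + π * η)) * h2
  have hε : ε = 1 - 2 * k * ε := by linear_combination hm - ε * hk
  have d2 : π ∣ η + 1 := by
    refine hπ.dvd_of_dvd_pow (n := 2) ⟨ε * π * (ε * j + k * ε * (1 + π * η) + η) - η, ?_⟩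
    linear_combination hη2 + (-(1 + π * η)) * hε + (ε * j + k * ε * (1 + π * η) + η) * h2
  obtain ⟨μ, hμ⟩ := d2
  -- As ε ≡ 1 mod 2, the relation reads η² + 1 + πη ≡ 0 mod π². Since π divides η + 1, also η² + 1 =
  -- (η + 1)² - 2η vanishes mod π², leaving π ∣ η, which contradicts η ≡ -1.
  have d3 : π ∣ η := by
    refine ⟨ε * (ε * j + k * ε * (1 + π * η) + η) - μ ^ 2, ?_⟩
    refine mul_left_cancel₀ hπ0 ?_
    linear_combination hη2 + (-(1 + π * η)) * hε + (ε * j + k * ε * (1 + π * η) + η) * h2 -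
      (η + 1 + π * μ) * hμ
  refine hπ.not_isUnit (isUnit_of_dvd_one ?_)
  have := dvd_sub (Dvd.intro _ hμ.symm) d3
  simpa using this

/-- The common shape of the equation for a first-order point. -/
lemma exists_firstOrder {π ε x y α : R} (hπ : Prime π) (h2 : 2 = ε * π ^ 2)
    (hα : IsUnit α) (hx : x = 1 + π * α) (hxy : y ^ 2 = x ^ 3 - x) :
    ∃ τ : R, α ^ 2 + ε + ε * π * α = α * (π * τ ^ 2 + ε * π ^ 2 * τ) := by
  have hπ0 : π ≠ 0 := hπ.ne_zero
  obtain ⟨γ, hγ⟩ := hα.exists_left_inv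
  have hy : y ^ 2 = π ^ 2 * ((1 + π * α) * (α ^ 2 + ε * π * α)) := by
    rw [hxy, hx]
    linear_combination (1 + π * α) * π * α * h2
  obtain ⟨β, rfl⟩ : π ∣ y := hπ.dvd_of_dvd_pow (n := 2) ⟨_, by rw [hy, sq π, mul_assoc]⟩
  have hβ : β ^ 2 = (1 + π * α) * (α ^ 2 + ε * π * α) := by
    refine mul_left_cancel₀ (pow_ne_zero 2 hπ0) ?_
    linear_combination hy
  -- The quotient θ = y/(πα) satisfies θ² = (1 + πα)(1 + επ/α), so θ ≡ 1 mod π; the witness is τ =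
  -- (θ - 1)/π.
  have hθ : (β * γ) ^ 2 = 1 + π * (α + ε * γ + ε * π) := by
    linear_combination γ ^ 2 * hβ + (1 + π * α) * (γ * α + 1 + ε * π * γ) * hγ + ε * π ^ 2 * hγ
  obtain ⟨τ, hτ⟩ : π ∣ β * γ - 1 := by
    refine hπ.dvd_of_dvd_pow (n := 2) ⟨α + ε * γ + ε * π - ε * π * (β * γ - 1), ?_⟩
    linear_combination hθ - (β * γ - 1) * h2
  refine ⟨τ, mul_left_cancel₀ hπ0 ?_⟩
  have hβγ : β * γ = 1 + π * τ := by linear_combination hτ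
  rw [hβγ] at hθ
  linear_combination -α * hθ - π * ε * hγ + α * π * τ * h2

/-- There is no first-order point on `y² = x³ - x` over the ring of integers of `ℚ₂(√3)`. -/
lemma no_firstOrder_of_one_add_sq {π ε w k x y α : R} (hπ : Prime π) (hε : IsUnit ε)
    (hres : ∀ z : R, π ∣ z ∨ π ∣ z - 1)
    (h2 : 2 = ε * π ^ 2) (hw : ε * w = 1) (hwπ : w = 1 + π + 4 * k)
    (hα : IsUnit α) (hx : x = 1 + π * α) : y ^ 2 ≠ x ^ 3 - x := by
  intro hxy
  have hπ0 : π ≠ 0 := hπ.ne_zero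
  have hεπ : ¬ π ∣ ε := fun h => hπ.not_isUnit (isUnit_of_dvd_unit h hε)
  have hαπ : ¬ π ∣ α := fun h => hπ.not_isUnit (isUnit_of_dvd_unit h hα)
  obtain ⟨τ, hτ⟩ := exists_firstOrder hπ h2 hα hx hxy
  obtain ⟨a, ha⟩ := (hres α).resolve_left hαπ
  have hτw : w * α ^ 2 + 1 + π * α = α * (w * π * τ ^ 2 + π ^ 2 * τ) := by
    linear_combination w * hτ + (-1 - π * α + α * π ^ 2 * τ) * hw
  obtain rfl : α = 1 + π * a := by linear_combination ha
  -- With α = 1 + πa the left side of `hτw` is π²(ε + a² + a) up to multiples of π³, which `X`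
  -- collects. So π divides τ, and after one more division π divides ε + a² + a.
  obtain ⟨X, hX⟩ : ∃ X, X = ε + ε * a + ε * π * a + a ^ 2 + ε ^ 2 * π * k * (1 + π * a) ^ 2 :=
    ⟨_, rfl⟩
  have e4 : (4 : R) = ε ^ 2 * π ^ 4 := by linear_combination (2 + ε * π ^ 2) * h2
  have h1 : π * (ε + a ^ 2 + a + π * X) = (1 + π * a) * (w * τ ^ 2 + π * τ) := by
    refine mul_left_cancel₀ hπ0 ?_
    linear_combination hτw - (1 + π * a) ^ 2 * hwπ - k * (1 + π * a) ^ 2 * e4 + π ^ 3 * hX -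
      (1 + π + π * a + π ^ 2 * a) * h2
  have hwπ' : ¬ π ∣ w := fun h => hπ.not_isUnit (isUnit_of_dvd_one (hw ▸ h.mul_left ε))
  obtain ⟨t, rfl⟩ : π ∣ τ := by
    have : π ∣ w * τ ^ 2 + π * τ := (hπ.dvd_or_dvd ⟨_, h1.symm⟩).resolve_left hαπ
    rw [dvd_add_mul_self_iff] at this
    exact hπ.dvd_of_dvd_pow ((hπ.dvd_or_dvd this).resolve_left hwπ')
  have h3 : ε + a ^ 2 + a = π * ((1 + π * a) * (w * t ^ 2 + t) - X) := by
    refine mul_left_cancel₀ hπ0 ?_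
    linear_combination h1
  -- The residue field has two elements, so a² + a vanishes in it, and π would divide the unit ε.
  refine hεπ ?_
  rcases hres a with ⟨b, hb⟩ | ⟨b, hb⟩
  · refine ⟨(1 + π * a) * (w * t ^ 2 + t) - X - b * (a + 1), ?_⟩
    linear_combination h3 - (a + 1) * hb
  · refine ⟨(1 + π * a) * (w * t ^ 2 + t) - X - b * a - ε * π * a, ?_⟩
    linear_combination h3 - a * hb - a * h2

/-- There is no first-order point on `y² = x³ - x` over the ring of integers of `ℚ₂(√6)`. -/
lemma no_firstOrder_of_sq {π ε m k x y α : R} (hπ : Prime π)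
    (hres : ∀ z : R, π ∣ z ∨ π ∣ z - 1)
    (h2 : 2 = ε * π ^ 2) (hm : ε * m = 1) (hk : m = -1 + 4 * k)
    (hα : IsUnit α) (hx : x = 1 + π * α) : y ^ 2 ≠ x ^ 3 - x := by
  intro hxy
  have hπ0 : π ≠ 0 := hπ.ne_zero
  have h1π : ¬ π ∣ 1 := fun h => hπ.not_isUnit (isUnit_of_dvd_one h)
  have hαπ : ¬ π ∣ α := fun h => hπ.not_isUnit (isUnit_of_dvd_unit h hα)
  obtain ⟨τ, hτ⟩ := exists_firstOrder hπ h2 hα hx hxy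
  obtain ⟨a, ha⟩ := (hres α).resolve_left hαπ
  have hτm : m * α ^ 2 + 1 + π * α = α * (m * π * τ ^ 2 + π ^ 2 * τ) := by
    linear_combination m * hτ + (-1 - π * α + α * π ^ 2 * τ) * hm
  have e4 : (4 : R) = ε ^ 2 * π ^ 4 := by linear_combination (2 + ε * π ^ 2) * h2
  have h1 : 1 + π * a - 2 * a - π * a ^ 2 + ε ^ 2 * π ^ 3 * k * α ^ 2 =
      α * (m * τ ^ 2 + π * τ) := by
    refine mul_left_cancel₀ hπ0 ?_
    obtain rfl : α = 1 + π * a := by linear_combination ha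
    linear_combination hτm - (1 + π * a) ^ 2 * hk - k * (1 + π * a) ^ 2 * e4
  -- Modulo π the relation `h1` is 1 ≡ τ², since 2 and the terms with π vanish.
  obtain ⟨t, ht⟩ : π ∣ τ - 1 := by
    refine (hres τ).resolve_left fun ⟨t, ht⟩ => h1π ⟨α * (m * π * t ^ 2 + π * t) - a + ε * π * a +
      a ^ 2 - ε ^ 2 * π ^ 2 * k * α ^ 2, ?_⟩
    subst ht
    linear_combination h1 + a * h2
  obtain rfl : τ = 1 + π * t := by linear_combination ht
  obtain rfl : α = 1 + π * a := by linear_combination ha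
  obtain ⟨Y, hY⟩ : ∃ Y, Y = ε + ε * π * a - ε * a - a + (1 + π * a) * (t ^ 2 - t) +
      ε * π * t * (1 + π * a) + ε ^ 2 * π * k * (1 + π * a) ^ 2 -
      ε ^ 2 * π ^ 2 * k * (1 + π * a) * (1 + π * t) ^ 2 := ⟨_, rfl⟩
  have h3 : a ^ 2 + 1 = π * Y := by
    refine mul_left_cancel₀ hπ0 ?_
    linear_combination -h1 - (1 + π * a) * (1 + π * t) ^ 2 * hk -
      k * (1 + π * a) * (1 + π * t) ^ 2 * e4 - π ^ 2 * hY +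
      (1 + π * a - a + π * t * (1 + π * a)) * h2
  obtain ⟨b, hb⟩ : π ∣ a - 1 := by
    refine (hres a).resolve_left fun ⟨b, hb⟩ => h1π ⟨Y - b * a, ?_⟩
    linear_combination h3 - a * hb
  have h4 : Y = π * (ε + ε * π * b + b ^ 2) := by
    refine mul_left_cancel₀ hπ0 ?_
    obtain rfl : a = 1 + π * b := by linear_combination hb
    linear_combination -h3 + (1 + π * b) * h2
  obtain ⟨c, hc⟩ : π ∣ t ^ 2 - t := by
    rcases hres t with ⟨c, hc⟩ | ⟨c, hc⟩
    · exact ⟨c * (t - 1), by linear_combination (t - 1) * hc⟩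
    · exact ⟨c * t, by linear_combination t * hc⟩
  -- By `h4`, π divides Y. But with a ≡ 1 and t² ≡ t mod π the definition of Y gives Y ≡ ε - ε - 1 =
  -- -1.
  refine h1π ⟨ε * a - ε * b - b + (1 + π * a) * c + ε * t * (1 + π * a) +
    ε ^ 2 * k * (1 + π * a) ^ 2 - ε ^ 2 * π * k * (1 + π * a) * (1 + π * t) ^ 2 -
    (ε + ε * π * b + b ^ 2), ?_⟩
  linear_combination hY - h4 + (1 + π * a) * hc - (1 + ε) * hb

end Congruences

namespace WeierstrassCurve

/-! ### Tamagawa factors of y² = x³ - x over ramified dyadic fields. -/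

section RamifiedDyadic

open IsDedekindDomain.HeightOneSpectrum WithZero

variable {R : Type*} [CommRing R] [IsDomain R] [IsDiscreteValuationRing R]
  {F : Type*} [Field F] [Algebra R F] [IsFractionRing R F]

local notation "𝓿" => HeightOneSpectrum.valuation F (IsDiscreteValuationRing.maximalIdeal R)

lemma valuation_intCast_le_one (j : ℤ) : 𝓿 (j : F) ≤ 1 :=
  (valuation_le_one_iff_mem_range R _).mpr ⟨j, by simp⟩

lemma valuation_intCast_of_odd (h2 : 𝓿 (2 : F) < 1) {j : ℤ} (hj : Odd j) : 𝓿 (j : F) = 1 := by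
  obtain ⟨k, rfl⟩ := hj
  rw [add_comm]
  push_cast
  refine Valuation.map_one_add_of_lt _ ?_
  rw [map_mul]
  exact (mul_le_of_le_one_right' (valuation_intCast_le_one k)).trans_lt h2

lemma exists_isUnit_lift {x : F} (hx : 𝓿 x = 1) : ∃ u : R, IsUnit u ∧ algebraMap R F u = x := by
  obtain ⟨u, rfl⟩ := (valuation_le_one_iff_mem_range R _).mp hx.le
  refine ⟨u, ?_, rfl⟩
  have h0 : algebraMap R F u ≠ 0 := fun h => by simp [h] at hx
  obtain ⟨u', hu'⟩ := (valuation_le_one_iff_mem_range R (algebraMap R F u)⁻¹).mp (by simp [hx])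
  refine IsUnit.of_mul_eq_one u' (IsFractionRing.injective R F ?_)
  rw [map_mul, hu', mul_inv_cancel₀ h0, map_one]

lemma prime_of_valuation_eq {π : R} (hπ : 𝓿 (algebraMap R F π) = exp (-1)) : Prime π := by
  have h0 : π ≠ 0 := fun h => by simp [h] at hπ; exact exp_ne_zero hπ.symm
  have hlt : exp (-1 : ℤ) < 1 := exp_neg_one_lt_one
  refine ⟨h0, fun h => ?_, fun a b hab => ?_⟩
  · obtain ⟨c, hc⟩ := h.exists_left_inv
    have h1 := congrArg (fun x => 𝓿 (algebraMap R F x)) hc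
    simp only [map_mul, map_one, hπ] at h1
    exact ((mul_le_of_le_one_left' (valuation_le_one (K := F) _ c)).trans_lt hlt).ne h1
  · obtain ⟨c, hc⟩ := hab
    by_contra! h
    have key : ∀ z : R, ¬ π ∣ z → 𝓿 (algebraMap R F z) = 1 := fun z hz => by
      refine le_antisymm (valuation_le_one _ z) (not_lt.mp fun hlt => hz ?_)
      exact dvd_of_valuation_le (F := F) h0 (hπ ▸ (lt_one_iff_le_exp_neg_one _).mp hlt)
    have h1 := congrArg (fun x => 𝓿 (algebraMap R F x)) hc
    simp only [map_mul, key a h.1, key b h.2, hπ, mul_one] at h1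
    exact ((mul_le_of_le_one_right' (valuation_le_one (K := F) _ c)).trans_lt hlt).ne h1.symm

lemma valuation_eq_exp_neg_one_of_sq {x : F} (h : 𝓿 (x ^ 2) = exp (-2)) : 𝓿 x = exp (-1) := by
  rw [map_pow, show (-2 : ℤ) = (-1) + (-1) by rfl, exp_add, ← sq] at h
  exact (pow_left_inj₀ zero_le zero_le two_ne_zero).mp h

lemma dvd_or_dvd_sub_one {π : R} (hπ : 𝓿 (algebraMap R F π) = exp (-1))
    (hres : ∀ z : F, 𝓿 z ≤ 1 → 𝓿 z < 1 ∨ 𝓿 (z - 1) < 1) (z : R) : π ∣ z ∨ π ∣ z - 1 := by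
  have h0 : π ≠ 0 := fun h => by simp [h] at hπ; exact exp_ne_zero hπ.symm
  refine (hres (algebraMap R F z) (valuation_le_one _ z)).imp (fun h => ?_) (fun h => ?_)
  · exact dvd_of_valuation_le (F := F) h0 (hπ ▸ (lt_one_iff_le_exp_neg_one _).mp h)
  · refine dvd_of_valuation_le (F := F) h0 (hπ ▸ (lt_one_iff_le_exp_neg_one _).mp ?_)
    simpa using h

/-- A first-order point has integral coordinates, because y is a root of a monic quadratic over R;
hence congruences in R can exclude it. -/
lemma valuation_sub_one_ne_of_forall {π : R} (hπ : 𝓿 (algebraMap R F π) = exp (-1))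
    (H : ∀ X Y α : R, IsUnit α → X = 1 + π * α → Y ^ 2 ≠ X ^ 3 - X) (x y : F)
    (hxy : y ^ 2 = x ^ 3 - x) : 𝓿 (x - 1) ≠ exp (-1) := by
  intro hx
  have h0 : algebraMap R F π ≠ 0 := fun h => by simp [h] at hπ; exact exp_ne_zero hπ.symm
  obtain ⟨α, hα, hα'⟩ := exists_isUnit_lift (R := R) (x := (x - 1) / algebraMap R F π) (by
    rw [map_div₀, hπ, hx, div_self exp_ne_zero])
  rw [eq_div_iff h0] at hα'
  obtain rfl : x = algebraMap R F (1 + π * α) := by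
    rw [map_add, map_mul, map_one]; linear_combination -hα'
  obtain ⟨Y, rfl⟩ : y ∈ (algebraMap R F).range := by
    refine mem_range_of_quadratic (p := 0) (q := -algebraMap R F ((1 + π * α) ^ 3 - (1 + π * α)))
      (zero_mem _) (neg_mem ⟨_, rfl⟩) ?_
    rw [hxy]; simp
  refine H _ Y α hα rfl (IsFractionRing.injective R F ?_)
  simpa using hxy

lemma exists_uniformizer_of_two_mul (h2 : 𝓿 (2 : F) = exp (-2)) {z u : F} (hu : 𝓿 u = 1)
    (hz : z ^ 2 = 2 * u) : 𝓿 z = exp (-1) ∧ ∃ π ε w : R, algebraMap R F π = z ∧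
      algebraMap R F w = u ∧ IsUnit ε ∧ Prime π ∧ 2 = ε * π ^ 2 ∧ ε * w = 1 := by
  have hz' : 𝓿 z = exp (-1) := valuation_eq_exp_neg_one_of_sq (by rw [hz, map_mul, h2, hu, mul_one])
  obtain ⟨π, rfl⟩ := (valuation_le_one_iff_mem_range R _).mp
    (hz'.trans_le exp_neg_one_lt_one.le)
  obtain ⟨w, hw, rfl⟩ := exists_isUnit_lift hu
  obtain ⟨ε, hε⟩ := hw.exists_left_inv
  refine ⟨hz', π, ε, w, rfl, rfl, .of_mul_eq_one w hε, prime_of_valuation_eq hz', ?_, hε⟩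
  have : π ^ 2 = 2 * w := IsFractionRing.injective R F (by simpa [map_ofNat] using hz)
  linear_combination -ε * this - 2 * hε

/-- The identity (1 + s)² = 2(s + 2 + 2j) makes 1 + s a square root of 2 times a unit. That unit is
w, the inverse of ε, rewritten by s = π - 1. -/
lemma exists_uniformizer_one_add (h2 : 𝓿 (2 : F) = exp (-2)) {s : F} {j : ℤ}
    (hs : s ^ 2 = ((3 + 4 * j : ℤ) : F)) : 𝓿 (1 + s) = exp (-1) ∧
      ∃ π ε w t : R, algebraMap R F π = 1 + s ∧ π = 1 + t ∧ t ^ 2 = -1 + 4 * (1 + j) ∧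
      w = 1 + π + 2 * j ∧ IsUnit ε ∧ Prime π ∧ 2 = ε * π ^ 2 ∧ ε * w = 1 := by
  have h2' : 𝓿 (2 : F) < 1 := h2 ▸ exp_neg_two_lt_one
  have hs1 : 𝓿 s = 1 := by
    have := valuation_intCast_of_odd (R := R) h2' (j := 3 + 4 * j) ⟨1 + 2 * j, by ring⟩
    rw [← hs, map_pow] at this
    exact (pow_eq_one_iff_of_nonneg zero_le two_ne_zero).mp this
  have hu : 𝓿 (s + 2 * (1 + j : ℤ)) = 1 := by
    rw [Valuation.map_add_eq_of_lt_left, hs1]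
    rw [hs1, map_mul]
    exact (mul_le_of_le_one_right' (valuation_intCast_le_one _)).trans_lt h2'
  obtain ⟨h1, π, ε, w, hπ, hw, hε, hp, e1, e2⟩ := exists_uniformizer_of_two_mul h2 hu
    (z := 1 + s) (by push_cast at hs ⊢; linear_combination hs)
  refine ⟨h1, π, ε, w, π - 1, hπ, by ring, ?_, ?_, hε, hp, e1, e2⟩
  · refine IsFractionRing.injective R F ?_
    simp only [map_pow, map_sub, hπ, map_one, map_add, map_neg, map_mul, map_intCast, map_ofNat]
    push_cast at hs
    linear_combination hs
  · refine IsFractionRing.injective R F ?_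
    simp only [map_add, hπ, hw, map_one, map_mul, map_ofNat, map_intCast]
    push_cast
    ring

/-- Minimality of `y² = x³ - x` over `ℚ₂(√n)` for `n ≡ 3 mod 4`. -/
theorem isMinimal_congruentCurve_one_of_three (h2 : 𝓿 (2 : F) = exp (-2)) {s : F} {j : ℤ}
    (hs : s ^ 2 = ((3 + 4 * j : ℤ) : F)) : IsMinimal R (congruentCurve (1 : F)) := by
  obtain ⟨-, π, ε, w, t, -, hπt, ht, -, hε, hp, e1, -⟩ := exists_uniformizer_one_add (R := R) h2 hs
  exact isMinimal_congruentCurve_one h2 (no_congruence_of_one_add_sq hp hε e1 ht hπt)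

lemma valuation_sqrt_of_two_mul (h2 : 𝓿 (2 : F) = exp (-2)) {s : F} {j : ℤ}
    (hs : s ^ 2 = ((2 * (1 + 2 * j) : ℤ) : F)) : 𝓿 s = exp (-1) :=
  (exists_uniformizer_of_two_mul (R := R) (u := ((1 + 2 * j : ℤ) : F)) h2
    (valuation_intCast_of_odd (h2 ▸ exp_neg_two_lt_one) ⟨j, by ring⟩)
    (by rw [hs]; push_cast; ring)).1

/-- Minimality of `y² = x³ - x` over `ℚ₂(√n)` for `n ≡ 2 mod 4`. -/
theorem isMinimal_congruentCurve_one_of_two (h2 : 𝓿 (2 : F) = exp (-2)) {s : F} {j : ℤ}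
    (hs : s ^ 2 = ((2 * (1 + 2 * j) : ℤ) : F)) : IsMinimal R (congruentCurve (1 : F)) := by
  obtain ⟨-, π, ε, w, -, hw, -, hp, e1, e2⟩ := exists_uniformizer_of_two_mul (R := R) h2
    (valuation_intCast_of_odd (h2 ▸ exp_neg_two_lt_one) (j := 1 + 2 * j) ⟨j, by ring⟩)
    (by rw [hs]; push_cast; ring)
  refine isMinimal_congruentCurve_one h2 (no_congruence_of_sq (k := j) hp e1 e2 ?_)
  exact IsFractionRing.injective R F (by simp [hw, map_ofNat])

theorem tamagawaFactor_congruentCurve_one_of_three (h2 : 𝓿 (2 : F) = exp (-2))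
    (hres : ∀ z : F, 𝓿 z ≤ 1 → 𝓿 z < 1 ∨ 𝓿 (z - 1) < 1) {s : F} {j : ℤ}
    (hs : s ^ 2 = ((3 + 8 * j : ℤ) : F)) : (congruentCurve (1 : F)).tamagawaFactor R = 2 := by
  have hs' : s ^ 2 = ((3 + 4 * (2 * j) : ℤ) : F) := by rw [hs]; push_cast; ring
  have := isMinimal_congruentCurve_one_of_three (R := R) h2 hs'
  obtain ⟨h1, π, ε, w, t, hπ, -, -, hw, hε, hp, e1, e2⟩ :=
    exists_uniformizer_one_add (R := R) h2 hs'
  rw [← hπ] at h1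
  have hw' : w = 1 + π + 4 * j := by rw [hw]; push_cast; ring
  have H : ∀ X Y α : R, IsUnit α → X = 1 + π * α → Y ^ 2 ≠ X ^ 3 - X := fun X Y α hα hX =>
    no_firstOrder_of_one_add_sq hp hε (dvd_or_dvd_sub_one h1 hres) e1 e2 hw' hα hX
  exact tamagawaFactor_congruentCurve_one_eq_two h2 (valuation_sub_one_ne_of_forall h1 H)

theorem tamagawaFactor_congruentCurve_one_of_six (h2 : 𝓿 (2 : F) = exp (-2))
    (hres : ∀ z : F, 𝓿 z ≤ 1 → 𝓿 z < 1 ∨ 𝓿 (z - 1) < 1) {s : F} {j : ℤ}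
    (hs : s ^ 2 = ((6 + 8 * j : ℤ) : F)) : (congruentCurve (1 : F)).tamagawaFactor R = 2 := by
  have := isMinimal_congruentCurve_one_of_two (R := R) (j := 1 + 2 * j) h2
    (s := s) (by rw [hs]; push_cast; ring)
  obtain ⟨h1, π, ε, w, hπ, hw, -, hp, e1, e2⟩ := exists_uniformizer_of_two_mul (R := R) h2
    (valuation_intCast_of_odd (h2 ▸ exp_neg_two_lt_one) (j := 3 + 4 * j) ⟨1 + 2 * j, by ring⟩)
    (z := s) (by rw [hs]; push_cast; ring)
  rw [← hπ] at h1
  have hw' : w = -1 + 4 * ((1 + j : ℤ) : R) := IsFractionRing.injective R F (by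
    rw [hw]; simp only [map_add, map_neg, map_one, map_mul, map_intCast, map_ofNat]
    push_cast; ring)
  have H : ∀ X Y α : R, IsUnit α → X = 1 + π * α → Y ^ 2 ≠ X ^ 3 - X := fun X Y α hα hX =>
    no_firstOrder_of_sq hp (dvd_or_dvd_sub_one h1 hres) e1 e2 hw' hα hX
  exact tamagawaFactor_congruentCurve_one_eq_two h2 (valuation_sub_one_ne_of_forall h1 H)

/-- Here -(7 + 8j) = 1 + 8(-1 - j) is a square, so the field contains i. The point (i, 1 - i) is of
first order, as (i - 1)² = -2i. -/
theorem tamagawaFactor_congruentCurve_one_of_seven (h2 : 𝓿 (2 : F) = exp (-2))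
    (hsq : ∀ c : F, 𝓿 c < 1 → ∃ q : F, q ^ 2 = 1 + 4 * c) {s : F} {j : ℤ}
    (hs : s ^ 2 = ((7 + 8 * j : ℤ) : F)) : (congruentCurve (1 : F)).tamagawaFactor R = 4 := by
  have h2' : 𝓿 (2 : F) < 1 := h2 ▸ exp_neg_two_lt_one
  have := isMinimal_congruentCurve_one_of_three (R := R) h2 (s := s) (j := 1 + 2 * j)
    (by rw [hs]; push_cast; ring)
  obtain ⟨q, hq⟩ := hsq (2 * ((-1 - j : ℤ) : F)) (by
    rw [map_mul]; exact (mul_le_of_le_one_right' (valuation_intCast_le_one _)).trans_lt h2')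
  have hq0 : q ≠ 0 := by
    rintro rfl
    have := valuation_intCast_of_odd (R := R) h2' (j := 7 + 8 * j) ⟨3 + 4 * j, by ring⟩
    rw [show ((7 + 8 * j : ℤ) : F) = 0 by push_cast at hq ⊢; linear_combination hq] at this
    simp at this
  have hi : (s / q) ^ 2 = -1 := by
    rw [div_pow, div_eq_iff (pow_ne_zero 2 hq0), hs, hq]; push_cast; ring
  generalize s / q = i at hi
  refine tamagawaFactor_congruentCurve_one_eq_four h2 (x := i) (y := 1 - i)
    (by linear_combination (1 - i) * hi) (valuation_eq_exp_neg_one_of_sq ?_)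
  have hi1 : 𝓿 i = 1 := by
    have := congrArg 𝓿 hi
    rw [map_pow, Valuation.map_neg, map_one] at this
    exact (pow_eq_one_iff_of_nonneg zero_le two_ne_zero).mp this
  rw [show (i - 1) ^ 2 = -(2 * i) by linear_combination hi, Valuation.map_neg, map_mul, h2, hi1,
    mul_one]

/-- At x = 1 + s one has x³ - x = s(1 + s)(2 + s). Dividing by s²(1 + s)² and using s² = 2m with m =
1 + 4j leaves (m + s)/(m(1 + s)) = 1 - 4js/(m(1 + s)), a square by `hsq`. -/
theorem tamagawaFactor_congruentCurve_one_of_two (h2 : 𝓿 (2 : F) = exp (-2))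
    (hsq : ∀ c : F, 𝓿 c < 1 → ∃ q : F, q ^ 2 = 1 + 4 * c) {s : F} {j : ℤ}
    (hs : s ^ 2 = ((2 + 8 * j : ℤ) : F)) : (congruentCurve (1 : F)).tamagawaFactor R = 4 := by
  have h2' : 𝓿 (2 : F) < 1 := h2 ▸ exp_neg_two_lt_one
  have hs' : s ^ 2 = ((2 * (1 + 2 * (2 * j)) : ℤ) : F) := by rw [hs]; push_cast; ring
  have := isMinimal_congruentCurve_one_of_two (R := R) h2 hs'
  have hs1 := valuation_sqrt_of_two_mul (R := R) h2 hs'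
  have hs1' : 𝓿 s < 1 := hs1 ▸ exp_neg_one_lt_one
  have hm := valuation_intCast_of_odd (R := R) h2' (j := 1 + 4 * j) ⟨2 * j, by ring⟩
  have h1s : 𝓿 (1 + s) = 1 := Valuation.map_one_add_of_lt _ hs1'
  have hm0 : ((1 + 4 * j : ℤ) : F) ≠ 0 := fun h => by simp [h] at hm
  have hs0 : (1 + s) ≠ 0 := fun h => by simp [h] at h1s
  obtain ⟨q, hq⟩ := hsq (-(j * s) / ((1 + 4 * j : ℤ) * (1 + s))) (by
    rw [map_div₀, map_mul, Valuation.map_neg, map_mul, h1s, hm, mul_one, div_one]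
    exact (mul_le_of_le_one_left' (valuation_intCast_le_one _)).trans_lt hs1')
  refine tamagawaFactor_congruentCurve_one_eq_four h2 (x := 1 + s) (y := s * (1 + s) * q) ?_
    (by rwa [add_sub_cancel_left])
  rw [mul_pow, hq]
  push_cast at hs hm0 ⊢
  field_simp
  linear_combination s * hs

end RamifiedDyadic

end WeierstrassCurve

namespace WeierstrassCurve

open WithZero

/-- Two discrete valuations with the same valuation ring coincide. -/
lemma _root_.Valuation.eq_of_le_one_iff {F : Type*} [Field F]
    {v₁ v₂ : Valuation F (WithZero (Multiplicative ℤ))} (h : ∀ x, v₁ x ≤ 1 ↔ v₂ x ≤ 1)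
    (h₁ : ∃ x, v₁ x = exp (-1)) (h₂ : ∃ x, v₂ x = exp (-1)) (x : F) : v₁ x = v₂ x := by
  have hle : ∀ a b : F, b ≠ 0 → (v₁ a ≤ v₁ b ↔ v₂ a ≤ v₂ b) := fun a b hb => by
    have := h (a / b)
    rwa [map_div₀, map_div₀, div_le_one₀ (by simpa [zero_lt_iff]),
      div_le_one₀ (by simpa [zero_lt_iff])] at this
  have hlt : ∀ a : F, a ≠ 0 → (v₁ a < 1 ↔ v₂ a < 1) := fun a ha => by
    have := (hle 1 a ha).not
    rwa [not_le, not_le, map_one, map_one] at this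
  obtain ⟨a, ha⟩ := h₁
  obtain ⟨b, hb⟩ := h₂
  have ha0 : a ≠ 0 := fun h => by simp [h] at ha; exact exp_ne_zero ha.symm
  have hb0 : b ≠ 0 := fun h => by simp [h] at hb; exact exp_ne_zero hb.symm
  have hb1 : v₁ b = exp (-1) := by
    refine le_antisymm ((lt_one_iff_le_exp_neg_one _).mp
      ((hlt b hb0).mpr (hb ▸ exp_neg_one_lt_one))) ?_
    rw [← ha, hle a b hb0, hb, ← lt_one_iff_le_exp_neg_one, ← hlt a ha0, ha]
    exact exp_neg_one_lt_one
  rcases eq_or_ne x 0 with rfl | hx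
  · simp
  have key : ∀ {v : Valuation F (WithZero (Multiplicative ℤ))} (_ : v b = exp (-1)) (k : ℤ),
      v x = exp (-k) ↔ v (x / b ^ k) = 1 := fun hv k => by
    rw [map_div₀, map_zpow₀, hv, ← exp_zsmul, div_eq_one_iff_eq exp_ne_zero]
    simp
  obtain ⟨k, hk⟩ : ∃ k : ℤ, v₁ x = exp (-k) := ⟨-log (v₁ x), by simp [exp_log, hx]⟩
  rw [hk, eq_comm, key hb]
  rw [key hb1] at hk
  have h0 : x / b ^ k ≠ 0 := by positivity
  refine le_antisymm ((h _).mp hk.le) (not_lt.mp ?_)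
  rw [← hlt _ h0, hk]
  exact lt_irrefl 1

end WeierstrassCurve

namespace MKT

open HeightOneSpectrum WithZero

/-! ### Valuation, norm and squares in a completion. -/

section Completion

variable {K : Type*} [Field K] [NumberField K] (v : HeightOneSpectrum (𝓞 K))

lemma valued_algebraMap (x : K) :
    Valued.v (algebraMap K (v.adicCompletion K) x) = v.valuation K x :=
  valuedAdicCompletion_eq_valuation' v x

/-- This links the valuation of a discrete valuation ring, in which the local results are phrased,
to the one carried by the completion. -/
lemma valuation_maximalIdeal_eq_valued (x : v.adicCompletion K) :
    (IsDiscreteValuationRing.maximalIdeal (v.adicCompletionIntegers K)).valuation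
      (v.adicCompletion K) x = Valued.v x := by
  refine Valuation.eq_of_le_one_iff (fun x => ?_) (valuation_exists_uniformizer _ _) ?_ x
  · rw [WeierstrassCurve.valuation_le_one_iff_mem_range]
    exact ⟨fun ⟨y, hy⟩ => hy ▸ y.2, fun h => ⟨⟨x, h⟩, rfl⟩⟩
  · obtain ⟨y, hy⟩ := v.valuation_exists_uniformizer K
    exact ⟨algebraMap K _ y, by rw [valued_algebraMap, hy]⟩

lemma norm_eq_of_valued_eq {x : v.adicCompletion K} {k : ℤ} (h : Valued.v x = exp k) :
    ‖x‖ = (Ideal.absNorm v.asIdeal : ℝ) ^ k := by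
  rw [FinitePlace.norm_def, h, WithZeroMulInt.toNNReal_neg_apply _ exp_ne_zero]
  simp only [NNReal.coe_zpow, NNReal.coe_natCast]
  rfl

lemma norm_le_iff (x y : v.adicCompletion K) : ‖x‖ ≤ ‖y‖ ↔ Valued.v x ≤ Valued.v y := by
  rw [FinitePlace.norm_def, FinitePlace.norm_def, NNReal.coe_le_coe,
    (WithZeroMulInt.toNNReal_strictMono (HeightOneSpectrum.one_lt_absNorm_nnreal v)).le_iff_le]

lemma norm_lt_one_iff (x : v.adicCompletion K) : ‖x‖ < 1 ↔ Valued.v x < 1 := by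
  have := (norm_le_iff v 1 x).not
  rwa [not_le, not_le, norm_one, map_one] at this

lemma norm_sub_le_max (x y : v.adicCompletion K) : ‖x - y‖ ≤ max ‖x‖ ‖y‖ := by
  rcases le_total ‖x‖ ‖y‖ with h | h
  · rw [max_eq_right h, norm_le_iff]
    exact (Valuation.map_sub _ _ _).trans (max_le ((norm_le_iff v _ _).mp h) le_rfl)
  · rw [max_eq_left h, norm_le_iff]
    exact (Valuation.map_sub _ _ _).trans (max_le le_rfl ((norm_le_iff v _ _).mp h))

/-- In a completion, the elements `1 + 4 * c` with `c` in the maximal ideal are squares. -/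
lemma exists_sq_eq_one_add_four_mul {c : v.adicCompletion K} (hc : Valued.v c < 1) :
    ∃ q : v.adicCompletion K, q ^ 2 = 1 + 4 * c := by
  rw [← norm_lt_one_iff] at hc
  have hcl : IsComplete (Metric.closedBall (0 : v.adicCompletion K) ‖c‖) :=
    Metric.isClosed_closedBall.isComplete
  -- The equation (1 + 2t)² = 1 + 4c says t = c - t². The map t ↦ c - t² contracts the closed ball
  -- of radius ‖c‖ with ratio ‖c‖, so the fixed point exists even in residue characteristic 2.
  have hmaps : Set.MapsTo (fun t => c - t ^ 2) (Metric.closedBall (0 : v.adicCompletion K) ‖c‖)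
      (Metric.closedBall 0 ‖c‖) := fun t ht => by
    rw [mem_closedBall_zero_iff] at ht ⊢
    refine (norm_sub_le_max v _ _).trans (max_le le_rfl ?_)
    rw [norm_pow, sq]
    exact (mul_le_of_le_one_left (norm_nonneg _) (ht.trans hc.le)).trans ht
  have hcontr : ContractingWith ‖c‖₊ (hmaps.restrict (fun t => c - t ^ 2) _ _) := by
    refine ⟨hc, LipschitzWith.of_dist_le_mul fun ⟨t, ht⟩ ⟨t', ht'⟩ => ?_⟩
    rw [mem_closedBall_zero_iff] at ht ht'
    rw [Subtype.dist_eq, Subtype.dist_eq, dist_eq_norm, dist_eq_norm]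
    change ‖c - t ^ 2 - (c - t' ^ 2)‖ ≤ ‖c‖ * ‖t - t'‖
    rw [show c - t ^ 2 - (c - t' ^ 2) = (-t' - t) * (t - t') by ring, norm_mul]
    refine mul_le_mul_of_nonneg_right ((norm_sub_le_max v _ _).trans ?_) (norm_nonneg _)
    rw [norm_neg]
    exact max_le ht' ht
  obtain ⟨t, -, ht, -⟩ := hcontr.exists_fixedPoint' hcl hmaps
    (Metric.mem_closedBall_self (norm_nonneg c)) (edist_ne_top _ _)
  refine ⟨1 + 2 * t, ?_⟩
  have : c - t ^ 2 = t := ht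
  linear_combination -4 * this

lemma valued_intCast (j : ℤ) : Valued.v (j : v.adicCompletion K) = v.valuation K j := by
  rw [← valued_algebraMap, map_intCast (algebraMap K (v.adicCompletion K))]

lemma exists_valued_sub_lt_one {z : v.adicCompletion K} (hz : Valued.v z ≤ 1) :
    ∃ r : 𝓞 K, Valued.v (z - algebraMap K _ (algebraMap (𝓞 K) K r)) < 1 := by
  have hopen : IsOpen {y : v.adicCompletion K | ‖z - y‖ < 1} := by
    have h1 : Continuous fun y : v.adicCompletion K => ‖z - y‖ := by fun_prop
    exact isOpen_lt h1 continuous_const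
  obtain ⟨q, hq⟩ := (v.denseRange_algebraMap K).exists_mem_open hopen ⟨z, by simp⟩
  rw [Set.mem_ofPred_eq, norm_lt_one_iff] at hq
  have hq1 : v.valuation K q ≤ 1 := by
    rw [← valued_algebraMap]
    have := Valuation.map_sub Valued.v z (z - algebraMap K (v.adicCompletion K) q)
    rw [sub_sub_cancel] at this
    exact this.trans (max_le hz hq.le)
  obtain ⟨r, hr⟩ := v.exists_valuation_sub_lt_of_integer hq1 1
  rw [Units.val_one, ← valued_algebraMap, map_sub] at hr
  refine ⟨r, ?_⟩
  rw [← sub_sub_sub_cancel_right _ _ (algebraMap K (v.adicCompletion K) q)]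
  exact Valuation.map_sub_lt _ hq hr

end Completion

end MKT

namespace MKT

open HeightOneSpectrum WithZero

/-! ### The embedding of completions and its effect on valuations. -/

section CompletionMap

variable {F K : Type*} [Field F] [NumberField F] [Field K] [NumberField K] [Algebra F K]
  (v : HeightOneSpectrum (𝓞 F)) (w : HeightOneSpectrum (𝓞 K)) [w.asIdeal.LiesOver v.asIdeal]

/-- Approximate x by an element of F, for which the bound is known, closely enough on both sides of
the continuous map. -/
lemma valued_completionMap_le_one {x : v.adicCompletion F} (hx : Valued.v x ≤ 1) :
    Valued.v (completionMap v w x) ≤ 1 := by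
  have hopen : IsOpen {y : v.adicCompletion F | ‖y - x‖ < 1 ∧
      ‖completionMap v w y - completionMap v w x‖ < 1} := by
    have := continuous_completionMap v w
    have h1 : Continuous fun y : v.adicCompletion F => ‖y - x‖ := by fun_prop
    have h2 : Continuous fun y => ‖completionMap v w y - completionMap v w x‖ := by fun_prop
    exact (isOpen_lt h1 continuous_const).inter (isOpen_lt h2 continuous_const)
  obtain ⟨q, hq1, hq2⟩ := (v.denseRange_algebraMap F).exists_mem_open hopen ⟨x, by simp⟩
  rw [norm_lt_one_iff] at hq1 hq2
  rw [completionMap_algebraMap] at hq2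
  have hq : v.valuation F q ≤ 1 := by
    rw [← valued_algebraMap]
    have := Valuation.map_add Valued.v (algebraMap F (v.adicCompletion F) q - x) x
    rw [sub_add_cancel] at this
    exact this.trans (max_le hq1.le hx)
  have hq' : Valued.v (algebraMap F (w.adicCompletion K) q) ≤ 1 := by
    rw [IsScalarTower.algebraMap_apply F K, valued_algebraMap, ← valuation_liesOver K v w]
    exact pow_le_one₀ zero_le hq
  have := Valuation.map_sub Valued.v (algebraMap F (w.adicCompletion K) q)
    (algebraMap F (w.adicCompletion K) q - completionMap v w x)
  rw [sub_sub_cancel] at this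
  exact this.trans (max_le hq' hq2.le)

lemma valued_completionMap_eq_one {x : v.adicCompletion F} (hx : Valued.v x = 1) :
    Valued.v (completionMap v w x) = 1 := by
  refine le_antisymm (valued_completionMap_le_one v w hx.le) ?_
  have := valued_completionMap_le_one v w (x := x⁻¹) (by simp [hx])
  rw [map_inv₀, map_inv₀] at this
  have h0 : Valued.v (completionMap v w x) ≠ 0 := by
    rw [Valuation.ne_zero_iff, Ne, map_eq_zero]
    rintro rfl
    simp at hx
  exact (inv_le_one₀ (zero_lt_iff.mpr h0)).mp this

lemma valued_completionMap {p : F} (hp : v.valuation F p = exp (-1)) {e : ℕ}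
    (he : w.valuation K (algebraMap F K p) = exp (-e : ℤ)) (x : v.adicCompletion F) :
    Valued.v (completionMap v w x) = Valued.v x ^ e := by
  rcases eq_or_ne x 0 with rfl | hx
  -- At x = 0 the exponent matters, since 0⁰ = 1; it is nonzero because the prime below is in the
  -- maximal ideal above.
  · have : e ≠ 0 := by
      rintro rfl
      rw [← valuation_liesOver K v w, hp] at he
      have h := Ideal.IsDedekindDomain.ramificationIdx'_ne_zero_of_liesOver (p := v.asIdeal) w.asIdeal v.ne_bot
      have := pow_lt_one₀ zero_le WeierstrassCurve.exp_neg_one_lt_one h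
      rw [he] at this
      simp at this
    simp [this]
  obtain ⟨k, hk⟩ : ∃ k : ℤ, Valued.v x = exp (-k) := ⟨-log (Valued.v x), by simp [exp_log, hx]⟩
  have hp0 : p ≠ 0 := fun h => by simp [h] at hp; exact exp_ne_zero hp.symm
  have hp0' : algebraMap F (v.adicCompletion F) p ≠ 0 := by simpa using hp0
  have h1 : Valued.v (x / algebraMap F (v.adicCompletion F) p ^ k) = 1 := by
    rw [map_div₀, map_zpow₀, valued_algebraMap, hp, hk, ← exp_zsmul, smul_eq_mul, mul_neg_one,
      div_self exp_ne_zero]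
  have h2 := valued_completionMap_eq_one v w h1
  rw [map_div₀, map_zpow₀, map_div₀, map_zpow₀, completionMap_algebraMap,
    IsScalarTower.algebraMap_apply F K, valued_algebraMap, he, ← exp_zsmul,
    div_eq_one_iff_eq exp_ne_zero] at h2
  rw [h2, hk, ← exp_nsmul]
  congr 1
  simp [mul_comm]

open scoped Valued in
-- The span of 1 and s over F_v is finite-dimensional, hence closed, and it contains the dense
-- subfield K.
lemma exists_eq_completionMap_add_mul {s : K}
    (hs : ∀ x : K, ∃ a b : F, x = algebraMap F K a + algebraMap F K b * s)
    (z : w.adicCompletion K) : ∃ a b : v.adicCompletion F,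
      z = completionMap v w a + completionMap v w b * algebraMap K (w.adicCompletion K) s := by
  let := completionAlgebra v w
  have : ContinuousSMul (v.adicCompletion F) (w.adicCompletion K) :=
    ⟨((continuous_completionMap v w).comp continuous_fst).mul continuous_snd⟩
  let S : Submodule (v.adicCompletion F) (w.adicCompletion K) :=
    .span _ {1, algebraMap K (w.adicCompletion K) s}
  have : FiniteDimensional (v.adicCompletion F) S :=
    FiniteDimensional.span_of_finite _ (Set.toFinite _)
  have hS : (S : Set (w.adicCompletion K)) = Set.univ := by
    rw [← S.closed_of_finiteDimensional.closure_eq]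
    refine ((w.denseRange_algebraMap K).mono ?_).closure_eq
    rintro _ ⟨x, rfl⟩
    obtain ⟨a, b, rfl⟩ := hs x
    refine Submodule.mem_span_pair.mpr
      ⟨algebraMap F (v.adicCompletion F) a, algebraMap F (v.adicCompletion F) b, ?_⟩
    rw [Algebra.smul_def, Algebra.smul_def, mul_one]
    change completionMap v w _ + completionMap v w _ * _ = _
    rw [completionMap_algebraMap, completionMap_algebraMap, map_add, map_mul,
      ← IsScalarTower.algebraMap_apply, ← IsScalarTower.algebraMap_apply]
  have hz : z ∈ S := by rw [← SetLike.mem_coe, hS]; trivial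
  obtain ⟨a, b, h⟩ := Submodule.mem_span_pair.mp hz
  refine ⟨a, b, ?_⟩
  rw [← h, Algebra.smul_def, Algebra.smul_def, mul_one]
  rfl

end CompletionMap

end MKT

namespace MKT

/-! ### Discriminants of quadratic extensions. -/

section Discriminant

/-- The basis elements have traces 2 and t, so the trace matrix has rows (2, t) and (t, t² - 2N). -/
lemma discr_of_basis_fin_two {A S : Type*} [CommRing A] [CommRing S] [Algebra A S]
    (b : Module.Basis (Fin 2) A S) (h0 : b 0 = 1) {t N : A} (h1 : b 1 ^ 2 = t • b 1 - N • b 0) :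
    Algebra.discr A b = t ^ 2 - 4 * N := by
  have tr : ∀ x, Algebra.trace A S x = b.repr (x * b 0) 0 + b.repr (x * b 1) 1 := fun x => by
    rw [Algebra.trace_eq_matrix_trace b, Matrix.trace_fin_two, Algebra.leftMulMatrix_eq_repr_mul,
      Algebra.leftMulMatrix_eq_repr_mul]
  have t0 : Algebra.trace A S (b 0) = 2 := by
    rw [tr, h0, one_mul, one_mul, ← h0]
    simp [one_add_one_eq_two]
  have t1 : Algebra.trace A S (b 1) = t := by
    rw [tr, ← sq, h1, h0, mul_one, ← h0]
    simp
  rw [Algebra.discr_def, Matrix.det_fin_two]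
  simp only [Algebra.traceMatrix_apply, Algebra.traceForm_apply]
  rw [← sq (b 1), h1, map_sub, map_smul, map_smul, t1, h0, one_mul, one_mul, mul_one, ← h0, t0, t1,
    smul_eq_mul, smul_eq_mul]
  ring

/-- The basis in `extensionDiscriminant` is unspecified; passing from it to the explicit basis 1, π
costs the square of a unit determinant. -/
theorem exists_extensionDiscriminant_eq (R F L : Type*) [CommRing R] [IsDomain R]
    [IsPrincipalIdealRing R]
    [Field F] [Algebra R F] [IsFractionRing R F] [Field L] [Algebra F L] [Algebra R L]
    [IsScalarTower R F L] [FiniteDimensional F L] [Algebra.IsSeparable F L] {π : L} {t N : R}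
    (hπ : π ^ 2 = algebraMap R L t * π - algebraMap R L N)
    (hspan : ∀ x : L, IsIntegral R x → ∃ c d : R, x = algebraMap R L c + algebraMap R L d * π)
    (hind : ∀ c d : R, algebraMap R L c + algebraMap R L d * π = 0 → c = 0 ∧ d = 0) :
    ∃ u : Rˣ, extensionDiscriminant R F L = u ^ 2 * (t ^ 2 - 4 * N) := by
  have hint : π ∈ integralClosure R L := by
    refine ⟨.X ^ 2 - .C t * .X + .C N, by monicity!, ?_⟩
    simp only [Polynomial.eval₂_add, Polynomial.eval₂_sub, Polynomial.eval₂_mul,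
      Polynomial.eval₂_pow, Polynomial.eval₂_X, Polynomial.eval₂_C]
    linear_combination hπ
  let g : Fin 2 → integralClosure R L := ![1, ⟨π, hint⟩]
  have hli : LinearIndependent R g := by
    rw [LinearIndependent.pair_iff]
    intro c d h
    refine hind c d ?_
    have := congrArg (Subtype.val : integralClosure R L → L) h
    simpa [Algebra.smul_def] using this
  have hsp : ⊤ ≤ Submodule.span R (Set.range g) := by
    rintro ⟨x, hx⟩ -
    obtain ⟨c, d, rfl⟩ := hspan x hx
    rw [Matrix.range_cons_cons_empty, Submodule.mem_span_pair]
    refine ⟨c, d, Subtype.ext ?_⟩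
    simp [Algebra.smul_def]
  let b := Module.Basis.mk hli hsp
  have hb : Algebra.discr R b = t ^ 2 - 4 * N := by
    refine discr_of_basis_fin_two b (by simp [b, g]) (Subtype.ext ?_)
    simpa [b, g, Algebra.smul_def] using hπ
  have key : ∀ {ι : Type} [Fintype ι] [DecidableEq ι] (b' : Module.Basis ι R (integralClosure R L)),
      ∃ u : Rˣ, Algebra.discr R b' = u ^ 2 * (t ^ 2 - 4 * N) := fun b' => by
    let e := b'.indexEquiv b
    obtain ⟨u, hu⟩ := b.isUnit_det (b'.reindex e)
    refine ⟨u, ?_⟩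
    rw [← Algebra.discr_reindex R b' e, ← hb, hu, Module.Basis.det_apply,
      ← Algebra.discr_of_matrix_vecMul, Module.Basis.toMatrix_map_vecMul, Module.Basis.coe_reindex]
  have : Module.IsTorsionFree R L := .trans_faithfulSMul R F L
  have : IsNoetherian R (integralClosure R L) :=
    IsIntegralClosure.isNoetherian R F L (integralClosure R L)
  have : Module.Free R (integralClosure R L) :=
    IsIntegralClosure.module_free R F L (integralClosure R L)
  exact key _

end Discriminant

end MKT

namespace MKT

open HeightOneSpectrum WithZero

/-! ### The discriminant of an extension of completions. -/

section LocalDiscriminant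

variable {F K : Type*} [Field F] [NumberField F] [Field K] [NumberField K] [Algebra F K]
  (v : HeightOneSpectrum (𝓞 F)) (w : HeightOneSpectrum (𝓞 K)) [w.asIdeal.LiesOver v.asIdeal]

lemma valued_le_one_of_isIntegral {x : w.adicCompletion K}
    (hx : letI := completionAlgebra v w; IsIntegral (v.adicCompletionIntegers F) x) :
    Valued.v x ≤ 1 := by
  let := completionAlgebra v w
  obtain ⟨P, hP, h⟩ := hx
  let g : v.adicCompletionIntegers F →+* w.adicCompletionIntegers K :=
    ((completionMap v w).comp (v.adicCompletionIntegers F).subtype).codRestrict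
      (w.adicCompletionIntegers K).toSubring fun y => valued_completionMap_le_one v w y.2
  have hint : IsIntegral (w.adicCompletionIntegers K) x := by
    refine ⟨P.map g, hP.map g, ?_⟩
    rw [Polynomial.eval₂_map]
    exact h
  obtain ⟨y, rfl⟩ := IsIntegrallyClosed.isIntegral_iff.mp hint
  exact y.2

theorem valued_localDiscriminant {θ : w.adicCompletion K} {t N : v.adicCompletion F}
    (ht : Valued.v t ≤ 1) (hN : Valued.v N ≤ 1)
    (hθ : θ ^ 2 = completionMap v w t * θ - completionMap v w N)
    (hspan : ∀ z, ∃ a b, z = completionMap v w a + completionMap v w b * θ)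
    (hval : ∀ a b, Valued.v (completionMap v w a + completionMap v w b * θ) ≤ 1 →
      Valued.v a ≤ 1 ∧ Valued.v b ≤ 1) :
    Valued.v (localDiscriminant v w) = Valued.v (t ^ 2 - 4 * N) := by
  let := completionAlgebra v w
  have := finiteDimensional_completion v w
  obtain ⟨y, hy⟩ := valuedAdicCompletion_surjective F v (exp 1)
  have hy1 : ¬ Valued.v y ≤ 1 := by
    rw [hy, ← exp_zero, exp_le_exp]; norm_num
  -- A linear relation may be scaled arbitrarily, so by `hval` all multiples of its coefficients
  -- would be integral; hence they vanish.
  have hind : ∀ a b, completionMap v w a + completionMap v w b * θ = 0 → a = 0 ∧ b = 0 := by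
    intro a b hab
    have h : ∀ c, Valued.v (c * a) ≤ 1 ∧ Valued.v (c * b) ≤ 1 := fun c => by
      refine hval _ _ ?_
      rw [map_mul, map_mul, mul_assoc, ← mul_add, hab]
      simp
    constructor
    · by_contra h0
      exact hy1 (by simpa [h0] using (h (y / a)).1)
    · by_contra h0
      exact hy1 (by simpa [h0] using (h (y / b)).2)
  obtain ⟨u, hu⟩ := exists_extensionDiscriminant_eq (v.adicCompletionIntegers F)
    (v.adicCompletion F) (w.adicCompletion K) (π := θ) (t := ⟨t, ht⟩) (N := ⟨N, hN⟩) hθ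
    (fun x hx => by
      obtain ⟨a, b, rfl⟩ := hspan x
      obtain ⟨ha, hb⟩ := hval a b (valued_le_one_of_isIntegral v w hx)
      exact ⟨⟨a, ha⟩, ⟨b, hb⟩, rfl⟩)
    (fun c d h => by
      obtain ⟨hc, hd⟩ := hind c d h
      exact ⟨Subtype.ext hc, Subtype.ext hd⟩)
  have hu1 : Valued.v ((u : v.adicCompletionIntegers F) : v.adicCompletion F) = 1 :=
    adicCompletionIntegers.isUnit_iff_valued_eq_one.mp u.isUnit
  have : localDiscriminant v w =
      ((u : v.adicCompletionIntegers F) : v.adicCompletion F) ^ 2 * (t ^ 2 - 4 * N) :=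
    congrArg (algebraMap (v.adicCompletionIntegers F) (v.adicCompletion F)) hu
  rw [this, map_mul, map_pow, hu1, one_pow, one_mul]

/-- In a ramified quadratic extension, `1` and a uniformizer span the ring of integers. -/
lemma valued_le_one_of_ramified (he : ∀ x, Valued.v (completionMap v w x) = Valued.v x ^ 2)
    {θ : w.adicCompletion K} (hθ : Valued.v θ = exp (-1)) (a b : v.adicCompletion F)
    (h : Valued.v (completionMap v w a + completionMap v w b * θ) ≤ 1) :
    Valued.v a ≤ 1 ∧ Valued.v b ≤ 1 := by
  have hb : Valued.v (completionMap v w b * θ) = Valued.v b ^ 2 * exp (-1) := by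
    rw [map_mul, he, hθ]
  have aux : ∀ g : WithZero (Multiplicative ℤ), g ^ 2 * exp (-1) ≤ 1 → g ≤ 1 := fun g hg => by
    rcases eq_or_ne g 0 with rfl | h0
    · simp
    · rw [← exp_log h0, ← exp_nsmul, ← exp_add, ← exp_zero, exp_le_exp] at hg
      rw [← exp_log h0, ← exp_zero, exp_le_exp]
      simp at hg
      omega
  -- Elements of F_v have even valuation in K_w and θ has odd valuation, so the two summands never
  -- cancel.
  have hne : Valued.v (completionMap v w a) ≠ Valued.v (completionMap v w b * θ) ∨ b = 0 := by
    by_contra! hc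
    obtain ⟨h1, h2⟩ := hc
    have hb0 : Valued.v b ≠ 0 := by simpa using h2
    rw [he, hb] at h1
    refine sq_ne_exp_of_odd (Valued.v a / Valued.v b) (k := -1) (by decide) ?_
    rw [div_pow, h1, mul_div_cancel_left₀ _ (pow_ne_zero 2 hb0)]
  rcases hne with hne | rfl
  · rw [Valuation.map_add_of_distinct_val _ hne, max_le_iff, he, hb] at h
    exact ⟨(pow_le_one_iff_of_nonneg zero_le two_ne_zero).mp h.1, aux _ h.2⟩
  · rw [map_zero, zero_mul, add_zero, he] at h
    exact ⟨(pow_le_one_iff_of_nonneg zero_le two_ne_zero).mp h, by simp⟩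

/-- In an unramified quadratic extension, `1` and a generator of the residue field extension span
the ring of integers. -/
lemma valued_le_one_of_unramified (he : ∀ x, Valued.v (completionMap v w x) = Valued.v x)
    {θ : w.adicCompletion K}
    (hθ : ∀ u, Valued.v u ≤ 1 → Valued.v (completionMap v w u + θ) = 1) (a b : v.adicCompletion F)
    (h : Valued.v (completionMap v w a + completionMap v w b * θ) ≤ 1) :
    Valued.v a ≤ 1 ∧ Valued.v b ≤ 1 := by
  have hθ1 : Valued.v θ = 1 := by simpa using hθ 0 (by simp)
  rcases le_or_gt (Valued.v a) (Valued.v b) with hab | hab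
  · rcases eq_or_ne b 0 with rfl | hb
    · simp_all
    have h1 := hθ (a / b) (by rw [map_div₀]; exact div_le_one_of_le₀ hab zero_le)
    have hb' : completionMap v w b ≠ 0 := by simpa using hb
    rw [show completionMap v w a + completionMap v w b * θ =
      completionMap v w b * (completionMap v w (a / b) + θ) by rw [map_div₀]; field_simp,
      map_mul, h1, mul_one, he] at h
    exact ⟨hab.trans h, h⟩
  · rw [Valuation.map_add_eq_of_lt_left, he] at h
    · exact ⟨h, hab.le.trans h⟩
    · rwa [map_mul, he, he, hθ1, mul_one]

end LocalDiscriminant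

end MKT

namespace MKT

open HeightOneSpectrum WithZero Rat.HeightOneSpectrum

/-! ### The finite places of ℚ. -/

section RationalPlaces

variable (v : HeightOneSpectrum (𝓞 ℚ))

lemma intCast_mem_asIdeal_iff (j : ℤ) : (j : 𝓞 ℚ) ∈ v.asIdeal ↔ (natGenerator v : ℤ) ∣ j := by
  rw [← Ideal.mem_span_singleton, span_natGenerator,
    ← Ideal.apply_mem_of_equiv_iff (f := Rat.IsIntegralClosure.intEquiv (𝓞 ℚ)), map_intCast]
  rfl

lemma exists_intCast_eq (x : 𝓞 ℚ) : ∃ j : ℤ, x = j := by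
  obtain ⟨j, hj⟩ := Rat.int_algebraMap_surjective (𝓞 ℚ) x
  exact ⟨j, by rw [← hj]; simp⟩

lemma asIdeal_eq_span : v.asIdeal = Ideal.span {(natGenerator v : 𝓞 ℚ)} := by
  ext x
  obtain ⟨j, rfl⟩ := exists_intCast_eq x
  rw [intCast_mem_asIdeal_iff, Ideal.mem_span_singleton]
  constructor
  · rintro ⟨k, rfl⟩
    exact ⟨k, by push_cast; rfl⟩
  · rintro ⟨x, hx⟩
    obtain ⟨k, rfl⟩ := exists_intCast_eq x
    exact ⟨k, by exact_mod_cast hx⟩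

lemma valuation_intCast_le_one (j : ℤ) : v.valuation ℚ (j : ℚ) ≤ 1 := by
  have := v.valuation_le_one (K := ℚ) (j : 𝓞 ℚ)
  simpa using this

lemma valuation_intCast_lt_one_iff (j : ℤ) :
    v.valuation ℚ (j : ℚ) < 1 ↔ (natGenerator v : ℤ) ∣ j := by
  rw [← intCast_mem_asIdeal_iff, ← v.valuation_lt_one_iff_mem (K := ℚ)]
  simp

lemma valuation_intCast_eq_one {j : ℤ} (h : ¬ (natGenerator v : ℤ) ∣ j) :
    v.valuation ℚ (j : ℚ) = 1 :=
  le_antisymm (valuation_intCast_le_one v j)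
    (not_lt.mp fun h' => h ((valuation_intCast_lt_one_iff v j).mp h'))

lemma valuation_natGenerator : v.valuation ℚ (natGenerator v : ℚ) = exp (-1) := by
  have h : (natGenerator v : 𝓞 ℚ) ≠ 0 := by exact_mod_cast (prime_natGenerator v).ne_zero
  have := v.valuation_of_algebraMap (K := ℚ) (natGenerator v : 𝓞 ℚ)
  rw [v.intValuation_singleton h (asIdeal_eq_span v)] at this
  simpa using this

lemma absNorm_asIdeal : Ideal.absNorm v.asIdeal = natGenerator v := by
  rw [asIdeal_eq_span, Ideal.absNorm_span_natCast, RingOfIntegers.rank, Module.finrank_self, pow_one]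

lemma natGenerator_injective :
    Function.Injective (natGenerator : HeightOneSpectrum (𝓞 ℚ) → ℕ) := fun v v' h =>
  HeightOneSpectrum.ext (by rw [asIdeal_eq_span, asIdeal_eq_span, h])

lemma exists_natGenerator_eq {p : ℕ} (hp : p.Prime) :
    ∃ v : HeightOneSpectrum (𝓞 ℚ), natGenerator v = p :=
  ⟨primesEquiv.symm ⟨p, hp⟩, congrArg Subtype.val (primesEquiv.apply_symm_apply ⟨p, hp⟩)⟩

lemma valued_lt_one_or_of_dyadic (h2 : natGenerator v = 2) {z : v.adicCompletion ℚ}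
    (hz : Valued.v z ≤ 1) : Valued.v z < 1 ∨ Valued.v (z - 1) < 1 := by
  obtain ⟨r, hr⟩ := exists_valued_sub_lt_one v hz
  obtain ⟨j, rfl⟩ := exists_intCast_eq r
  rw [map_intCast, map_intCast] at hr
  have key : ∀ i : ℤ, (2 : ℤ) ∣ j - i → Valued.v (z - i) < 1 := fun i hi => by
    have h1 : Valued.v (((j - i : ℤ) : v.adicCompletion ℚ)) < 1 := by
      rw [valued_intCast, valuation_intCast_lt_one_iff, h2]
      exact_mod_cast hi
    rw [show z - i = (z - j) + ((j - i : ℤ) : v.adicCompletion ℚ) by push_cast; ring]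
    exact Valuation.map_add_lt _ hr h1
  rcases Int.even_or_odd j with hj | hj
  · exact .inl (by simpa using key 0 (by simpa using hj.two_dvd))
  · exact .inr (by simpa using key 1 (hj.sub_odd odd_one).two_dvd)

end RationalPlaces

/-! ### Norms and valuations at the places of a quadratic field. -/

section PlacesAbove

variable {K : Type*} [Field K] [NumberField K] (v : HeightOneSpectrum (𝓞 ℚ))
  (w : HeightOneSpectrum (𝓞 K))

lemma map_asIdeal_eq_span : v.asIdeal.map (algebraMap (𝓞 ℚ) (𝓞 K)) =
    Ideal.span {(natGenerator v : 𝓞 K)} := by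
  rw [asIdeal_eq_span, Ideal.map_span, Set.image_singleton, map_natCast]

lemma natGenerator_mem [w.asIdeal.LiesOver v.asIdeal] : (natGenerator v : 𝓞 K) ∈ w.asIdeal := by
  have : (natGenerator v : 𝓞 ℚ) ∈ v.asIdeal := by
    rw [asIdeal_eq_span]; exact Ideal.mem_span_singleton_self _
  rw [Ideal.mem_of_liesOver w.asIdeal v.asIdeal, map_natCast] at this
  exact this

lemma intCast_mem_iff [w.asIdeal.LiesOver v.asIdeal] (j : ℤ) :
    (j : 𝓞 K) ∈ w.asIdeal ↔ (natGenerator v : ℤ) ∣ j := by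
  rw [← intCast_mem_asIdeal_iff, Ideal.mem_of_liesOver w.asIdeal v.asIdeal, map_intCast]

variable (hK : Module.finrank ℚ K = 2)

include hK in
-- The square of w divides (p), whose norm is p², so the norm of w divides p.
lemma absNorm_of_sq_mem (h : (natGenerator v : 𝓞 K) ∈ w.asIdeal ^ 2) :
    Ideal.absNorm w.asIdeal = natGenerator v := by
  rw [← Ideal.dvd_span_singleton] at h
  have h1 := map_dvd Ideal.absNorm h
  rw [map_pow, Ideal.absNorm_span_natCast, RingOfIntegers.rank, hK,
    Nat.pow_dvd_pow_iff two_ne_zero] at h1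
  exact ((Nat.dvd_prime (prime_natGenerator v)).mp h1).resolve_left
    (HeightOneSpectrum.one_lt_absNorm w).ne'

include hK in
-- A higher exponent would make p³ divide p² after taking norms.
lemma valuation_natGenerator_of_sq_mem (h : (natGenerator v : 𝓞 K) ∈ w.asIdeal ^ 2) :
    w.valuation K (algebraMap ℚ K (natGenerator v)) = exp (-(2 : ℕ) : ℤ) := by
  have h0 : w.valuation K (natGenerator v : K) = w.intValuation (natGenerator v : 𝓞 K) := by
    simpa using w.valuation_of_algebraMap (K := K) (natGenerator v : 𝓞 K)
  rw [map_natCast (algebraMap ℚ K)]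
  refine h0.trans (le_antisymm ((w.intValuation_le_pow_iff_mem _ 2).mpr h) (not_lt.mp fun hlt => ?_))
  have h3 : w.intValuation (natGenerator v : 𝓞 K) ≤ exp (-(3 : ℕ) : ℤ) := by
    have hne : w.intValuation (natGenerator v : 𝓞 K) ≠ 0 := by
      refine w.intValuation_ne_zero _ ?_
      exact_mod_cast (prime_natGenerator v).ne_zero
    rw [← exp_log hne, exp_lt_exp] at hlt
    rw [← exp_log hne, exp_le_exp]
    push_cast at hlt ⊢
    omega
  rw [w.intValuation_le_pow_iff_dvd] at h3
  have h1 := map_dvd Ideal.absNorm h3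
  rw [map_pow, Ideal.absNorm_span_natCast, RingOfIntegers.rank, hK, absNorm_of_sq_mem v w hK h,
    Nat.pow_dvd_pow_iff_le_right (prime_natGenerator v).one_lt] at h1
  omega

lemma asIdeal_eq_span_of_isInertIn [w.asIdeal.LiesOver v.asIdeal] (h : IsInertIn K v) :
    w.asIdeal = Ideal.span {(natGenerator v : 𝓞 K)} := by
  rw [IsInertIn, map_asIdeal_eq_span] at h
  have h0 : Ideal.span {(natGenerator v : 𝓞 K)} ≠ ⊥ := by
    rw [Ne, Ideal.span_singleton_eq_bot]
    exact_mod_cast (prime_natGenerator v).ne_zero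
  refine ((h.isMaximal h0).eq_of_le w.isPrime.ne_top ?_).symm
  rw [Ideal.span_singleton_le_iff_mem]
  exact natGenerator_mem v w

include hK in
lemma absNorm_of_isInertIn [w.asIdeal.LiesOver v.asIdeal] (h : IsInertIn K v) :
    Ideal.absNorm w.asIdeal = natGenerator v ^ 2 := by
  rw [asIdeal_eq_span_of_isInertIn v w h, Ideal.absNorm_span_natCast, RingOfIntegers.rank, hK]

lemma valuation_natGenerator_of_isInertIn [w.asIdeal.LiesOver v.asIdeal] (h : IsInertIn K v) :
    w.valuation K (algebraMap ℚ K (natGenerator v)) = exp (-(1 : ℕ) : ℤ) := by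
  have h0 : (natGenerator v : 𝓞 K) ≠ 0 := by exact_mod_cast (prime_natGenerator v).ne_zero
  have := w.valuation_of_algebraMap (K := K) (natGenerator v : 𝓞 K)
  rw [w.intValuation_singleton h0 (asIdeal_eq_span_of_isInertIn v w h)] at this
  simpa using this

end PlacesAbove

end MKT

namespace MKT

open HeightOneSpectrum WithZero Rat.HeightOneSpectrum

/-! ### Decomposition of rational primes in ℚ(√n). -/

section QuadraticField

variable {K : Type*} [Field K] [NumberField K]

lemma sqrt_notMem_range {n : ℤ} (hn : Squarefree n) (hn1 : n ≠ 1) {s : K} (hs : s ^ 2 = n) :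
    s ∉ (algebraMap ℚ K).range := by
  rintro ⟨q, rfl⟩
  have hq : q ^ 2 = n := (algebraMap ℚ K).injective (by rw [map_pow, hs, map_intCast])
  obtain ⟨z, rfl⟩ : ∃ z : ℤ, (z : ℚ) = q := by
    have : IsIntegral ℤ q := by
      refine ⟨.X ^ 2 - .C n, by monicity!, ?_⟩
      rw [Polynomial.eval₂_sub, Polynomial.eval₂_pow, Polynomial.eval₂_X, Polynomial.eval₂_C, hq]
      simp
    exact IsIntegrallyClosed.isIntegral_iff.mp this
  have hz : z * z = n := by rw [← sq]; exact_mod_cast hq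
  rcases Int.isUnit_iff.mp (hn z (hz ▸ dvd_rfl)) with rfl | rfl <;> omega

lemma exists_eq_add_mul (hK : Module.finrank ℚ K = 2) {s : K} (hs : s ∉ (algebraMap ℚ K).range)
    (x : K) : ∃ a b : ℚ, x = algebraMap ℚ K a + algebraMap ℚ K b * s := by
  have hli : LinearIndependent ℚ ![1, s] := by
    rw [LinearIndependent.pair_iff' one_ne_zero]
    intro a ha
    exact hs ⟨a, by rw [← ha, Algebra.smul_def, mul_one]⟩
  have hsp := hli.span_eq_top_of_card_eq_finrank (by simp [hK])
  have hx : x ∈ Submodule.span ℚ (Set.range ![1, s]) := hsp ▸ Submodule.mem_top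
  rw [Matrix.range_cons_cons_empty, Submodule.mem_span_pair] at hx
  obtain ⟨a, b, h⟩ := hx
  exact ⟨a, b, by rw [← h, Algebra.smul_def, Algebra.smul_def, mul_one]⟩

/-- If the square of a prime `w` divides the rational prime `p`, then `w` contains the derivative
of the minimal polynomial at an integral generator. -/
lemma two_mul_sub_mem_of_sq_mem (hK : Module.finrank ℚ K = 2) (w : HeightOneSpectrum (𝓞 K)) {p : ℕ}
    (hp : p.Prime) (h : (p : 𝓞 K) ∈ w.asIdeal ^ 2) {x : 𝓞 K} {t N : ℤ}
    (hx : x ^ 2 = t * x - N) (hxQ : (x : K) ∉ (algebraMap ℚ K).range) : 2 * x - t ∈ w.asIdeal := by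
  have hadj : Algebra.adjoin ℚ {algebraMap (𝓞 K) K x} = ⊤ := by
    refine eq_top_iff.mpr fun y _ => ?_
    obtain ⟨a, b, rfl⟩ := exists_eq_add_mul hK hxQ y
    exact add_mem (Subalgebra.algebraMap_mem _ _)
      (mul_mem (Subalgebra.algebraMap_mem _ _) (Algebra.self_mem_adjoin_singleton ℚ _))
  have hint : IsIntegral ℤ x := RingOfIntegers.isIntegral x
  have hmin : minpoly ℤ x = .X ^ 2 - .C t * .X + .C N := by
    have hmon : (.X ^ 2 - .C t * .X + .C N : Polynomial ℤ).Monic := by monicity!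
    refine (Polynomial.eq_of_monic_of_dvd_of_natDegree_le (minpoly.monic hint) hmon
      (minpoly.isIntegrallyClosed_dvd hint ?_) ?_).symm
    · simp only [map_add, map_sub, map_mul, map_pow, Polynomial.aeval_X, Polynomial.aeval_C, hx]
      simp
    · have h1 : (.X ^ 2 - .C t * .X + .C N : Polynomial ℤ).natDegree = 2 := by compute_degree!
      rw [h1]
      refine (minpoly.two_le_natDegree_iff hint).mpr ?_
      rintro ⟨y, rfl⟩
      exact hxQ ⟨y, by simp⟩
  -- The different contains the derivative of the minimal polynomial at the generator, and
  -- ramification makes w divide the different.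
  have hd := aeval_derivative_mem_differentIdeal ℤ ℚ K x hadj
  have : (Ideal.span {(p : ℤ)}).IsMaximal :=
    PrincipalIdealRing.isMaximal_of_irreducible (Nat.prime_iff_prime_int.mp hp).irreducible
  have hdvd := pow_sub_one_dvd_differentIdeal ℤ (p := Ideal.span {(p : ℤ)}) w.asIdeal 2
    (by simp [hp.ne_zero]) (by
      rw [Ideal.map_span, Set.image_singleton, map_natCast, Ideal.dvd_span_singleton]
      exact h)
  have := Ideal.le_of_dvd hdvd hd
  rw [hmin] at this
  simpa [map_ofNat] using this

variable (v : HeightOneSpectrum (𝓞 ℚ)) (w : HeightOneSpectrum (𝓞 K))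

/-- Write n = pm with p and m coprime. A Bézout relation times p expresses p by p² and n = S², both
in the square of w. -/
lemma natGenerator_mem_sq_of_dvd [w.asIdeal.LiesOver v.asIdeal] {n : ℤ} (hn : Squarefree n)
    {S : 𝓞 K} (hS : S ^ 2 = n) (h : (natGenerator v : ℤ) ∣ n) :
    (natGenerator v : 𝓞 K) ∈ w.asIdeal ^ 2 := by
  have hSw : S ∈ w.asIdeal := by
    refine w.isPrime.mem_of_pow_mem 2 ?_
    rw [hS, intCast_mem_iff v w]
    exact h
  obtain ⟨m, hm⟩ := h
  have hp := Nat.prime_iff_prime_int.mp (prime_natGenerator v)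
  have hcop : IsCoprime (natGenerator v : ℤ) m := by
    refine hp.irreducible.coprime_iff_not_dvd.mpr fun ⟨k, hk⟩ => hp.not_isUnit (hn _ ⟨k, ?_⟩)
    rw [hm, hk, mul_assoc]
  obtain ⟨x, y, hxy⟩ := hcop
  have : (natGenerator v : 𝓞 K) = x * (natGenerator v : 𝓞 K) ^ 2 + y * S ^ 2 := by
    rw [hS, hm]
    have := congrArg (Int.cast : ℤ → 𝓞 K) hxy
    push_cast at this ⊢
    linear_combination -(natGenerator v : 𝓞 K) * this
  rw [this]
  exact add_mem (Ideal.mul_mem_left _ _ (Ideal.pow_mem_pow (natGenerator_mem v w) 2))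
    (Ideal.mul_mem_left _ _ (Ideal.pow_mem_pow hSw 2))

/-- Here 1 + S lies in w because (1 + S)² = 2(S + 2 + 2j), and 2 is a combination of 2² and (1 +
S)². -/
lemma natGenerator_mem_sq_of_three [w.asIdeal.LiesOver v.asIdeal] (h2 : natGenerator v = 2)
    {j : ℤ} {S : 𝓞 K} (hS : S ^ 2 = (3 + 4 * j : ℤ)) :
    (natGenerator v : 𝓞 K) ∈ w.asIdeal ^ 2 := by
  have h2w := natGenerator_mem v w
  rw [h2] at h2w ⊢
  push_cast at h2w hS ⊢
  have h1 : 1 + S ∈ w.asIdeal := by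
    refine w.isPrime.mem_of_pow_mem 2 ?_
    rw [show (1 + S) ^ 2 = 2 * (S + 2 + 2 * j) by linear_combination hS]
    exact Ideal.mul_mem_right _ _ h2w
  have : (2 : 𝓞 K) = 2 ^ 2 * (2 + 2 * j + (1 + j) * S) - (1 + S) ^ 2 * S := by
    linear_combination (2 + S) * hS
  rw [this]
  exact sub_mem (Ideal.mul_mem_right _ _ (Ideal.pow_mem_pow h2w 2))
    (Ideal.mul_mem_right _ _ (Ideal.pow_mem_pow h1 2))

lemma isRamifiedIn_of_mem_sq (h : (natGenerator v : 𝓞 K) ∈ w.asIdeal ^ 2) : IsRamifiedIn K v :=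
  ⟨w, by rwa [map_asIdeal_eq_span, Ideal.span_singleton_le_iff_mem]⟩

/-- If the residue field of w had two elements, Θ² - Θ = N would lie in w, but N is odd. So w has
norm 4, the norm of (2). -/
lemma isInertIn_of_five (hK : Module.finrank ℚ K = 2) (h2 : natGenerator v = 2) {N : ℤ}
    (hN : Odd N) {Θ : 𝓞 K} (hΘ : Θ ^ 2 = Θ + N) : IsInertIn K v := by
  let w := placeAbove K v
  have hw : (natGenerator v : 𝓞 K) ∈ w.asIdeal := natGenerator_mem v w
  rw [IsInertIn, map_asIdeal_eq_span]
  have habs : Ideal.absNorm (Ideal.span {(natGenerator v : 𝓞 K)}) = 2 ^ 2 := by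
    rw [Ideal.absNorm_span_natCast, RingOfIntegers.rank, hK, h2]
  obtain ⟨J, hJ⟩ := Ideal.dvd_span_singleton.mpr hw
  have hmul := congrArg Ideal.absNorm hJ
  rw [habs, map_mul] at hmul
  obtain ⟨k, hk, hk'⟩ := (Nat.dvd_prime_pow Nat.prime_two).mp ⟨_, hmul⟩
  have hk0 : k ≠ 0 := by
    rintro rfl
    exact (HeightOneSpectrum.one_lt_absNorm w).ne' hk'
  have hk1 : k ≠ 1 := by
    rintro rfl
    have : Θ ^ 2 - Θ ∈ w.asIdeal := by
      have := w.isPrime.isMaximal w.ne_bot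
      let : Field (𝓞 K ⧸ w.asIdeal) := Ideal.Quotient.field _
      have : Finite (𝓞 K ⧸ w.asIdeal) := w.asIdeal.finiteQuotientOfFreeOfNeBot w.ne_bot
      let : Fintype (𝓞 K ⧸ w.asIdeal) := Fintype.ofFinite _
      have hc : Fintype.card (𝓞 K ⧸ w.asIdeal) = 2 := by
        rw [← Nat.card_eq_fintype_card, ← Submodule.cardQuot_apply, ← Ideal.absNorm_apply, hk',
          pow_one]
      have := FiniteField.pow_card (Ideal.Quotient.mk w.asIdeal Θ)
      rw [hc, ← map_pow] at this
      exact Ideal.Quotient.eq.mp this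
    rw [hΘ, add_sub_cancel_left, intCast_mem_iff v w, h2] at this
    exact (Int.not_even_iff_odd.mpr hN) (even_iff_two_dvd.mpr this)
  obtain rfl : k = 2 := by omega
  rw [hk'] at hmul
  have : J = ⊤ := Ideal.absNorm_eq_one_iff.mp (by omega)
  rw [hJ, this, Ideal.mul_top]
  exact w.isPrime

/-- A rational prime not dividing the discriminant is unramified. -/
lemma not_isRamifiedIn (hK : Module.finrank ℚ K = 2) {x : 𝓞 K} {t N : ℤ}
    (hx : x ^ 2 = t * x - N) (hxQ : (x : K) ∉ (algebraMap ℚ K).range)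
    (h : ¬ (natGenerator v : ℤ) ∣ t ^ 2 - 4 * N) : ¬ IsRamifiedIn K v := by
  rintro ⟨w, hw⟩
  rw [map_asIdeal_eq_span, Ideal.span_singleton_le_iff_mem] at hw
  have h1 := two_mul_sub_mem_of_sq_mem hK w (prime_natGenerator v) hw hx hxQ
  have h2 : ((t ^ 2 - 4 * N : ℤ) : 𝓞 K) ∈ w.asIdeal := by
    have : ((t ^ 2 - 4 * N : ℤ) : 𝓞 K) = (2 * x - t) * (2 * x - t) := by
      push_cast; linear_combination -4 * hx
    rw [this]
    exact Ideal.mul_mem_right _ _ h1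
  have hp : (natGenerator v : 𝓞 K) ∈ w.asIdeal := Ideal.pow_le_self two_ne_zero hw
  have hp' := Nat.prime_iff_prime_int.mp (prime_natGenerator v)
  obtain ⟨a, b, hab⟩ := (hp'.irreducible.coprime_iff_not_dvd.mpr h)
  refine w.isPrime.ne_top ((Ideal.eq_top_iff_one _).mpr ?_)
  have := congrArg (Int.cast : ℤ → 𝓞 K) hab
  rw [Int.cast_add, Int.cast_mul, Int.cast_mul, Int.cast_one, Int.cast_natCast] at this
  rw [← this]
  exact add_mem (Ideal.mul_mem_left _ _ hp) (Ideal.mul_mem_left _ _ h2)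

lemma exists_quadratic_relation (hK : Module.finrank ℚ K = 2) {y : 𝓞 K}
    (hy : (y : K) ∉ (algebraMap ℚ K).range) : ∃ t N : ℤ, y ^ 2 = t * y - N := by
  have hint : IsIntegral ℤ y := RingOfIntegers.isIntegral y
  have hdeg : (minpoly ℤ y).natDegree = 2 := by
    refine le_antisymm ?_ ((minpoly.two_le_natDegree_iff hint).mpr ?_)
    · have h1 : minpoly ℚ (y : K) = (minpoly ℤ (y : K)).map (algebraMap ℤ ℚ) :=
        minpoly.isIntegrallyClosed_eq_field_fractions' ℚ (RingOfIntegers.isIntegral_coe y)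
      have h2 := minpoly.natDegree_le (A := ℚ) (y : K)
      rw [h1, (minpoly.monic (RingOfIntegers.isIntegral_coe y)).natDegree_map, hK] at h2
      rwa [← minpoly.algebraMap_eq (RingOfIntegers.coe_injective (K := K)) y]
    · rintro ⟨a, rfl⟩
      exact hy ⟨a, by simp⟩
  have h := minpoly.aeval ℤ y
  have hlead : (minpoly ℤ y).coeff 2 = 1 := hdeg ▸ (minpoly.monic hint).coeff_natDegree
  rw [Polynomial.aeval_eq_sum_range, hdeg, Finset.sum_range_succ, Finset.sum_range_succ,
    Finset.sum_range_one, hlead, zsmul_eq_mul, zsmul_eq_mul, zsmul_eq_mul] at h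
  refine ⟨-(minpoly ℤ y).coeff 1, (minpoly ℤ y).coeff 0, ?_⟩
  push_cast at h ⊢
  linear_combination h

/-- If Θ = 2y with y² = ay - b and N = 2M, comparison of the two quadratic relations gives (2a - t)y
= M + 2b. As 2a - t is odd, it is nonzero, and y would be rational. -/
lemma not_two_dvd_of_sq_eq (hK : Module.finrank ℚ K = 2) {Θ : 𝓞 K} {N t : ℤ} (ht : Odd t)
    (hN : Even N) (hΘ : Θ ^ 2 = t * Θ + N) (hΘQ : (Θ : K) ∉ (algebraMap ℚ K).range) : ¬ 2 ∣ Θ := by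
  rintro ⟨y, rfl⟩
  obtain ⟨M, rfl⟩ := hN.two_dvd
  have hy : (y : K) ∉ (algebraMap ℚ K).range := fun ⟨q, hq⟩ => hΘQ ⟨2 * q, by simp only [map_mul, hq, map_ofNat]⟩
  obtain ⟨a, b, hab⟩ := exists_quadratic_relation hK hy
  refine hy ⟨(M + 2 * b) / (2 * a - t), ?_⟩
  have h0 : (2 * a - t : ℤ) ≠ 0 := by
    obtain ⟨k, rfl⟩ := ht
    omega
  have h0' : (2 * a - t : K) ≠ 0 := by exact_mod_cast h0
  have h1 : (2 * a - t) * y = M + 2 * b := by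
    refine mul_left_cancel₀ (two_ne_zero (α := 𝓞 K)) ?_
    push_cast at hΘ
    linear_combination hΘ - 4 * hab
  have h2 := congrArg (algebraMap (𝓞 K) K) h1
  simp only [map_mul, map_sub, map_add, map_intCast, map_ofNat] at h2
  simp only [map_div₀, map_mul, map_sub, map_add, map_intCast, map_ofNat]
  rw [div_eq_iff h0']
  linear_combination -h2

/-- The prime `2` is not inert if `n ≡ 1 mod 8`. -/
lemma not_isInertIn_of_one (hK : Module.finrank ℚ K = 2) (h2 : natGenerator v = 2) {N : ℤ}
    (hN : Even N) {Θ : 𝓞 K} (hΘ : Θ ^ 2 = Θ + N) (hΘQ : (Θ : K) ∉ (algebraMap ℚ K).range) :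
    ¬ IsInertIn K v := by
  intro h
  rw [IsInertIn, map_asIdeal_eq_span, h2] at h
  have hmem : Θ * (Θ - 1) ∈ Ideal.span {((2 : ℕ) : 𝓞 K)} := by
    rw [show Θ * (Θ - 1) = N by linear_combination hΘ, Ideal.mem_span_singleton]
    obtain ⟨M, rfl⟩ := hN.two_dvd
    exact ⟨M, by push_cast; rfl⟩
  rcases h.mem_or_mem hmem with h | h
  · rw [Ideal.mem_span_singleton] at h
    exact not_two_dvd_of_sq_eq hK odd_one hN (by push_cast; rw [one_mul]; exact hΘ) hΘQ
      (by exact_mod_cast h)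
  · rw [Ideal.mem_span_singleton] at h
    refine not_two_dvd_of_sq_eq hK (Θ := Θ - 1) (t := -1) (by decide) hN
      (by push_cast; linear_combination hΘ) (fun ⟨q, hq⟩ => hΘQ ⟨q + 1, ?_⟩) (by exact_mod_cast h)
    rw [map_add, hq, map_one]
    simp

end QuadraticField

end MKT

namespace MKT

open HeightOneSpectrum WithZero Rat.HeightOneSpectrum WeierstrassCurve

/-! ### The local term in terms of exponents. -/

section LocalTerm

lemma baseChange_curveE₁ {L : Type*} [Field L] {_ : Algebra ℚ L} :
    curveE₁.baseChange L = congruentCurve 1 := by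
  ext <;> simp [curveE₁, congruentCurve, WeierstrassCurve.baseChange, WeierstrassCurve.map]

lemma baseChange_quadraticTwist_curveE₁ {L : Type*} [Field L] {_ : Algebra ℚ L} (n : ℤ) :
    (curveE₁.quadraticTwist n).baseChange L = congruentCurve (n : L) := by
  have h4 : (curveE₁.quadraticTwist n).a₄ = -(n : ℚ) ^ 2 := by
    simp only [curveE₁, quadraticTwist, WeierstrassCurve.b₄]
    ring
  have h2 : (curveE₁.quadraticTwist n).a₂ = 0 := by
    simp [curveE₁, quadraticTwist, WeierstrassCurve.b₂]
  have h6 : (curveE₁.quadraticTwist n).a₆ = 0 := by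
    simp [curveE₁, quadraticTwist, WeierstrassCurve.b₆]
  ext
  · simp [quadraticTwist, congruentCurve, WeierstrassCurve.baseChange, WeierstrassCurve.map]
  · change algebraMap ℚ L _ = 0
    rw [h2, map_zero]
  · simp [quadraticTwist, congruentCurve, WeierstrassCurve.baseChange, WeierstrassCurve.map]
  · change algebraMap ℚ L _ = -(n : L) ^ 2
    rw [h4]; simp
  · change algebraMap ℚ L _ = 0
    rw [h6, map_zero]

lemma valued_minimalDiscriminant_congruentCurve {K : Type*} [Field K] [NumberField K]
    (v : HeightOneSpectrum (𝓞 K)) {a : v.adicCompletion K} (ha : a ≠ 0)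
    [IsMinimal (v.adicCompletionIntegers K) (congruentCurve a)] :
    Valued.v ((congruentCurve a).minimalDiscriminant (v.adicCompletionIntegers K)) =
      (Valued.v (2 : v.adicCompletion K) * Valued.v a) ^ 6 := by
  obtain ⟨u, hu⟩ := valuation_minimalDiscriminant (v.adicCompletionIntegers K) (congruentCurve a)
    (congruentCurve_Δ_ne_zero two_ne_zero ha)
  have hu1 : Valued.v ((u : v.adicCompletionIntegers K) : v.adicCompletion K) = 1 :=
    adicCompletionIntegers.isUnit_iff_valued_eq_one.mp u.isUnit
  have h := valuation_congruentCurve_Δ (R := v.adicCompletionIntegers K) a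
  simp only [valuation_maximalIdeal_eq_valued] at h
  rw [hu, map_mul, h]
  exact (congrArg (· * _) hu1).trans (one_mul _)

variable {K : Type*} [Field K] [NumberField K] (v : HeightOneSpectrum (𝓞 ℚ))
  (w : HeightOneSpectrum (𝓞 K)) [w.asIdeal.LiesOver v.asIdeal]

/-- Minimal discriminants are 64 and 64n⁶ up to units, and a norm upstairs is a power of p^f. The
total exponent is 12a + 6b - 6d - 6fc = 12m, and the twelfth root leaves m. -/
theorem localTerm_curveE₁_eq {n : ℤ} {c₁ c₂ c₃ f : ℕ} {a b c d m : ℤ}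
    (min₁ : IsMinimal (v.adicCompletionIntegers ℚ) (congruentCurve (1 : v.adicCompletion ℚ)))
    (min₂ : IsMinimal (v.adicCompletionIntegers ℚ) (congruentCurve (n : v.adicCompletion ℚ)))
    (min₃ : IsMinimal (w.adicCompletionIntegers K) (congruentCurve (1 : w.adicCompletion K)))
    (h₁ : (congruentCurve (1 : v.adicCompletion ℚ)).tamagawaFactor (v.adicCompletionIntegers ℚ) = c₁)
    (h₂ : (congruentCurve (n : v.adicCompletion ℚ)).tamagawaFactor (v.adicCompletionIntegers ℚ) = c₂)
    (h₃ : (congruentCurve (1 : w.adicCompletion K)).tamagawaFactor (w.adicCompletionIntegers K) = c₃)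
    (ha : Valued.v (2 : v.adicCompletion ℚ) = exp a) (hb : Valued.v (n : v.adicCompletion ℚ) = exp b)
    (hc : Valued.v (2 : w.adicCompletion K) = exp c) (hd : Valued.v (localDiscriminant v w) = exp d)
    (hf : Ideal.absNorm w.asIdeal = natGenerator v ^ f) (hm : 2 * a + b - d - f * c = 2 * m) :
    localTerm v w curveE₁ (n : ℚ) =
      Real.logb 2 ((c₁ : ℝ) * c₂ / c₃ * (natGenerator v : ℝ) ^ m) := by
  have hn0 : (n : v.adicCompletion ℚ) ≠ 0 := fun h => by
    simp [h] at hb; exact exp_ne_zero hb.symm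
  have hp : (0 : ℝ) < natGenerator v := by exact_mod_cast (prime_natGenerator v).pos
  rw [localTerm, baseChange_curveE₁, baseChange_curveE₁, baseChange_quadraticTwist_curveE₁, h₁, h₂,
    h₃]
  congr 2
  have e1 : Valued.v ((congruentCurve (1 : v.adicCompletion ℚ)).minimalDiscriminant
      (v.adicCompletionIntegers ℚ) * (congruentCurve (n : v.adicCompletion ℚ)).minimalDiscriminant
      (v.adicCompletionIntegers ℚ) * localDiscriminant v w ^ (-6 : ℤ)) =
      exp (12 * a + 6 * b - 6 * d) := by
    rw [map_mul, map_mul, map_zpow₀, valued_minimalDiscriminant_congruentCurve v one_ne_zero,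
      valued_minimalDiscriminant_congruentCurve v hn0, ha, hb, hd, map_one, mul_one, ← exp_add,
      ← exp_nsmul, ← exp_nsmul, ← exp_zsmul, ← exp_add, ← exp_add]
    congr 1
    simp only [nsmul_eq_mul, smul_eq_mul]
    push_cast
    ring
  have e2 : Valued.v ((congruentCurve (1 : w.adicCompletion K)).minimalDiscriminant
      (w.adicCompletionIntegers K)) = exp (6 * c) := by
    rw [valued_minimalDiscriminant_congruentCurve w one_ne_zero, hc, map_one, mul_one, ← exp_nsmul]
    congr 1
  rw [norm_eq_of_valued_eq v e1, norm_eq_of_valued_eq w e2, absNorm_asIdeal, hf, Nat.cast_pow,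
    ← zpow_natCast, ← zpow_mul, ← zpow_sub₀ hp.ne',
    show 12 * a + 6 * b - 6 * d - f * (6 * c) = m * (12 : ℕ) by push_cast; linarith, zpow_mul,
    zpow_natCast, one_div]
  exact_mod_cast Real.pow_rpow_inv_natCast (zpow_nonneg hp.le m) (by norm_num : (12 : ℕ) ≠ 0)

end LocalTerm

end MKT

namespace MKT

open HeightOneSpectrum WithZero Rat.HeightOneSpectrum WeierstrassCurve

/-! ### Values at 2 and n, and local discriminants. -/

section GoodReduction

variable {K : Type*} [Field K] [NumberField K] (v : HeightOneSpectrum (𝓞 K))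

lemma isMinimal_congruentCurve_one_of_valued_two (h2 : Valued.v (2 : v.adicCompletion K) = 1) :
    IsMinimal (v.adicCompletionIntegers K) (congruentCurve (1 : v.adicCompletion K)) := by
  rw [← valuation_maximalIdeal_eq_valued] at h2
  have := isIntegral_congruentCurve (R := v.adicCompletionIntegers K)
    (a := (1 : v.adicCompletion K)) (by simp)
  refine isMinimal_of_exp_lt_valuation_Δ _ ?_
  rw [valuation_congruentCurve_Δ, h2, map_one, mul_one, one_pow, ← exp_zero, exp_lt_exp]
  norm_num

lemma tamagawaFactor_congruentCurve_one_of_valued_two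
    (h2 : Valued.v (2 : v.adicCompletion K) = 1) :
    (congruentCurve (1 : v.adicCompletion K)).tamagawaFactor (v.adicCompletionIntegers K) = 1 := by
  have := isMinimal_congruentCurve_one_of_valued_two v h2
  rw [← valuation_maximalIdeal_eq_valued] at h2
  refine tamagawaFactor_of_valuation_Δ_eq_one _ ?_
  rw [valuation_congruentCurve_Δ, h2, map_one, mul_one, one_pow]

end GoodReduction

section RationalValues

variable (v : HeightOneSpectrum (𝓞 ℚ))

lemma valued_two_of_odd (h2 : natGenerator v ≠ 2) : Valued.v (2 : v.adicCompletion ℚ) = 1 := by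
  rw [show (2 : v.adicCompletion ℚ) = ((2 : ℤ) : v.adicCompletion ℚ) by norm_num, valued_intCast]
  refine valuation_intCast_eq_one v fun h => h2 ?_
  exact (Nat.prime_dvd_prime_iff_eq (prime_natGenerator v) Nat.prime_two).mp (by exact_mod_cast h)

lemma valued_two_of_dyadic (h2 : natGenerator v = 2) :
    Valued.v (2 : v.adicCompletion ℚ) = exp (-1) := by
  rw [show (2 : v.adicCompletion ℚ) = ((2 : ℤ) : v.adicCompletion ℚ) by norm_num, valued_intCast,
    ← valuation_natGenerator v, h2]
  norm_num

lemma valued_intCast_of_dvd {n : ℤ} (hn : Squarefree n) (h : (natGenerator v : ℤ) ∣ n) :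
    Valued.v (n : v.adicCompletion ℚ) = exp (-1) := by
  obtain ⟨m, rfl⟩ := h
  have hp := Nat.prime_iff_prime_int.mp (prime_natGenerator v)
  have hm : ¬ (natGenerator v : ℤ) ∣ m := fun ⟨k, hk⟩ =>
    hp.not_isUnit (hn _ ⟨k, by rw [hk, mul_assoc]⟩)
  rw [valued_intCast, Int.cast_mul, map_mul, valuation_intCast_eq_one v hm, mul_one,
    Int.cast_natCast, valuation_natGenerator]

lemma valued_intCast_of_odd (h2 : natGenerator v = 2) {n : ℤ} (hn : Odd n) :
    Valued.v (n : v.adicCompletion ℚ) = 1 := by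
  rw [valued_intCast]
  refine valuation_intCast_eq_one v fun h => ?_
  rw [h2] at h
  exact (Int.not_even_iff_odd.mpr hn) (even_iff_two_dvd.mpr (by exact_mod_cast h))

end RationalValues

section Ramified

variable {K : Type*} [Field K] [NumberField K] (v : HeightOneSpectrum (𝓞 ℚ))
  (w : HeightOneSpectrum (𝓞 K)) [w.asIdeal.LiesOver v.asIdeal]

lemma valued_intCast_le_one (j : ℤ) : Valued.v (j : v.adicCompletion ℚ) ≤ 1 := by
  rw [valued_intCast]; exact valuation_intCast_le_one v j

variable {v w}

lemma valued_localDiscriminant_of_sqrt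
    (he : ∀ x, Valued.v (completionMap v w x) = Valued.v x ^ 2) {n : ℤ} {s : w.adicCompletion K}
    (hs : s ^ 2 = n) (hs1 : Valued.v s = exp (-1))
    (hspan : ∀ z, ∃ a b, z = completionMap v w a + completionMap v w b * s) :
    Valued.v (localDiscriminant v w) = Valued.v (4 * n : v.adicCompletion ℚ) := by
  rw [valued_localDiscriminant v w (t := 0) (N := ((-n : ℤ) : v.adicCompletion ℚ)) (θ := s)
    (by simp) (valued_intCast_le_one v _) (by rw [hs]; simp) hspan
    (valued_le_one_of_ramified v w he hs1)]
  congr 1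
  push_cast
  ring

/-- The uniformizer 1 + s is a root of X² - 2X + (1 - n), of discriminant 4n. -/
lemma valued_localDiscriminant_of_one_add_sqrt
    (he : ∀ x, Valued.v (completionMap v w x) = Valued.v x ^ 2) {n : ℤ} {s : w.adicCompletion K}
    (hs : s ^ 2 = n) (hs1 : Valued.v (1 + s) = exp (-1))
    (hspan : ∀ z, ∃ a b, z = completionMap v w a + completionMap v w b * s) :
    Valued.v (localDiscriminant v w) = Valued.v (4 * n : v.adicCompletion ℚ) := by
  rw [valued_localDiscriminant v w (t := ((2 : ℤ) : v.adicCompletion ℚ))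
    (N := ((1 - n : ℤ) : v.adicCompletion ℚ)) (θ := 1 + s) (valued_intCast_le_one v _)
    (valued_intCast_le_one v _) ?_ (fun z => ?_) (valued_le_one_of_ramified v w he hs1)]
  · congr 1
    push_cast
    ring
  · rw [map_intCast, map_intCast]
    push_cast
    linear_combination hs
  · obtain ⟨a, b, rfl⟩ := hspan z
    exact ⟨a - b, b, by rw [map_sub]; ring⟩

/-- The element θ = (1 + s)/2 satisfies θ(θ - 1) = N, a unit, so θ and θ - 1 are units and the
residue of θ lies outside 𝔽₂. Hence 1 and θ generate the integers, with discriminant 1 + 4N. -/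
lemma valued_localDiscriminant_of_five (h2 : natGenerator v = 2)
    (he : ∀ x, Valued.v (completionMap v w x) = Valued.v x) {N : ℤ} (hN : Odd N)
    {s : w.adicCompletion K} (hs : s ^ 2 = (1 + 4 * N : ℤ))
    (hspan : ∀ z, ∃ a b, z = completionMap v w a + completionMap v w b * s) :
    Valued.v (localDiscriminant v w) = 1 := by
  obtain ⟨θ, hθ⟩ : ∃ θ : w.adicCompletion K, θ = (1 + s) / 2 := ⟨_, rfl⟩
  have hs' : s = 2 * θ - 1 := by rw [hθ]; field_simp; ring
  have hθ2 : θ ^ 2 = θ + N := by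
    refine mul_left_cancel₀ (by norm_num : (4 : w.adicCompletion K) ≠ 0) ?_
    rw [hs'] at hs
    push_cast at hs
    linear_combination hs
  have hV2 : Valued.v (2 : w.adicCompletion K) < 1 := by
    have := he 2
    rw [map_ofNat, valued_two_of_dyadic v h2] at this
    rw [this]
    exact exp_neg_one_lt_one
  have hN1 : Valued.v (N : w.adicCompletion K) = 1 := by
    rw [← map_intCast (completionMap v w), he, valued_intCast_of_odd v h2 hN]
  have hprod : Valued.v θ * Valued.v (θ - 1) = 1 := by
    rw [← map_mul, ← hN1]; congr 1; linear_combination hθ2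
  have hle : Valued.v θ ≤ 1 := by
    by_contra! h
    have h1 : Valued.v (θ - 1) = Valued.v θ := by
      rw [Valuation.map_sub_eq_of_lt_left]
      simpa using h
    rw [h1, ← sq] at hprod
    exact h.ne' ((pow_eq_one_iff_of_nonneg zero_le two_ne_zero).mp hprod)
  have hle' : Valued.v (θ - 1) ≤ 1 := (Valuation.map_sub _ _ _).trans (max_le hle (by simp))
  have hθ0 : Valued.v θ = 1 := le_antisymm hle (by
    rw [← hprod]; exact mul_le_of_le_one_right' hle')
  have hθ1 : Valued.v (θ - 1) = 1 := by rwa [hθ0, one_mul] at hprod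
  have hunr : ∀ u, Valued.v u ≤ 1 → Valued.v (completionMap v w u + θ) = 1 := fun u hu => by
    rcases valued_lt_one_or_of_dyadic v h2 hu with h | h
    · rw [Valuation.map_add_eq_of_lt_right, hθ0]
      rwa [he, hθ0]
    · rw [show completionMap v w u + θ = (completionMap v w (u - 1) + 2) + (θ - 1) by
        rw [map_sub, map_one]; ring, Valuation.map_add_eq_of_lt_right, hθ1]
      rw [hθ1]
      exact Valuation.map_add_lt _ (by rwa [he]) hV2
  rw [valued_localDiscriminant v w (t := 1) (N := ((-N : ℤ) : v.adicCompletion ℚ)) (θ := θ)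
    (by simp) (valued_intCast_le_one v _) (by rw [hθ2]; simp) (fun z => ?_)
    (valued_le_one_of_unramified v w he hunr)]
  · rw [show (1 : v.adicCompletion ℚ) ^ 2 - 4 * ((-N : ℤ) : v.adicCompletion ℚ) =
      ((1 + 2 * (2 * N) : ℤ) : v.adicCompletion ℚ) by push_cast; ring]
    exact valued_intCast_of_odd v h2 ⟨2 * N, by ring⟩
  · obtain ⟨a, b, rfl⟩ := hspan z
    exact ⟨a - b, 2 * b, by rw [map_sub, map_mul, map_ofNat, hs']; ring⟩

/-- A ramified quadratic extension of ℚ₂ keeps the residue field 𝔽₂: modulo the maximal ideal a + bθ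
is a. -/
lemma valued_lt_one_or_of_ramified (h2 : natGenerator v = 2)
    (he : ∀ x, Valued.v (completionMap v w x) = Valued.v x ^ 2) {θ : w.adicCompletion K}
    (hθ : Valued.v θ = exp (-1))
    (hspan : ∀ z, ∃ a b, z = completionMap v w a + completionMap v w b * θ)
    (z : w.adicCompletion K) (hz : Valued.v z ≤ 1) : Valued.v z < 1 ∨ Valued.v (z - 1) < 1 := by
  obtain ⟨a, b, rfl⟩ := hspan z
  obtain ⟨ha, hb⟩ := valued_le_one_of_ramified v w he hθ a b hz
  have h1 : Valued.v (completionMap v w b * θ) < 1 := by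
    rw [map_mul, hθ]
    exact (mul_le_of_le_one_left' (valued_completionMap_le_one v w hb)).trans_lt exp_neg_one_lt_one
  have key : ∀ x, Valued.v x < 1 → Valued.v (completionMap v w x) < 1 := fun x hx => by
    rw [he]; exact pow_lt_one₀ zero_le hx two_ne_zero
  refine (valued_lt_one_or_of_dyadic v h2 ha).imp (fun h => ?_) (fun h => ?_)
  · exact Valuation.map_add_lt _ (key _ h) h1
  · rw [add_sub_right_comm, ← map_one (completionMap v w), ← map_sub]
    exact Valuation.map_add_lt _ (key _ h) h1

end Ramified

end MKT

namespace MKT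

open HeightOneSpectrum WithZero Rat.HeightOneSpectrum WeierstrassCurve

/-! ### The local terms, by the behaviour of the prime. -/

section Terms

variable {K : Type*} [Field K] [NumberField K] (hK : Module.finrank ℚ K = 2)
  (v : HeightOneSpectrum (𝓞 ℚ)) (w : HeightOneSpectrum (𝓞 K)) [w.asIdeal.LiesOver v.asIdeal]
  {n : ℤ} (hn : Squarefree n) (hn1 : n ≠ 1) {S : 𝓞 K} (hS : S ^ 2 = n)

include hK in
lemma valued_completionMap_of_mem_sq (h : (natGenerator v : 𝓞 K) ∈ w.asIdeal ^ 2)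
    (x : v.adicCompletion ℚ) : Valued.v (completionMap v w x) = Valued.v x ^ 2 :=
  valued_completionMap v w (valuation_natGenerator v)
    (valuation_natGenerator_of_sq_mem v w hK h) x

lemma valued_completionMap_of_isInertIn (h : IsInertIn K v)
    (x : v.adicCompletion ℚ) : Valued.v (completionMap v w x) = Valued.v x := by
  rw [valued_completionMap v w (valuation_natGenerator v)
    (valuation_natGenerator_of_isInertIn v w h) x, pow_one]

include hS in
lemma sqrt_completion_sq : algebraMap K (w.adicCompletion K) (S : K) ^ 2 = n := by
  rw [← map_pow, ← map_pow, hS, map_intCast, map_intCast]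

include hK hn hn1 hS in
lemma exists_eq_completionMap_add_mul_sqrt (z : w.adicCompletion K) :
    ∃ a b, z = completionMap v w a +
      completionMap v w b * algebraMap K (w.adicCompletion K) (S : K) :=
  exists_eq_completionMap_add_mul v w (exists_eq_add_mul hK
    (sqrt_notMem_range hn hn1 (by rw [← map_pow, hS, map_intCast]))) z

include hK hn hn1 hS in
-- The twist's n⁶ and the sixth power of the discriminant, which is 4n up to units, cancel; the
-- Tamagawa quotient is 1 · 4 / 1.
theorem localTerm_of_odd_dvd (h2 : natGenerator v ≠ 2) (h : (natGenerator v : ℤ) ∣ n) :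
    localTerm v w curveE₁ (n : ℚ) = 2 := by
  have hram := natGenerator_mem_sq_of_dvd v w hn hS h
  have he := valued_completionMap_of_mem_sq hK v w hram
  have hV2 := valued_two_of_odd v h2
  have hVn := valued_intCast_of_dvd v hn h
  have hs := sqrt_completion_sq w hS
  have hV2w : Valued.v (2 : w.adicCompletion K) = 1 := by
    rw [← map_ofNat (completionMap v w), he, hV2, one_pow]
  have hs1 : Valued.v (algebraMap K (w.adicCompletion K) (S : K)) = exp (-1) := by
    have := congrArg Valued.v hs
    rw [← map_intCast (completionMap v w), he, hVn, map_pow] at this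
    exact (pow_left_inj₀ zero_le zero_le two_ne_zero).mp this
  have hd := valued_localDiscriminant_of_sqrt he hs hs1
    (exists_eq_completionMap_add_mul_sqrt hK v w hn hn1 hS)
  rw [show (4 : v.adicCompletion ℚ) * n = 2 * 2 * n by norm_num, map_mul, map_mul, hV2, hVn,
    one_mul, one_mul] at hd
  have hV2' := hV2
  have hVn' := hVn
  rw [← valuation_maximalIdeal_eq_valued] at hV2' hVn'
  rw [localTerm_curveE₁_eq v w (a := 0) (b := -1) (c := 0) (d := -1) (m := 0) (f := 1)
    (isMinimal_congruentCurve_one_of_valued_two v hV2) (isMinimal_congruentCurve_of_odd hV2' hVn')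
    (isMinimal_congruentCurve_one_of_valued_two w hV2w)
    (tamagawaFactor_congruentCurve_one_of_valued_two v hV2)
    (tamagawaFactor_congruentCurve_of_odd hV2' hVn')
    (tamagawaFactor_congruentCurve_one_of_valued_two w hV2w) (by rw [hV2, exp_zero]) hVn
    (by rw [hV2w, exp_zero]) hd (by rw [absNorm_of_sq_mem v w hK hram, pow_one]) (by norm_num)]
  rw [show (((1 : ℕ) : ℝ) * (4 : ℕ) / (1 : ℕ) * (natGenerator v : ℝ) ^ (0 : ℤ)) = 2 ^ (2 : ℝ) by
    norm_num, Real.logb_rpow (by norm_num) (by norm_num)]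

include hK hn hn1 hS in
-- The discriminant of K_w is a unit, and the residue degree 2 balances the two discriminants below;
-- the Tamagawa quotient is 2 · 2 / 2.
theorem localTerm_of_five (h2 : natGenerator v = 2) {N : ℤ} (hN : Odd N) (hnN : n = 1 + 4 * N)
    (hin : IsInertIn K v) : localTerm v w curveE₁ (n : ℚ) = 1 := by
  have he := valued_completionMap_of_isInertIn v w hin
  have hV2 := valued_two_of_dyadic v h2
  have hVn := valued_intCast_of_odd v h2 (n := n) ⟨2 * N, by rw [hnN]; ring⟩
  have hs := sqrt_completion_sq w hS
  have hV2w : Valued.v (2 : w.adicCompletion K) = exp (-1) := by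
    rw [← map_ofNat (completionMap v w), he, hV2]
  have hd := valued_localDiscriminant_of_five h2 he hN (hnN ▸ hs)
    (exists_eq_completionMap_add_mul_sqrt hK v w hn hn1 hS)
  have hV2' := hV2
  have hVn' := hVn
  have hV2w' := hV2w
  rw [← valuation_maximalIdeal_eq_valued] at hV2' hVn' hV2w'
  rw [localTerm_curveE₁_eq v w (a := -1) (b := 0) (c := -1) (d := 0) (m := 0) (f := 2)
    (isMinimal_congruentCurve_of_unit hV2' (map_one _)) (isMinimal_congruentCurve_of_unit hV2' hVn')
    (isMinimal_congruentCurve_of_unit hV2w' (map_one _))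
    (tamagawaFactor_congruentCurve_of_unit hV2' (map_one _))
    (tamagawaFactor_congruentCurve_of_unit hV2' hVn')
    (tamagawaFactor_congruentCurve_of_unit hV2w' (map_one _)) hV2 (by rw [hVn, exp_zero])
    hV2w (by rw [hd, exp_zero]) (absNorm_of_isInertIn v w hK hin) (by norm_num)]
  rw [show (((2 : ℕ) : ℝ) * (2 : ℕ) / (2 : ℕ) * (natGenerator v : ℝ) ^ (0 : ℤ)) = 2 ^ (1 : ℝ) by
    norm_num, Real.logb_rpow (by norm_num) (by norm_num)]

include hK hn hn1 hS in
-- The norm exponents add to -2 + 0 + 2 + 2 = 2, so m = 1 and the argument of the logarithm is (2 ·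
-- 2 / c) · 2.
lemma localTerm_of_three_mod_four (h2 : natGenerator v = 2) {j : ℤ} (hj : n = 3 + 4 * j) {c : ℕ}
    (hc : (congruentCurve (1 : w.adicCompletion K)).tamagawaFactor (w.adicCompletionIntegers K) = c) :
    localTerm v w curveE₁ (n : ℚ) = Real.logb 2 (8 / c) := by
  have hram := natGenerator_mem_sq_of_three v w h2 (hj ▸ hS)
  have he := valued_completionMap_of_mem_sq hK v w hram
  have hV2 := valued_two_of_dyadic v h2
  have hVn := valued_intCast_of_odd v h2 (n := n) ⟨1 + 2 * j, by rw [hj]; ring⟩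
  have hs := sqrt_completion_sq w hS
  have hV2w : Valued.v (2 : w.adicCompletion K) = exp (-2) := by
    rw [← map_ofNat (completionMap v w), he, hV2, ← exp_nsmul]; rfl
  have hV2' := hV2
  have hVn' := hVn
  have hV2w' := hV2w
  rw [← valuation_maximalIdeal_eq_valued] at hV2' hVn' hV2w'
  have hs1 := (exists_uniformizer_one_add hV2w' (hj ▸ hs)).1
  rw [valuation_maximalIdeal_eq_valued] at hs1
  have hd := valued_localDiscriminant_of_one_add_sqrt he hs hs1
    (exists_eq_completionMap_add_mul_sqrt hK v w hn hn1 hS)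
  rw [show (4 : v.adicCompletion ℚ) * n = 2 * 2 * n by norm_num, map_mul, map_mul, hV2, hVn,
    mul_one, ← exp_add] at hd
  rw [localTerm_curveE₁_eq v w (a := -1) (b := 0) (c := -2) (d := -1 + -1) (m := 1) (f := 1)
    (isMinimal_congruentCurve_of_unit hV2' (map_one _)) (isMinimal_congruentCurve_of_unit hV2' hVn')
    (isMinimal_congruentCurve_one_of_three hV2w' (hj ▸ hs))
    (tamagawaFactor_congruentCurve_of_unit hV2' (map_one _))
    (tamagawaFactor_congruentCurve_of_unit hV2' hVn') hc hV2 (by rw [hVn, exp_zero])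
    hV2w hd (by rw [absNorm_of_sq_mem v w hK hram, pow_one]) (by norm_num), h2]
  congr 1
  push_cast
  ring

include hK hn hn1 hS in
-- The norm exponents add to -2 - 1 + 3 + 2 = 2, so m = 1; the twist now has Tamagawa factor 4,
-- giving (2 · 4 / c) · 2.
lemma localTerm_of_two_mod_four (h2 : natGenerator v = 2) {j : ℤ} (hj : n = 2 * (1 + 2 * j)) {c : ℕ}
    (hc : (congruentCurve (1 : w.adicCompletion K)).tamagawaFactor (w.adicCompletionIntegers K) = c) :
    localTerm v w curveE₁ (n : ℚ) = Real.logb 2 (16 / c) := by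
  have hdvd : (natGenerator v : ℤ) ∣ n := ⟨1 + 2 * j, by rw [h2, hj]; rfl⟩
  have hram := natGenerator_mem_sq_of_dvd v w hn hS hdvd
  have he := valued_completionMap_of_mem_sq hK v w hram
  have hV2 := valued_two_of_dyadic v h2
  have hVn := valued_intCast_of_dvd v hn hdvd
  have hs := sqrt_completion_sq w hS
  have hV2w : Valued.v (2 : w.adicCompletion K) = exp (-2) := by
    rw [← map_ofNat (completionMap v w), he, hV2, ← exp_nsmul]; rfl
  have hV2' := hV2
  have hVn' := hVn
  have hV2w' := hV2w
  rw [← valuation_maximalIdeal_eq_valued] at hV2' hVn' hV2w'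
  have hs1 := valuation_sqrt_of_two_mul hV2w' (hj ▸ hs)
  rw [valuation_maximalIdeal_eq_valued] at hs1
  have hd := valued_localDiscriminant_of_sqrt he hs hs1
    (exists_eq_completionMap_add_mul_sqrt hK v w hn hn1 hS)
  rw [show (4 : v.adicCompletion ℚ) * n = 2 * 2 * n by norm_num, map_mul, map_mul, hV2, hVn,
    ← exp_add, ← exp_add] at hd
  rw [localTerm_curveE₁_eq v w (a := -1) (b := -1) (c := -2) (d := -1 + -1 + -1) (m := 1) (f := 1)
    (isMinimal_congruentCurve_of_unit hV2' (map_one _))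
    (isMinimal_congruentCurve_of_two_mul hV2' hVn')
    (isMinimal_congruentCurve_one_of_two hV2w' (hj ▸ hs))
    (tamagawaFactor_congruentCurve_of_unit hV2' (map_one _))
    (tamagawaFactor_congruentCurve_of_two_mul hV2' hVn') hc hV2 hVn
    hV2w hd (by rw [absNorm_of_sq_mem v w hK hram, pow_one]) (by norm_num), h2]
  congr 1
  push_cast
  ring

end Terms

end MKT

namespace MKT

open HeightOneSpectrum WithZero Rat.HeightOneSpectrum WeierstrassCurve

/-! ### The terms at 2 in the ramified classes mod 8. -/

section DyadicTerms

variable {K : Type*} [Field K] [NumberField K] (hK : Module.finrank ℚ K = 2)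
  (v : HeightOneSpectrum (𝓞 ℚ)) (w : HeightOneSpectrum (𝓞 K)) [w.asIdeal.LiesOver v.asIdeal]
  (h2 : natGenerator v = 2)
  {n : ℤ} (hn : Squarefree n) (hn1 : n ≠ 1) {S : 𝓞 K} (hS : S ^ 2 = n)

include hK h2 in
lemma valuation_two_of_mem_sq (h : (natGenerator v : 𝓞 K) ∈ w.asIdeal ^ 2) :
    (IsDiscreteValuationRing.maximalIdeal (w.adicCompletionIntegers K)).valuation
      (w.adicCompletion K) (2 : w.adicCompletion K) = exp (-2) := by
  rw [valuation_maximalIdeal_eq_valued, ← map_ofNat (completionMap v w),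
    valued_completionMap_of_mem_sq hK v w h, valued_two_of_dyadic v h2, ← exp_nsmul]
  rfl

lemma exists_sq_eq_of_valuation_lt_one (c : w.adicCompletion K)
    (hc : (IsDiscreteValuationRing.maximalIdeal (w.adicCompletionIntegers K)).valuation
      (w.adicCompletion K) c < 1) : ∃ q, q ^ 2 = 1 + 4 * c := by
  rw [valuation_maximalIdeal_eq_valued] at hc
  exact exists_sq_eq_one_add_four_mul w hc

include hK hn hn1 hS h2 in
theorem localTerm_of_seven {j : ℤ} (hj : n = 7 + 8 * j) : localTerm v w curveE₁ (n : ℚ) = 1 := by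
  have hj' : n = 3 + 4 * (1 + 2 * j) := by rw [hj]; ring
  have hram := natGenerator_mem_sq_of_three v w h2 (hj' ▸ hS)
  rw [localTerm_of_three_mod_four hK v w hn hn1 hS h2 hj'
    (tamagawaFactor_congruentCurve_one_of_seven (valuation_two_of_mem_sq hK v w h2 hram)
      (exists_sq_eq_of_valuation_lt_one w) (hj ▸ sqrt_completion_sq w hS))]
  norm_num

include hK hn hn1 hS h2 in
theorem localTerm_of_three {j : ℤ} (hj : n = 3 + 8 * j) : localTerm v w curveE₁ (n : ℚ) = 2 := by
  have hj' : n = 3 + 4 * (2 * j) := by rw [hj]; ring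
  have hram := natGenerator_mem_sq_of_three v w h2 (hj' ▸ hS)
  have hV2 := valuation_two_of_mem_sq hK v w h2 hram
  have hs := sqrt_completion_sq w hS
  have hs1 := (exists_uniformizer_one_add hV2 (hj' ▸ hs)).1
  rw [valuation_maximalIdeal_eq_valued] at hs1
  have hres := valued_lt_one_or_of_ramified h2 (valued_completionMap_of_mem_sq hK v w hram) hs1
    (fun z => by
      obtain ⟨a, b, rfl⟩ := exists_eq_completionMap_add_mul_sqrt hK v w hn hn1 hS z
      exact ⟨a - b, b, by rw [map_sub]; ring⟩)
  simp only [← valuation_maximalIdeal_eq_valued] at hres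
  rw [localTerm_of_three_mod_four hK v w hn hn1 hS h2 hj'
    (tamagawaFactor_congruentCurve_one_of_three hV2 hres (hj ▸ hs)),
    show (8 / (2 : ℕ) : ℝ) = 2 ^ (2 : ℝ) by norm_num, Real.logb_rpow (by norm_num) (by norm_num)]

include hK hn hn1 hS h2 in
theorem localTerm_of_two {j : ℤ} (hj : n = 2 + 8 * j) : localTerm v w curveE₁ (n : ℚ) = 2 := by
  have hj' : n = 2 * (1 + 2 * (2 * j)) := by rw [hj]; ring
  have hram := natGenerator_mem_sq_of_dvd v w hn hS ⟨1 + 2 * (2 * j), by rw [h2, hj']; rfl⟩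
  rw [localTerm_of_two_mod_four hK v w hn hn1 hS h2 hj'
    (tamagawaFactor_congruentCurve_one_of_two (valuation_two_of_mem_sq hK v w h2 hram)
      (exists_sq_eq_of_valuation_lt_one w) (hj ▸ sqrt_completion_sq w hS)),
    show (16 / (4 : ℕ) : ℝ) = 2 ^ (2 : ℝ) by norm_num, Real.logb_rpow (by norm_num) (by norm_num)]

include hK hn hn1 hS h2 in
theorem localTerm_of_six {j : ℤ} (hj : n = 6 + 8 * j) : localTerm v w curveE₁ (n : ℚ) = 3 := by
  have hj' : n = 2 * (1 + 2 * (1 + 2 * j)) := by rw [hj]; ring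
  have hram := natGenerator_mem_sq_of_dvd v w hn hS ⟨1 + 2 * (1 + 2 * j), by rw [h2, hj']; rfl⟩
  have hV2 := valuation_two_of_mem_sq hK v w h2 hram
  have hs := sqrt_completion_sq w hS
  have hs1 := valuation_sqrt_of_two_mul hV2 (hj' ▸ hs)
  rw [valuation_maximalIdeal_eq_valued] at hs1
  have hres := valued_lt_one_or_of_ramified h2 (valued_completionMap_of_mem_sq hK v w hram) hs1
    (exists_eq_completionMap_add_mul_sqrt hK v w hn hn1 hS)
  simp only [← valuation_maximalIdeal_eq_valued] at hres
  rw [localTerm_of_two_mod_four hK v w hn hn1 hS h2 hj'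
    (tamagawaFactor_congruentCurve_one_of_six hV2 hres (hj ▸ hs)),
    show (16 / (2 : ℕ) : ℝ) = 2 ^ (3 : ℝ) by norm_num, Real.logb_rpow (by norm_num) (by norm_num)]

end DyadicTerms

/-! ### Bad places and the sum over the finite places. -/

section BadPlaces

variable (v : HeightOneSpectrum (𝓞 ℚ))

lemma isBadAt_curveE₁_iff : IsBadAt curveE₁ v ↔ natGenerator v = 2 := by
  have key : ∀ {W : WeierstrassCurve (v.adicCompletion ℚ)},
      (W.minimal (v.adicCompletionIntegers ℚ)).HasGoodReduction (v.adicCompletionIntegers ℚ) ↔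
        Valued.v (W.minimalDiscriminant (v.adicCompletionIntegers ℚ)) = 1 := fun {W} => by
    rw [← valuation_maximalIdeal_eq_valued]
    exact ⟨fun h => h.goodReduction, fun h => ⟨h⟩⟩
  rw [IsBadAt, baseChange_curveE₁, key]
  constructor
  · intro h
    by_contra h2
    have hV2 := valued_two_of_odd v h2
    have := isMinimal_congruentCurve_one_of_valued_two v hV2
    rw [valued_minimalDiscriminant_congruentCurve v one_ne_zero, hV2] at h
    simp at h
  · intro h2 h
    have hV2 := valued_two_of_dyadic v h2
    have hV2' := hV2
    rw [← valuation_maximalIdeal_eq_valued] at hV2'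
    have := isMinimal_congruentCurve_of_unit hV2' (map_one _)
    rw [valued_minimalDiscriminant_congruentCurve v one_ne_zero, hV2, map_one, mul_one] at h
    exact (pow_lt_one₀ zero_le exp_neg_one_lt_one (by norm_num)).ne h

end BadPlaces

section FiniteIndex

variable {K : Type*} [Field K] [NumberField K]

lemma deltaFinite_eq_sum {E : WeierstrassCurve ℚ} {D : ℚ} {T : Finset ℕ} {g : ℕ → ℝ}
    (hT : ∀ p ∈ T, p.Prime) (hS : ∀ v, v ∈ placesS₀ E K ↔ natGenerator v ∈ T)
    (hg : ∀ v, natGenerator v ∈ T → localTerm v (placeAbove K v) E D = g (natGenerator v)) :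
    deltaFinite E D K = ∑ p ∈ T, g p := by
  rw [deltaFinite, ← finsum_mem_coe_finset]
  refine finsum_mem_eq_of_bijOn natGenerator ⟨fun v hv => (hS v).mp hv,
    natGenerator_injective.injOn, fun p hp => ?_⟩ fun v hv => hg v ((hS v).mp hv)
  obtain ⟨v, rfl⟩ := exists_natGenerator_eq (hT p hp)
  exact ⟨v, (hS v).mpr hp, rfl⟩

variable (hK : Module.finrank ℚ K = 2) {n : ℤ} (hn : Squarefree n) (hn1 : n ≠ 1) {S : 𝓞 K}
  (hS : S ^ 2 = n)

include hn in
lemma natGenerator_mem_iff (v : HeightOneSpectrum (𝓞 ℚ)) :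
    natGenerator v ∈ n.natAbs.primeFactors.erase 2 ↔
      natGenerator v ≠ 2 ∧ (natGenerator v : ℤ) ∣ n := by
  rw [Finset.mem_erase, Nat.mem_primeFactors, Int.natCast_dvd]
  have : n.natAbs ≠ 0 := by simpa using hn.ne_zero
  simp [prime_natGenerator v, this]

include hn hn1 hS in
lemma coe_sqrt_notMem_range : (S : K) ∉ (algebraMap ℚ K).range :=
  sqrt_notMem_range hn hn1 (by rw [← map_pow, hS, map_intCast])

include hK hn hn1 hS in
-- Reduction is good, so only ramification counts, and an odd prime dividing the discriminant 4n of
-- X² - n divides n.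
lemma mem_placesS₀_iff_of_odd {v : HeightOneSpectrum (𝓞 ℚ)} (h2 : natGenerator v ≠ 2) :
    v ∈ placesS₀ curveE₁ K ↔ (natGenerator v : ℤ) ∣ n := by
  have hbad : ¬ IsBadAt curveE₁ v := by rwa [isBadAt_curveE₁_iff]
  have hram : IsRamifiedIn K v ↔ (natGenerator v : ℤ) ∣ n := by
    constructor
    · intro h
      by_contra hd
      refine not_isRamifiedIn v hK (x := S) (t := 0) (N := -n) (by rw [hS]; simp)
        (coe_sqrt_notMem_range hn hn1 hS) (fun h' => ?_) h
      have hp := Nat.prime_iff_prime_int.mp (prime_natGenerator v)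
      have h4 : (natGenerator v : ℤ) ∣ 2 ^ 2 * n := by convert h' using 1; ring
      rcases hp.dvd_or_dvd h4 with h4 | h4
      · have := hp.dvd_of_dvd_pow h4
        exact h2 ((Nat.prime_dvd_prime_iff_eq (prime_natGenerator v) Nat.prime_two).mp
          (by exact_mod_cast this))
      · exact hd h4
    · intro h
      exact isRamifiedIn_of_mem_sq v _ (natGenerator_mem_sq_of_dvd v (placeAbove K v) hn hS h)
  simp only [placesS₀, placesS, Set.mem_ofPred_eq, hbad, or_false]
  rw [← hram]
  tauto

lemma mem_placesS₀_iff_of_dyadic {v : HeightOneSpectrum (𝓞 ℚ)} (h2 : natGenerator v = 2) :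
    v ∈ placesS₀ curveE₁ K ↔ IsRamifiedIn K v ∨ IsInertIn K v := by
  have hbad : IsBadAt curveE₁ v := by rwa [isBadAt_curveE₁_iff]
  simp [placesS₀, placesS, hbad]

include hK hn hn1 hS in
theorem deltaFinite_of_notMem
    (h : ∀ v : HeightOneSpectrum (𝓞 ℚ), natGenerator v = 2 → ¬ (IsRamifiedIn K v ∨ IsInertIn K v)) :
    deltaFinite curveE₁ (n : ℚ) K = 2 * oddPrimeCount n := by
  rw [deltaFinite_eq_sum (T := n.natAbs.primeFactors.erase 2) (g := fun _ => 2)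
    (fun p hp => Nat.prime_of_mem_primeFactors (Finset.mem_of_mem_erase hp)) (fun v => ?_)
    (fun v hv => ?_)]
  · simp [oddPrimeCount, mul_comm]
  · rw [natGenerator_mem_iff hn]
    by_cases h2 : natGenerator v = 2
    · rw [mem_placesS₀_iff_of_dyadic h2]
      simp [h v h2, h2]
    · rw [mem_placesS₀_iff_of_odd hK hn hn1 hS h2]
      simp [h2]
  · rw [natGenerator_mem_iff hn] at hv
    exact localTerm_of_odd_dvd hK v _ hn hn1 hS hv.1 hv.2

include hK hn hn1 hS in
theorem deltaFinite_of_mem {t : ℝ}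
    (h : ∀ v : HeightOneSpectrum (𝓞 ℚ), natGenerator v = 2 → IsRamifiedIn K v ∨ IsInertIn K v)
    (ht : ∀ v : HeightOneSpectrum (𝓞 ℚ), natGenerator v = 2 →
      localTerm v (placeAbove K v) curveE₁ (n : ℚ) = t) :
    deltaFinite curveE₁ (n : ℚ) K = t + 2 * oddPrimeCount n := by
  rw [deltaFinite_eq_sum (T := insert 2 (n.natAbs.primeFactors.erase 2))
    (g := fun p => if p = 2 then t else 2) (fun p hp => ?_) (fun v => ?_) (fun v hv => ?_)]
  · rw [Finset.sum_insert (Finset.notMem_erase _ _), if_pos rfl,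
      Finset.sum_congr rfl fun p hp => if_neg (Finset.ne_of_mem_erase hp)]
    simp [oddPrimeCount, mul_comm]
  · rcases Finset.mem_insert.mp hp with rfl | hp
    · exact Nat.prime_two
    · exact Nat.prime_of_mem_primeFactors (Finset.mem_of_mem_erase hp)
  · rw [Finset.mem_insert, natGenerator_mem_iff hn]
    by_cases h2 : natGenerator v = 2
    · rw [mem_placesS₀_iff_of_dyadic h2]
      simp [h v h2, h2]
    · rw [mem_placesS₀_iff_of_odd hK hn hn1 hS h2]
      simp [h2]
  · rw [Finset.mem_insert, natGenerator_mem_iff hn] at hv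
    by_cases h2 : natGenerator v = 2
    · rw [if_pos h2, ht v h2]
    · rw [if_neg h2]
      have hv := hv.resolve_left h2
      exact localTerm_of_odd_dvd hK v _ hn hn1 hS hv.1 hv.2

end FiniteIndex

/-! ### The real place. -/

section InfiniteIndex

variable {K : Type*} [Field K] [NumberField K] {n : ℤ} {s : K} (hs : s ^ 2 = n)

lemma curveE₁_Δ : curveE₁.Δ = 64 := by
  simp only [curveE₁, WeierstrassCurve.Δ, WeierstrassCurve.b₂, WeierstrassCurve.b₄,
    WeierstrassCurve.b₆, WeierstrassCurve.b₈]
  norm_num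

lemma rat_isReal (v : InfinitePlace ℚ) : v.IsReal := by
  rw [Subsingleton.elim v Rat.infinitePlace]
  exact Rat.isReal_infinitePlace

include hs in
-- A real place of K would make the negative number n a square in ℝ.
theorem deltaInfinite_of_neg (hn : n < 0) : deltaInfinite curveE₁ K = 1 := by
  rw [deltaInfinite, Set.ncard_eq_one]
  refine ⟨Rat.infinitePlace, Set.eq_singleton_iff_unique_mem.mpr
    ⟨?_, fun v _ => Subsingleton.elim _ _⟩⟩
  refine ⟨rat_isReal _, fun h => ?_, ?_⟩
  · obtain ⟨φ⟩ : Nonempty (InfinitePlace K) := inferInstance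
    have hφ := h φ (Subsingleton.elim _ _)
    rw [InfinitePlace.isUnramified_iff] at hφ
    rcases hφ with hφ | hφ
    · have h1 := congrArg (InfinitePlace.embedding_of_isReal hφ) hs
      rw [map_pow, map_intCast] at h1
      have : (n : ℝ) < 0 := by exact_mod_cast hn
      nlinarith [sq_nonneg (InfinitePlace.embedding_of_isReal hφ s)]
    · exact (InfinitePlace.not_isComplex_iff_isReal.mpr (rat_isReal _)) hφ
  · rw [curveE₁_Δ]; simp

include hs in
theorem deltaInfinite_of_pos (hK : Module.finrank ℚ K = 2) (hsQ : s ∉ (algebraMap ℚ K).range)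
    (hn : 0 < n) : deltaInfinite curveE₁ K = 0 := by
  rw [deltaInfinite, Set.ncard_eq_zero]
  refine Set.eq_empty_iff_forall_notMem.mpr ?_
  rintro v ⟨-, hv, -⟩
  refine hv fun φ _ => ?_
  rw [InfinitePlace.isUnramified_iff]
  refine .inl (InfinitePlace.isReal_iff.mpr (RingHom.ext fun x => ?_))
  obtain ⟨a, b, rfl⟩ := exists_eq_add_mul hK hsQ x
  have h1 : (φ.embedding s) ^ 2 = ((Real.sqrt n : ℝ) : ℂ) ^ 2 := by
    rw [← map_pow, hs, map_intCast, ← Complex.ofReal_pow,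
      Real.sq_sqrt (by exact_mod_cast hn.le)]
    simp
  have h2 : (starRingEnd ℂ) (φ.embedding s) = φ.embedding s := by
    rcases sq_eq_sq_iff_eq_or_eq_neg.mp h1 with h | h <;> rw [h] <;> simp
  simp [ComplexEmbedding.conjugate_coe_eq, h2]

end InfiniteIndex

end MKT

namespace MKT

open Rat.HeightOneSpectrum

/-! ### The finite part for each class of n mod 8. -/

section Index

variable {K : Type*} [Field K]

lemma exists_sqrt_ringOfIntegers {n : ℤ} {s : K} (hs : s ^ 2 = n) :
    ∃ S : 𝓞 K, S ^ 2 = n := by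
  have hint : s ∈ integralClosure ℤ K := by
    refine ⟨.X ^ 2 - .C n, by monicity!, ?_⟩
    rw [Polynomial.eval₂_sub, Polynomial.eval₂_pow, Polynomial.eval₂_X, Polynomial.eval₂_C, hs]
    simp
  obtain ⟨S, rfl⟩ : ∃ S : 𝓞 K, algebraMap (𝓞 K) K S = s := ⟨⟨s, hint⟩, rfl⟩
  refine ⟨S, RingOfIntegers.coe_injective ?_⟩
  rw [map_pow, map_intCast, hs]

variable [NumberField K]

lemma exists_half_one_add_sqrt {n N : ℤ} (hN : n = 1 + 4 * N) {s : K} (hs : s ^ 2 = n)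
    (hsQ : s ∉ (algebraMap ℚ K).range) :
    ∃ Θ : 𝓞 K, Θ ^ 2 = Θ + N ∧ (Θ : K) ∉ (algebraMap ℚ K).range := by
  have hθ : ((1 + s) / 2) ^ 2 = (1 + s) / 2 + N := by
    rw [hN] at hs
    push_cast at hs
    field_simp
    linear_combination hs
  have hint : (1 + s) / 2 ∈ integralClosure ℤ K := by
    refine ⟨.X ^ 2 - .X - .C N, by monicity!, ?_⟩
    rw [Polynomial.eval₂_sub, Polynomial.eval₂_sub, Polynomial.eval₂_pow, Polynomial.eval₂_X,
      Polynomial.eval₂_C, hθ]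
    simp
  obtain ⟨Θ, hΘ⟩ : ∃ Θ : 𝓞 K, algebraMap (𝓞 K) K Θ = (1 + s) / 2 := ⟨⟨_, hint⟩, rfl⟩
  refine ⟨Θ, RingOfIntegers.coe_injective ?_, ?_⟩
  · rw [map_pow, map_add, map_intCast, hΘ, hθ]
  · rintro ⟨q, hq⟩
    refine hsQ ⟨2 * q - 1, ?_⟩
    rw [map_sub, map_mul, hq.trans hΘ, map_one, map_ofNat]
    ring

variable (hK : Module.finrank ℚ K = 2) {n : ℤ} (hn : Squarefree n) (hn1 : n ≠ 1) {s : K}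
  (hs : s ^ 2 = n)

include hK hn hn1 hs

theorem deltaFinite_of_one_mod_eight (h : n % 8 = 1) :
    deltaFinite curveE₁ (n : ℚ) K = 2 * oddPrimeCount n := by
  have hsQ := sqrt_notMem_range hn hn1 hs
  obtain ⟨S, hS⟩ := exists_sqrt_ringOfIntegers hs
  obtain ⟨j, rfl⟩ : ∃ j, n = 1 + 4 * (2 * j) := ⟨n / 8, by omega⟩
  obtain ⟨Θ, hΘ, hΘQ⟩ := exists_half_one_add_sqrt rfl hs hsQ
  -- Here 2 splits: Θ = (1 + √n)/2 has odd discriminant, and Θ(Θ - 1) = 2j lies in (2) although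
  -- neither factor does.
  refine deltaFinite_of_notMem hK hn hn1 hS fun v h2 => not_or.mpr ⟨?_, ?_⟩
  · refine not_isRamifiedIn v hK (x := Θ) (t := 1) (N := -(2 * j)) ?_ hΘQ ?_
    · rw [hΘ]; push_cast; ring
    · rw [h2]; push_cast; omega
  · exact not_isInertIn_of_one v hK h2 (even_two_mul j) hΘ hΘQ

theorem deltaFinite_of_five_mod_eight (h : n % 8 = 5) :
    deltaFinite curveE₁ (n : ℚ) K = 1 + 2 * oddPrimeCount n := by
  have hsQ := sqrt_notMem_range hn hn1 hs
  obtain ⟨S, hS⟩ := exists_sqrt_ringOfIntegers hs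
  obtain ⟨j, hj⟩ : ∃ j, n = 1 + 4 * (2 * j + 1) := ⟨n / 8, by omega⟩
  obtain ⟨Θ, hΘ, -⟩ := exists_half_one_add_sqrt hj hs hsQ
  have hin : ∀ v : HeightOneSpectrum (𝓞 ℚ), natGenerator v = 2 → IsInertIn K v := fun v h2 =>
    isInertIn_of_five v hK h2 ⟨j, rfl⟩ hΘ
  exact deltaFinite_of_mem hK hn hn1 hS (fun v h2 => .inr (hin v h2)) fun v h2 =>
    localTerm_of_five hK v _ hn hn1 hS h2 ⟨j, rfl⟩ hj (hin v h2)

theorem deltaFinite_of_seven_mod_eight (h : n % 8 = 7) :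
    deltaFinite curveE₁ (n : ℚ) K = 1 + 2 * oddPrimeCount n := by
  obtain ⟨S, hS⟩ := exists_sqrt_ringOfIntegers hs
  obtain ⟨j, hj⟩ : ∃ j, n = 7 + 8 * j := ⟨n / 8, by omega⟩
  have hS' : S ^ 2 = (3 + 4 * (1 + 2 * j) : ℤ) := by rw [hS, hj]; push_cast; ring
  exact deltaFinite_of_mem hK hn hn1 hS
    (fun v h2 => .inl (isRamifiedIn_of_mem_sq v _
      (natGenerator_mem_sq_of_three v (placeAbove K v) h2 hS')))
    fun v h2 => localTerm_of_seven hK v _ h2 hn hn1 hS hj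

theorem deltaFinite_of_three_mod_eight (h : n % 8 = 3) :
    deltaFinite curveE₁ (n : ℚ) K = 2 + 2 * oddPrimeCount n := by
  obtain ⟨S, hS⟩ := exists_sqrt_ringOfIntegers hs
  obtain ⟨j, hj⟩ : ∃ j, n = 3 + 8 * j := ⟨n / 8, by omega⟩
  have hS' : S ^ 2 = (3 + 4 * (2 * j) : ℤ) := by rw [hS, hj]; push_cast; ring
  exact deltaFinite_of_mem hK hn hn1 hS
    (fun v h2 => .inl (isRamifiedIn_of_mem_sq v _
      (natGenerator_mem_sq_of_three v (placeAbove K v) h2 hS')))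
    fun v h2 => localTerm_of_three hK v _ h2 hn hn1 hS hj

theorem deltaFinite_of_two_mod_eight (h : n % 8 = 2) :
    deltaFinite curveE₁ (n : ℚ) K = 2 + 2 * oddPrimeCount n := by
  obtain ⟨S, hS⟩ := exists_sqrt_ringOfIntegers hs
  obtain ⟨j, hj⟩ : ∃ j, n = 2 + 8 * j := ⟨n / 8, by omega⟩
  exact deltaFinite_of_mem hK hn hn1 hS
    (fun v h2 => .inl (isRamifiedIn_of_mem_sq v _
      (natGenerator_mem_sq_of_dvd v (placeAbove K v) hn hS (by rw [h2]; push_cast; omega))))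
    fun v h2 => localTerm_of_two hK v _ h2 hn hn1 hS hj

theorem deltaFinite_of_six_mod_eight (h : n % 8 = 6) :
    deltaFinite curveE₁ (n : ℚ) K = 3 + 2 * oddPrimeCount n := by
  obtain ⟨S, hS⟩ := exists_sqrt_ringOfIntegers hs
  obtain ⟨j, hj⟩ : ∃ j, n = 6 + 8 * j := ⟨n / 8, by omega⟩
  exact deltaFinite_of_mem hK hn hn1 hS
    (fun v h2 => .inl (isRamifiedIn_of_mem_sq v _
      (natGenerator_mem_sq_of_dvd v (placeAbove K v) hn hS (by rw [h2]; push_cast; omega))))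
    fun v h2 => localTerm_of_six hK v _ h2 hn hn1 hS hj

end Index

end MKT

theorem lemma4p2 (n : ℤ) (hn : Squarefree n) (hn1 : n ≠ 1)
    (K : Type*) [Field K] [NumberField K]
    (hK : Module.finrank ℚ K = 2) (hs : ∃ s : K, s ^ 2 = (n : K)) :
    (0 < n → n ≡ 1 [ZMOD 8] →
      MKT.mktIndex MKT.curveE₁ (n : ℚ) K = 2 * MKT.oddPrimeCount n) ∧
    (0 < n → (n ≡ 5 [ZMOD 8] ∨ n ≡ 7 [ZMOD 8]) →
      MKT.mktIndex MKT.curveE₁ (n : ℚ) K = 1 + 2 * MKT.oddPrimeCount n) ∧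
    (0 < n → n ≡ 6 [ZMOD 8] →
      MKT.mktIndex MKT.curveE₁ (n : ℚ) K = 3 + 2 * MKT.oddPrimeCount n) ∧
    (0 < n → (n ≡ 2 [ZMOD 8] ∨ n ≡ 3 [ZMOD 8]) →
      MKT.mktIndex MKT.curveE₁ (n : ℚ) K = 2 + 2 * MKT.oddPrimeCount n) ∧
    (n < 0 → n ≡ 1 [ZMOD 8] →
      MKT.mktIndex MKT.curveE₁ (n : ℚ) K = 1 + 2 * MKT.oddPrimeCount n) ∧
    (n < 0 → (n ≡ 5 [ZMOD 8] ∨ n ≡ 7 [ZMOD 8]) →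
      MKT.mktIndex MKT.curveE₁ (n : ℚ) K = 2 + 2 * MKT.oddPrimeCount n) ∧
    (n < 0 → (n ≡ 2 [ZMOD 8] ∨ n ≡ 3 [ZMOD 8]) →
      MKT.mktIndex MKT.curveE₁ (n : ℚ) K = 3 + 2 * MKT.oddPrimeCount n) ∧
    (n < 0 → n ≡ 6 [ZMOD 8] →
      MKT.mktIndex MKT.curveE₁ (n : ℚ) K = 4 + 2 * MKT.oddPrimeCount n) := by
  obtain ⟨s, hs⟩ := hs
  have hpos := MKT.deltaInfinite_of_pos hs hK (MKT.sqrt_notMem_range hn hn1 hs)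
  have hneg := MKT.deltaInfinite_of_neg hs
  have h1 := MKT.deltaFinite_of_one_mod_eight hK hn hn1 hs
  have h2 := MKT.deltaFinite_of_two_mod_eight hK hn hn1 hs
  have h3 := MKT.deltaFinite_of_three_mod_eight hK hn hn1 hs
  have h5 := MKT.deltaFinite_of_five_mod_eight hK hn hn1 hs
  have h6 := MKT.deltaFinite_of_six_mod_eight hK hn hn1 hs
  have h7 := MKT.deltaFinite_of_seven_mod_eight hK hn hn1 hs
  simp only [MKT.mktIndex]
  refine ⟨fun h hm => ?_, fun h hm => ?_, fun h hm => ?_, fun h hm => ?_, fun h hm => ?_,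
    fun h hm => ?_, fun h hm => ?_, fun h hm => ?_⟩
  · rw [hpos h, h1 hm]; simp
  · rw [hpos h, hm.elim h5 h7]; simp
  · rw [hpos h, h6 hm]; simp
  · rw [hpos h, hm.elim h2 h3]; simp
  · rw [hneg h, h1 hm]; simp
  · rw [hneg h, hm.elim h5 h7]; norm_num; ring
  · rw [hneg h, hm.elim h2 h3]; norm_num; ring
  · rw [hneg h, h6 hm]; norm_num; ring
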